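/- Let $d\ge 1$, let $\Omega\subset\mathbb{R}^d$ be a bounded domain with Lipschitz boundary, let $\lambda\in(0,1]$ and $u\in H^2(\Omega)\cap C^{0,\lambda}(\overline\Omega)$. For all $M_0,\eta_0,\Theta_0\in\mathbb{R}$ and $\alpha_0>0$ there is a constant $C>0$, depending only on $d,\Omega,\lambda,u,M_0,\eta_0,\Theta_0,\alpha_0$, such that the following holds. \emph{Exact problem.} Let $\alpha,\sigma\in L^\infty(\Omega)$ with $0<\alpha_{\min}\le\alpha$ and $0\le\sigma$ a.e., let $f\in L^2(\Omega)$, let $$a(w,v)=\int_\Omega \alpha\,\nabla w\cdot\nabla v+\sigma wv\,dx,\qquad \ell(v)=\int_\Omega f v\,dx,$$ let $V$ be a closed subspace with $H^1_0(\Omega)\subset V\subset H^1(\Omega)$ on which $a$ is coercive, and let $u\in V$ satisfy $a(u,v)=\ell(v)$ for all $v\in V$. Assume that $\bigl(\tfrac{\partial u}{\partial\nu}v\bigr)|_{\partial\Omega}=0$ (a.e. on $\partial\Omega$, in the sense of traces) for all $v\in V$. \emph{Inexact problem.} Let $\tilde\alpha,\tilde\sigma\in L^\infty(\Omega)$ with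 $\alpha_0\le\tilde\alpha_{\min}\le\tilde\alpha$ and $0\le\tilde\sigma$ a.e., let $\tilde f\in L^2(\Omega)$, define $\tilde a$ and $\tilde\ell$ as above with $\tilde\alpha,\tilde\sigma,\tilde f$, and assume $\tilde\alpha-\alpha\in W^{1,\infty}(\Omega)$. \emph{Data.} Let $B_1,\dots,B_m\subset\Omega$ be open and nonempty and let $K_i\supset B_i$ be bounded convex sets with $\Omega\subset\bigcup_{i}\overline{K_i}$. Let $p_i\in B_i$ and put $b_i=u(p_i)$. Let $$M=\max_{x\in\Omega}|\{i: x\in K_i\}|,\quad r=\max_i\operatorname{diam}B_i,\quad R=\max_i\operatorname{diam}K_i,$$ and let $\eta=1$ if $B_i=K_i$ for all $i$, and $\eta=3\max_i |K_i|/|B_i|$ otherwise. Assume that the problem is non-degenerate, with $M\le M_0$ and $\eta\le\eta_0$, and that $\delta>0$ is well-balanced, i.e. for some $\theta\in(0,1]$ with $\theta^{-1}\le\Theta_0$, $$\delta\in\Bigl[\theta\,\frac{R^2M}{\pi^2\tilde\alpha_{\min}},\ \theta^{-1}\frac{R^2M}{\pi^2\tilde\alpha_{\min}}\Bigr].$$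 If $\tilde u\in V$ solves the regularized problem $$\tilde a(\tilde u,v)+\delta^{-1}\sum_{i=1}^m |B_i|\,\frac{1}{|B_i|}\!\int_{B_i}\!\tilde u\;\frac{1}{|B_i|}\!\int_{B_i}\! v=\tilde\ell(v)+\delta^{-1}\sum_{i=1}^m b_i\,|B_i|\,\frac{1}{|B_i|}\!\int_{B_i}\! v\qquad\text{for all } v\in V,$$ then $$\|\tilde u-u\|_{L^2(\Omega)}\le C R^2\bigl(\|\tilde\ell-\ell\|_{L^2(\Omega)}+\|\tilde\sigma-\sigma\|_{L^\infty(\Omega)}+\|\tilde\alpha-\alpha\|_{W^{1,\infty}(\Omega)}\bigr)+C r^\lambda,$$ where $\|\tilde\ell-\ell\|_{L^2(\Omega)}=\|\tilde f-f\|_{L^2(\Omega)}$. -/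

import Mathlib

open MeasureTheory Filter Topology Set
open scoped ENNReal NNReal ContDiff

noncomputable section

namespace PDELearning

/-- The Euclidean space `ℝᵈ`. -/
abbrev Eu (d : ℕ) := EuclideanSpace ℝ (Fin d)

variable {d : ℕ}

/-! ### Domains -/

/-- `Ω` has a Lipschitz boundary: near each boundary point `Ω` is the strict epigraph, in some
direction `e`, of a Lipschitz function of the coordinates orthogonal to `e`. -/
def HasLipschitzBoundary (Ω : Set (Eu d)) : Prop :=
  ∀ z ∈ frontier Ω, ∃ e : Eu d, ‖e‖ = 1 ∧ ∃ (γ : Eu d → ℝ) (L : ℝ≥0) (ε : ℝ),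
    LipschitzWith L γ ∧ 0 < ε ∧
      ∀ x ∈ Metric.ball z ε, (x ∈ Ω ↔ γ (x - inner ℝ e x • e) < inner ℝ e x)

/-- A bounded domain (nonempty, open, connected) with Lipschitz boundary. -/
structure IsLipschitzDomain (Ω : Set (Eu d)) : Prop where
  isOpen : IsOpen Ω
  isConnected : IsConnected Ω
  isBounded : Bornology.IsBounded Ω
  lipschitz : HasLipschitzBoundary Ω

/-! ### Sobolev spaces through weak derivatives -/

/-- A test function on `Ω`: smooth with compact support contained in `Ω`. -/
structure IsTestFunction (Ω : Set (Eu d)) (φ : Eu d → ℝ) : Prop where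
  smooth : ContDiff ℝ ∞ φ
  compact : HasCompactSupport φ
  support : tsupport φ ⊆ Ω

/-- `g` is a weak gradient of `f` on `Ω` (used below only for `f`, `g` in some `Lᵖ(Ω)`). -/
def IsWeakGradient (Ω : Set (Eu d)) (f : Eu d → ℝ) (g : Eu d → Eu d) : Prop :=
  ∀ φ : Eu d → ℝ, IsTestFunction Ω φ → ∀ e : Eu d,
    ∫ x in Ω, f x * fderiv ℝ φ x e = - ∫ x in Ω, inner ℝ (g x) e * φ x

/-- `L²(Ω)`. -/
abbrev L2 (Ω : Set (Eu d)) := Lp ℝ 2 ((volume : Measure (Eu d)).restrict Ω)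

/-- `L²(Ω; ℝᵈ)`. -/
abbrev L2Vec (Ω : Set (Eu d)) := Lp (Eu d) 2 ((volume : Measure (Eu d)).restrict Ω)

theorem IsTestFunction.memLp {Ω : Set (Eu d)} {φ : Eu d → ℝ} (h : IsTestFunction Ω φ) :
    MemLp φ 2 (volume.restrict Ω) :=
  (h.smooth.continuous.memLp_of_hasCompactSupport h.compact).restrict Ω

theorem IsTestFunction.memLp_fderiv {Ω : Set (Eu d)} {φ : Eu d → ℝ} (h : IsTestFunction Ω φ)
    (e : Eu d) : MemLp (fun x => fderiv ℝ φ x e) 2 (volume.restrict Ω) := by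
  have hc : Continuous (fun x => fderiv ℝ φ x e) :=
    (h.smooth.continuous_fderiv (by simp)).clm_apply continuous_const
  exact (hc.memLp_of_hasCompactSupport (h.compact.fderiv_apply ℝ e)).restrict Ω

theorem integrable_value_mul {Ω : Set (Eu d)} (f : L2 Ω) {φ : Eu d → ℝ}
    (h : IsTestFunction Ω φ) (e : Eu d) :
    Integrable (fun x => f x * fderiv ℝ φ x e) (volume.restrict Ω) :=
  (Lp.memLp f).integrable_mul (h.memLp_fderiv e)

theorem integrable_inner_mul {Ω : Set (Eu d)} (g : L2Vec Ω) {φ : Eu d → ℝ}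
    (h : IsTestFunction Ω φ) (e : Eu d) :
    Integrable (fun x => inner ℝ (g x) e * φ x) (volume.restrict Ω) :=
  ((Lp.memLp g).inner_const e).integrable_mul h.memLp

/-- The Sobolev space `H¹(Ω)`: the pairs `(v, ∇v)` in `L²(Ω) × L²(Ω; ℝᵈ)`, with the
topology of the graph norm. -/
def H1 (Ω : Set (Eu d)) : Submodule ℝ (L2 Ω × L2Vec Ω) where
  carrier := {w | IsWeakGradient Ω w.1 w.2}
  zero_mem' := by
    intro φ _ e
    have h1 : (fun x => (((0 : L2 Ω × L2Vec Ω).1 : L2 Ω) : Eu d → ℝ) x * fderiv ℝ φ x e)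
        =ᵐ[volume.restrict Ω] fun _ => 0 := by
      filter_upwards [Lp.coeFn_zero ℝ 2 (volume.restrict Ω)] with x hx
      simp only [Prod.fst_zero, hx, Pi.zero_apply, zero_mul]
    have h2 : (fun x => inner ℝ ((((0 : L2 Ω × L2Vec Ω).2 : L2Vec Ω) : Eu d → Eu d) x) e * φ x)
        =ᵐ[volume.restrict Ω] fun _ => 0 := by
      filter_upwards [Lp.coeFn_zero (Eu d) 2 (volume.restrict Ω)] with x hx
      simp only [Prod.snd_zero, hx, Pi.zero_apply, inner_zero_left, zero_mul]
    rw [integral_congr_ae h1, integral_congr_ae h2]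
    simp
  add_mem' := by
    intro a b ha hb φ hφ e
    have h1 : (fun x => (((a + b).1 : L2 Ω) : Eu d → ℝ) x * fderiv ℝ φ x e)
        =ᵐ[volume.restrict Ω] fun x => a.1 x * fderiv ℝ φ x e + b.1 x * fderiv ℝ φ x e := by
      filter_upwards [Lp.coeFn_add a.1 b.1] with x hx
      simp only [Prod.fst_add, hx, Pi.add_apply]
      ring
    have h2 : (fun x => inner ℝ ((((a + b).2 : L2Vec Ω) : Eu d → Eu d) x) e * φ x)
        =ᵐ[volume.restrict Ω]
        fun x => inner ℝ (a.2 x) e * φ x + inner ℝ (b.2 x) e * φ x := by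
      filter_upwards [Lp.coeFn_add a.2 b.2] with x hx
      simp only [Prod.snd_add, hx, Pi.add_apply, inner_add_left]
      ring
    rw [integral_congr_ae h1, integral_congr_ae h2,
      integral_add (integrable_value_mul a.1 hφ e) (integrable_value_mul b.1 hφ e),
      integral_add (integrable_inner_mul a.2 hφ e) (integrable_inner_mul b.2 hφ e),
      ha φ hφ e, hb φ hφ e]
    ring
  smul_mem' := by
    intro c a ha φ hφ e
    have h1 : (fun x => (((c • a).1 : L2 Ω) : Eu d → ℝ) x * fderiv ℝ φ x e)
        =ᵐ[volume.restrict Ω] fun x => c * (a.1 x * fderiv ℝ φ x e) := by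
      filter_upwards [Lp.coeFn_smul c a.1] with x hx
      simp only [Prod.smul_fst, hx, Pi.smul_apply, smul_eq_mul]
      ring
    have h2 : (fun x => inner ℝ ((((c • a).2 : L2Vec Ω) : Eu d → Eu d) x) e * φ x)
        =ᵐ[volume.restrict Ω] fun x => c * (inner ℝ (a.2 x) e * φ x) := by
      filter_upwards [Lp.coeFn_smul c a.2] with x hx
      simp only [Prod.smul_snd, hx, Pi.smul_apply, real_inner_smul_left]
      ring
    rw [integral_congr_ae h1, integral_congr_ae h2, integral_const_mul, integral_const_mul,
      ha φ hφ e]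
    ring

/-- The `L²`-function underlying an element of `H¹(Ω)`. -/
def sobVal {Ω : Set (Eu d)} (v : H1 Ω) : L2 Ω := v.1.1

/-- The weak gradient of an element of `H¹(Ω)`. -/
def sobGrad {Ω : Set (Eu d)} (v : H1 Ω) : L2Vec Ω := v.1.2

/-- `H¹₀(Ω)`: the closure of the test functions in `H¹(Ω)`. -/
def H10 (Ω : Set (Eu d)) : Set (H1 Ω) :=
  closure {w | ∃ φ : Eu d → ℝ, IsTestFunction Ω φ ∧ sobVal w =ᵐ[volume.restrict Ω] φ}

/-- `u ∈ H²(Ω)`: every partial derivative of `u ∈ H¹(Ω)` lies in `H¹(Ω)`. -/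
def MemH2 {Ω : Set (Eu d)} (u : H1 Ω) : Prop :=
  ∀ i : Fin d, ∃ w : H1 Ω, sobVal w =ᵐ[volume.restrict Ω] fun x => sobGrad u x i

/-- The `L^∞(Ω)`-norm (for functions with `MemLp f ∞ (volume.restrict Ω)`). -/
def linfNorm {F : Type*} [NormedAddCommGroup F] (Ω : Set (Eu d)) (f : Eu d → F) : ℝ :=
  (eLpNorm f ∞ (volume.restrict Ω)).toReal

/-- `β ∈ W^{1,∞}(Ω)` with weak gradient `g`. -/
structure MemW1inf (Ω : Set (Eu d)) (β : Eu d → ℝ) (g : Eu d → Eu d) : Prop where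
  memLp : MemLp β ∞ (volume.restrict Ω)
  memLp_grad : MemLp g ∞ (volume.restrict Ω)
  weak : IsWeakGradient Ω β g

/-- The `W^{1,∞}(Ω)`-norm of a function `β` with weak gradient `g`. -/
def w1infNorm (Ω : Set (Eu d)) (β : Eu d → ℝ) (g : Eu d → Eu d) : ℝ :=
  max (linfNorm Ω β) (linfNorm Ω g)

/-! ### Boundary values -/

/-- `c` is the trace of `w` at the boundary point `z` of `Ω`. For `w ∈ H¹(Ω)` on a Lipschitz
domain such a `c` exists at almost every `z` and is the usual trace of `w`. -/
def IsTraceAt (Ω : Set (Eu d)) (w : Eu d → ℝ) (z : Eu d) (c : ℝ) : Prop :=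
  Tendsto (fun ρ : ℝ => ⨍ x in Ω ∩ Metric.ball z ρ, |w x - c|) (𝓝[>] 0) (𝓝 0)

/-- `n` is the outer unit normal of `Ω` at the boundary point `z`: for each `ε`, near `z` the
boundary lies in the thin double cone `|⟨x - z, n⟩| ≤ ε ‖x - z‖`, with `Ω` on the side of `-n`. -/
def IsOuterNormalAt (Ω : Set (Eu d)) (z n : Eu d) : Prop :=
  ‖n‖ = 1 ∧ ∀ ε > 0, ∃ ρ > 0, ∀ x ∈ Metric.ball z ρ,
    (inner ℝ (x - z) n < -(ε * ‖x - z‖) → x ∈ Ω) ∧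
    (ε * ‖x - z‖ < inner ℝ (x - z) n → x ∉ Ω)

/-- `((∂u/∂ν) v)|_{∂Ω} = 0`, almost everywhere for the surface measure of `∂Ω`; here `p` is the
trace of `∇u` and `c` the trace of `v`. -/
def BoundaryProductVanishes {Ω : Set (Eu d)} (u v : H1 Ω) : Prop :=
  ∀ᵐ z ∂((Measure.hausdorffMeasure ((d : ℝ) - 1) : Measure (Eu d)).restrict (frontier Ω)),
    ∃ (n p : Eu d) (c : ℝ), IsOuterNormalAt Ω z n ∧
      (∀ i, IsTraceAt Ω (fun x => sobGrad u x i) z (p i)) ∧ IsTraceAt Ω (sobVal v) z c ∧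
      inner ℝ p n * c = 0

/-! ### The variational problems -/

/-- Coefficients `α, σ ∈ L^∞(Ω)` with `0 < αmin ≤ α` and `0 ≤ σ`. -/
structure IsCoefficientPair (Ω : Set (Eu d)) (αmin : ℝ) (α σ : Eu d → ℝ) : Prop where
  pos : 0 < αmin
  memLp_α : MemLp α ∞ (volume.restrict Ω)
  le_α : ∀ᵐ x ∂(volume.restrict Ω), αmin ≤ α x
  memLp_σ : MemLp σ ∞ (volume.restrict Ω)
  nonneg_σ : ∀ᵐ x ∂(volume.restrict Ω), 0 ≤ σ x

/-- `a(w, v) = ∫_Ω α ∇w · ∇v + σ w v`. -/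
def ellForm {Ω : Set (Eu d)} (α σ : Eu d → ℝ) (w v : H1 Ω) : ℝ :=
  ∫ x in Ω, (α x * inner ℝ (sobGrad w x) (sobGrad v x) + σ x * sobVal w x * sobVal v x)

/-- `ℓ(v) = ∫_Ω f v`. -/
def load {Ω : Set (Eu d)} (f : L2 Ω) (v : H1 Ω) : ℝ :=
  ∫ x in Ω, f x * sobVal v x

/-- The trial space: a closed subspace `H¹₀(Ω) ⊆ V ⊆ H¹(Ω)` on which `a` is coercive. -/
structure IsTrialSpace {Ω : Set (Eu d)} (α σ : Eu d → ℝ) (V : Submodule ℝ (H1 Ω)) : Prop where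
  isClosed : IsClosed (V : Set (H1 Ω))
  h10_subset : H10 Ω ⊆ (V : Set (H1 Ω))
  coercive : ∃ κ > 0, ∀ v ∈ V, κ * (‖sobVal v‖ ^ 2 + ‖sobGrad v‖ ^ 2) ≤ ellForm α σ v v

/-- `u ∈ V` and `a(u, v) = ℓ(v)` for all `v ∈ V`. -/
def IsExactSolution {Ω : Set (Eu d)} (V : Submodule ℝ (H1 Ω)) (α σ : Eu d → ℝ) (f : L2 Ω)
    (u : H1 Ω) : Prop :=
  u ∈ V ∧ ∀ v ∈ V, ellForm α σ u v = load f v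

/-- `b(w, v) = ∑ᵢ |Bᵢ| (⨍_{Bᵢ} w) (⨍_{Bᵢ} v)`. -/
def dataForm {Ω : Set (Eu d)} {m : ℕ} (B : Fin m → Set (Eu d)) (w v : H1 Ω) : ℝ :=
  ∑ i, volume.real (B i) * (⨍ x in B i, sobVal w x) * (⨍ x in B i, sobVal v x)

/-- The inexact data term `∑ᵢ bᵢ |Bᵢ| ⨍_{Bᵢ} v`. -/
def dataTerm {Ω : Set (Eu d)} {m : ℕ} (B : Fin m → Set (Eu d)) (b : Fin m → ℝ) (v : H1 Ω) : ℝ :=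
  ∑ i, b i * volume.real (B i) * (⨍ x in B i, sobVal v x)

/-- `ũ ∈ V` and `ã(ũ, v) + δ⁻¹ b(ũ, v) = ℓ̃(v) + δ⁻¹ ∑ᵢ bᵢ |Bᵢ| ⨍_{Bᵢ} v` for all `v ∈ V`. -/
def IsRegularizedSolution {Ω : Set (Eu d)} (V : Submodule ℝ (H1 Ω)) (α' σ' : Eu d → ℝ)
    (f' : L2 Ω) {m : ℕ} (B : Fin m → Set (Eu d)) (b : Fin m → ℝ) (δ : ℝ) (u' : H1 Ω) : Prop :=
  u' ∈ V ∧ ∀ v ∈ V,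
    ellForm α' σ' u' v + δ⁻¹ * dataForm B u' v = load f' v + δ⁻¹ * dataTerm B b v

/-! ### The data sets -/

/-- Open nonempty sets `Bᵢ ⊆ Ω` and bounded convex sets `Kᵢ ⊇ Bᵢ` whose closures cover `Ω`.
(A bounded convex set with nonempty interior always has a Lipschitz boundary.) -/
structure IsDataCovering (Ω : Set (Eu d)) {m : ℕ} (B K : Fin m → Set (Eu d)) : Prop where
  isOpen : ∀ i, IsOpen (B i)
  nonempty : ∀ i, (B i).Nonempty
  subset : ∀ i, B i ⊆ Ω
  subset_K : ∀ i, B i ⊆ K i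
  convex : ∀ i, Convex ℝ (K i)
  bounded : ∀ i, Bornology.IsBounded (K i)
  cover : Ω ⊆ ⋃ i, closure (K i)

/-- `max_{x ∈ Ω} |{i | x ∈ Kᵢ}|`. -/
def overlap (Ω : Set (Eu d)) {m : ℕ} (K : Fin m → Set (Eu d)) : ℕ :=
  ⨆ x : Ω, Set.ncard {i | (x : Eu d) ∈ K i}

/-- `maxᵢ diam (Sᵢ)`. -/
def maxDiam {m : ℕ} (S : Fin m → Set (Eu d)) : ℝ := ⨆ i, Metric.diam (S i)

open Classical in
/-- `η = 1` if `Bᵢ = Kᵢ` for all `i`, and `η = 3 maxᵢ |Kᵢ| / |Bᵢ|` otherwise. -/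
def mismatch {m : ℕ} (B K : Fin m → Set (Eu d)) : ℝ :=
  if ∀ i, B i = K i then 1 else 3 * ⨆ i, volume.real (K i) / volume.real (B i)

/-- `δ ∈ [θ X, θ⁻¹ X]`, where `X = R² M / (π² α̃min)`, for some `θ ∈ (0, 1]` with `θ⁻¹ ≤ Θ`. -/
def IsWellBalanced (Ω : Set (Eu d)) {m : ℕ} (K : Fin m → Set (Eu d)) (αmin' δ Θ : ℝ) : Prop :=
  ∃ θ : ℝ, 0 < θ ∧ θ ≤ 1 ∧ θ⁻¹ ≤ Θ ∧
    δ ∈ Icc (θ * (maxDiam K ^ 2 * overlap Ω K / (Real.pi ^ 2 * αmin')))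
      (θ⁻¹ * (maxDiam K ^ 2 * overlap Ω K / (Real.pi ^ 2 * αmin')))

end PDELearning

end

open PDELearning

/-!
The error `w = ũ - u` belongs to `V` and is tested with itself in the difference of the two
variational equations. This gives (`IsRegularizedSolution.energy_le`)
`α̃min ‖∇w‖² + δ⁻¹ b(w, w) ≤ c G ‖w‖ + δ⁻¹ (T + b(w, w)) / 2`,
where `G` is the perturbation of the load and of the coefficients, and `T` is the squared misfit of
the data `u(pᵢ)` and the averages of `u`, which is of the order `r^{2λ}` since `u` is Hölder
continuous (`IsDataCovering.sum_sq_sub_average_le`). Two facts make this useful.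

*Stability of the data* (`exists_norm_sq_le`): `‖v‖² ≤ C (R² ‖∇v‖² + b(v, v))` for `v ∈ H¹(Ω)`. With
a well-balanced `δ`, both terms on the right are bounded through the energy, and `‖w‖` can be
absorbed (`exists_const_of_energy_estimate`). As the sets `Kᵢ` may leave `Ω`, no inequality
on the single `Kᵢ` is available. Instead, `‖v‖²` is compared with the averages over those `Bᵢ` whose
`Kᵢ` come close to a given point: these have enough mass, because the closed sets `Kᵢ` cover `Ω`, a
Lipschitz domain has a ball of comparable size near each point, and `|Kᵢ| ≤ (η / 3) |Bᵢ|` (or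
`Bᵢ = Kᵢ`). The increments between points at distance less than `2 R` are bounded by `R² ‖∇v‖²`
through translation estimates, along paths which in a Lipschitz chart go up, across and down. If `R`
is large, the Poincaré inequality on the connected set `Ω` replaces this local estimate.

*Perturbation of the diffusion coefficient* (`MemH2.exists_abs_integral_le`): for `u ∈ H²(Ω)`, the
integral of `β ∇u · ∇v` is bounded by `C ‖β‖_{W^{1,∞}} ‖v‖_{L²}`, although it contains `∇v`. This is
partial integration, with a boundary term that vanishes by the assumption on `(∂u/∂ν) v`. What is
needed is Green's formula `∑ᵢ ∫_Ω ∂ᵢ(β v Uᵢ) = 0` for Sobolev functions whose flux `(U · ν) v`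
vanishes in the sense of pointwise traces (`IsLipschitzDomain.sum_integral_eq_zero`). By a partition
of unity it suffices to work in a chart, where `Ω` is `{0 < Γ}` for a Lipschitz height `Γ`.
Mollifying with kernels that look inward makes the functions smooth up to the boundary and commutes
with weak derivatives there. For the smooth products the divergence theorem holds in the epigraph
(`IsHeight.integral_fderiv_epigraph`, by integration by parts against a truncated height); the
boundary integral is written as an integral over a layer above the graph, which avoids surface
measures. The trace inequality (`IsHeight.lintegral_foot_sq_le`) shows that the boundary values of
the mollified `v` and `Uᵢ` are Cauchy in `L²`; their limits are the pointwise traces, and the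
limiting flux is zero, as the gradient of `Γ` is parallel to the normal. The factor `β` needs
no trace: its mollifications are merely bounded.
-/

namespace PDELearning

/-! ### Mollification -/

theorem lintegral_enorm_sq_eq {X E : Type*} [MeasurableSpace X] [NormedAddCommGroup E]
    (f : X → E) (μ : Measure X) : ∫⁻ x, ‖f x‖ₑ ^ 2 ∂μ = eLpNorm f 2 μ ^ 2 := by
  have h := eLpNorm_nnreal_pow_eq_lintegral (f := f) (μ := μ) (p := 2) (by norm_num)
  have e : ((2 : ℝ≥0) : ℝ) = ((2 : ℕ) : ℝ) := by norm_num
  simp only [e, ENNReal.rpow_natCast] at h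
  exact h.symm

theorem memLp_two_of_lintegral_lt_top {X E : Type*} [MeasurableSpace X] [NormedAddCommGroup E]
    {f : X → E} {μ : Measure X} (hf : AEStronglyMeasurable f μ)
    (h : ∫⁻ x, ‖f x‖ₑ ^ 2 ∂μ < ⊤) : MemLp f 2 μ := by
  refine ⟨hf, ?_⟩
  rw [lintegral_enorm_sq_eq] at h
  exact (ENNReal.pow_lt_top_iff.1 h).resolve_right two_ne_zero

/-- The average of `f` over the translates of `x` by the points of a kernel `k`. -/
noncomputable def mollify {d : ℕ} (k f : Eu d → ℝ) (x : Eu d) : ℝ := ∫ y, k y * f (x + y)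

/-- A smooth probability density supported in the closed ball of radius `s` around `0`. It need
not be centred: kernels that look only into `Ω` are what is used near the boundary. -/
structure IsMollifier {d : ℕ} (k : Eu d → ℝ) (s : ℝ) : Prop where
  smooth : ContDiff ℝ ∞ k
  nonneg : ∀ y, 0 ≤ k y
  integral_eq : ∫ y, k y = 1
  tsupport_subset : tsupport k ⊆ Metric.closedBall 0 s

section
variable {d : ℕ} {k f g : Eu d → ℝ} {s : ℝ}

theorem IsMollifier.compact (h : IsMollifier k s) : HasCompactSupport k :=
  (isCompact_closedBall 0 s).of_isClosed_subset (isClosed_tsupport k) h.tsupport_subset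

theorem IsMollifier.integrable (h : IsMollifier k s) : Integrable k :=
  h.smooth.continuous.integrable_of_hasCompactSupport h.compact

theorem IsMollifier.lintegral_eq (h : IsMollifier k s) : ∫⁻ y, ENNReal.ofReal (k y) = 1 := by
  rw [← ofReal_integral_eq_lintegral_ofReal h.integrable (ae_of_all _ h.nonneg), h.integral_eq,
    ENNReal.ofReal_one]

theorem IsMollifier.eq_zero (h : IsMollifier k s) {y : Eu d} (hy : s < ‖y‖) : k y = 0 := by
  by_contra hne
  have := h.tsupport_subset (subset_tsupport k hne)
  simp at this
  linarith

theorem mollify_eq_integral_sub (k f : Eu d → ℝ) (x : Eu d) :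
    mollify k f x = ∫ w, f w * k (w - x) := by
  rw [← integral_add_left_eq_self (fun w => f w * k (w - x)) x]
  simp [mollify, mul_comm]

theorem mollify_eq_convolution (k f : Eu d → ℝ) :
    mollify k f = convolution f (fun y => k (-y)) (ContinuousLinearMap.mul ℝ ℝ) volume := by
  ext x
  rw [mollify_eq_integral_sub, convolution_def]
  simp

theorem contDiff_mollify (h : IsMollifier k s) (hf : LocallyIntegrable f) :
    ContDiff ℝ ∞ (mollify k f) := by
  rw [mollify_eq_convolution]
  refine HasCompactSupport.contDiff_convolution_right _ ?_ hf ?_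
  · exact h.compact.comp_homeomorph (Homeomorph.neg _)
  · exact h.smooth.comp contDiff_neg

theorem fderiv_mollify (h : IsMollifier k s) (hf : LocallyIntegrable f) (x a : Eu d) :
    fderiv ℝ (mollify k f) x a = - ∫ w, f w * fderiv ℝ k (w - x) a := by
  have hc : HasCompactSupport (fun y => k (-y)) := h.compact.comp_homeomorph (Homeomorph.neg _)
  have hs : ContDiff ℝ 1 (fun y => k (-y)) := (h.smooth.of_le (by simp)).comp contDiff_neg
  have hd := HasCompactSupport.hasFDerivAt_convolution_right (ContinuousLinearMap.mul ℝ ℝ)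
    (μ := volume) hc hf hs x
  rw [mollify_eq_convolution, hd.fderiv, convolution_def,
    ContinuousLinearMap.integral_apply, ← integral_neg]
  · refine integral_congr_ae (ae_of_all _ fun w => ?_)
    have hk : fderiv ℝ (fun y => k (-y)) (x - w) a = - fderiv ℝ k (w - x) a := by
      have h1 : HasFDerivAt k (fderiv ℝ k (-(x - w))) (-(x - w)) :=
        (h.smooth.differentiable (by simp) _).hasFDerivAt
      have h2 := h1.comp (x - w) (hasFDerivAt_id (x - w)).neg
      have h3 : fderiv ℝ (fun y => k (-y)) (x - w) = _ := h2.fderiv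
      rw [h3]
      simp
    simp [ContinuousLinearMap.precompR_apply, hk]
  · exact (hc.fderiv ℝ).convolutionExists_right
      (ContinuousLinearMap.precompR (Eu d) (ContinuousLinearMap.mul ℝ ℝ)) hf
      (hs.continuous_fderiv (by simp)) x

/-- Where the translated kernel is a test function on `Ω`, mollification commutes with weak
differentiation. -/
theorem fderiv_mollify_of_isWeakGradient {Ω : Set (Eu d)} (hΩ : MeasurableSet Ω)
    {f : Eu d → ℝ} {g : Eu d → Eu d}
    (h : IsMollifier k s) (hf : LocallyIntegrable (Ω.indicator f)) (hw : IsWeakGradient Ω f g)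
    {x : Eu d} (hx : ∀ y ∈ tsupport k, x + y ∈ Ω) (a : Eu d) :
    fderiv ℝ (mollify k (Ω.indicator f)) x a
      = mollify k (Ω.indicator fun w => inner ℝ (g w) a) x := by
  have htest : IsTestFunction Ω (fun w => k (w - x)) := by
    have e : (fun w => k (w - x)) = k ∘ (Homeomorph.subRight x) := rfl
    have hts : tsupport (fun w => k (w - x)) = (Homeomorph.subRight x) ⁻¹' tsupport k := by
      rw [e, tsupport_comp_eq_preimage]
    refine ⟨h.smooth.comp (contDiff_id.sub contDiff_const), ?_, ?_⟩
    · exact h.compact.comp_homeomorph (Homeomorph.subRight x)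
    · rw [hts]
      intro w hw
      simpa using hx _ hw
  have hd : ∀ w, fderiv ℝ (fun w => k (w - x)) w a = fderiv ℝ k (w - x) a := by
    intro w
    have h1 : HasFDerivAt k (fderiv ℝ k (w - x)) (w - x) :=
      (h.smooth.differentiable (by simp) _).hasFDerivAt
    have h2 := h1.comp w ((hasFDerivAt_id w).sub_const x)
    have h3 : fderiv ℝ (fun w => k (w - x)) w = _ := h2.fderiv
    rw [h3]
    simp
  rw [fderiv_mollify h hf, mollify_eq_integral_sub]
  have h1 : (fun w => Ω.indicator f w * fderiv ℝ k (w - x) a)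
      = Ω.indicator (fun w => f w * fderiv ℝ (fun w => k (w - x)) w a) := by
    ext w
    by_cases hwΩ : w ∈ Ω <;> simp [hwΩ, hd]
  have h2 : (fun w => Ω.indicator (fun w => inner ℝ (g w) a) w * k (w - x))
      = Ω.indicator (fun w => inner ℝ (g w) a * k (w - x)) := by
    ext w
    by_cases hwΩ : w ∈ Ω <;> simp [hwΩ]
  rw [h1, h2, integral_indicator hΩ, integral_indicator hΩ, hw _ htest a, neg_neg]

/-- Jensen's inequality for the square and the density `k`. -/
theorem enorm_integral_kernel_mul_sq_le (h : IsMollifier k s) {q : Eu d → ℝ}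
    (hq : AEStronglyMeasurable q volume) :
    ‖∫ y, k y * q y‖ₑ ^ 2 ≤ ∫⁻ y, ENNReal.ofReal (k y) * ‖q y‖ₑ ^ 2 := by
  set ν : Measure (Eu d) := volume.withDensity (fun y => ENNReal.ofReal (k y)) with hν
  have hm : Measurable (fun y => ENNReal.ofReal (k y)) :=
    h.smooth.continuous.measurable.ennreal_ofReal
  have hprob : IsProbabilityMeasure ν := ⟨by
    rw [hν, withDensity_apply _ MeasurableSet.univ, setLIntegral_univ, h.lintegral_eq]⟩
  have hlt : ∀ᵐ y : Eu d, ENNReal.ofReal (k y) < ⊤ := ae_of_all _ fun y => ENNReal.ofReal_lt_top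
  have h1 : ‖∫ y, k y * q y‖ₑ ≤ eLpNorm q 1 ν := by
    refine (enorm_integral_le_lintegral_enorm _).trans (le_of_eq ?_)
    rw [eLpNorm_one_eq_lintegral_enorm, hν,
      lintegral_withDensity_eq_lintegral_mul_non_measurable _ hm hlt]
    refine lintegral_congr fun y => ?_
    simp [enorm_mul, Real.enorm_eq_ofReal (h.nonneg y)]
  have h2 : eLpNorm q 1 ν ≤ eLpNorm q 2 ν :=
    eLpNorm_le_eLpNorm_of_exponent_le (by norm_num)
      (hq.mono_ac (withDensity_absolutelyContinuous _ _))
  calc _ ≤ eLpNorm q 2 ν ^ 2 := by gcongr; exact h1.trans h2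
    _ = _ := by
      rw [← lintegral_enorm_sq_eq, hν,
        lintegral_withDensity_eq_lintegral_mul_non_measurable _ hm hlt]
      rfl

theorem aestronglyMeasurable_comp_add_right {E : Type*} [TopologicalSpace E] {f : Eu d → E}
    (hf : AEStronglyMeasurable f volume) (x : Eu d) :
    AEStronglyMeasurable (fun y => f (y + x)) volume :=
  hf.comp_measurePreserving (measurePreserving_add_right volume x)

theorem aestronglyMeasurable_uncurry_add {f : Eu d → ℝ} (hf : AEStronglyMeasurable f volume) :
    AEStronglyMeasurable (fun p : Eu d × Eu d => f (p.1 + p.2)) (volume.prod volume) :=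
  hf.comp_quasiMeasurePreserving (quasiMeasurePreserving_add volume volume)

/-- Averaging with respect to the density `k` does not increase a uniform bound for `L²`-norms. -/
theorem lintegral_sq_average_le (h : IsMollifier k s) {q : Eu d → Eu d → ℝ}
    (hq : AEStronglyMeasurable (fun p : Eu d × Eu d => q p.1 p.2) (volume.prod volume))
    {c : ℝ≥0∞} (hc : ∀ y, k y ≠ 0 → ∫⁻ x, ‖q x y‖ₑ ^ 2 ≤ c) :
    ∫⁻ x, ‖∫ y, k y * q x y‖ₑ ^ 2 ≤ c := by
  have hm : Measurable (fun y => ENNReal.ofReal (k y)) :=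
    h.smooth.continuous.measurable.ennreal_ofReal
  calc ∫⁻ x, ‖∫ y, k y * q x y‖ₑ ^ 2
      ≤ ∫⁻ x, ∫⁻ y, ENNReal.ofReal (k y) * ‖q x y‖ₑ ^ 2 := by
        refine lintegral_mono_ae ?_
        filter_upwards [hq.prodMk_left] with x hx
        exact enorm_integral_kernel_mul_sq_le h hx
    _ = ∫⁻ y, ∫⁻ x, ENNReal.ofReal (k y) * ‖q x y‖ₑ ^ 2 := by
        refine lintegral_lintegral_swap ?_
        exact (hm.comp measurable_snd).aemeasurable.mul (hq.enorm.pow_const 2)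
    _ ≤ ∫⁻ y, ENNReal.ofReal (k y) * c := by
        refine lintegral_mono fun y => ?_
        rw [lintegral_const_mul' _ _ ENNReal.ofReal_ne_top]
        by_cases hy : k y = 0
        · simp [hy]
        · gcongr
          exact hc y hy
    _ = c := by rw [lintegral_mul_const _ hm, h.lintegral_eq, one_mul]

/-- Mollification does not increase the `L²`-norm. -/
theorem lintegral_mollify_sq_le (h : IsMollifier k s) (hf : AEStronglyMeasurable f volume) :
    ∫⁻ x, ‖mollify k f x‖ₑ ^ 2 ≤ ∫⁻ x, ‖f x‖ₑ ^ 2 := by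
  refine lintegral_sq_average_le h (q := fun x y => f (x + y))
    (aestronglyMeasurable_uncurry_add hf) fun y _ => le_of_eq ?_
  exact lintegral_add_right_eq_self (fun x => ‖f x‖ₑ ^ 2) y

theorem memLp_comp_add {f : Eu d → ℝ} (hf : MemLp f 2 volume) (x : Eu d) :
    MemLp (fun y => f (x + y)) 2 volume :=
  hf.comp_measurePreserving (measurePreserving_add_left volume x)

theorem IsMollifier.memLp (h : IsMollifier k s) : MemLp k 2 volume :=
  h.smooth.continuous.memLp_of_hasCompactSupport h.compact

theorem mollify_sub_const (h : IsMollifier k s) (hf : MemLp f 2 volume) (x : Eu d) (c : ℝ) :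
    mollify k f x - c = ∫ y, k y * (f (x + y) - c) := by
  have hi : Integrable (fun y => k y * f (x + y)) := h.memLp.integrable_mul (memLp_comp_add hf x)
  simp only [mul_sub]
  rw [integral_sub hi (h.integrable.mul_const c), integral_mul_const, h.integral_eq, one_mul,
    mollify]

theorem abs_mollify_le (h : IsMollifier k s) {c : ℝ} (hc : ∀ᵐ y, |f y| ≤ c) (x : Eu d) :
    |mollify k f x| ≤ c := by
  have hc' : ∀ᵐ y, |f (x + y)| ≤ c :=
    (measurePreserving_add_left volume x).quasiMeasurePreserving.ae hc
  calc |mollify k f x| ≤ ∫ y, k y * c := by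
        refine norm_integral_le_of_norm_le (f := fun y => k y * f (x + y))
          (h.integrable.mul_const c) ?_
        filter_upwards [hc'] with y hy
        rw [norm_mul, Real.norm_eq_abs, Real.norm_eq_abs, abs_of_nonneg (h.nonneg y)]
        exact mul_le_mul_of_nonneg_left hy (h.nonneg y)
    _ = c := by rw [integral_mul_const, h.integral_eq, one_mul]

/-- Translations are continuous in `L²`. -/
theorem exists_translation_lintegral_sq_le (hf : MemLp f 2 volume) {ε : ℝ≥0∞} (hε : 0 < ε) :
    ∃ r > 0, ∀ y : Eu d, ‖y‖ ≤ r → ∫⁻ x, ‖f (x + y) - f x‖ₑ ^ 2 ≤ ε := by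
  let G : Eu d → C(Eu d, Eu d) := fun y => ⟨fun x => x + y, by fun_prop⟩
  have hG : Continuous G := by
    have : Continuous (Function.uncurry fun y x : Eu d => x + y) := by fun_prop
    exact (ContinuousMap.mk (Function.uncurry fun y x : Eu d => x + y) this).curry.continuous
  have hGm : ∀ y, MeasurePreserving (G y) volume volume := fun y =>
    measurePreserving_add_right volume y
  have hcont : Continuous (fun y => Lp.compMeasurePreserving (G y) (hGm y) (hf.toLp f)) :=
    Continuous.compMeasurePreservingLp continuous_const hG hGm (by norm_num)
  have h0 : Lp.compMeasurePreserving (G 0) (hGm 0) (hf.toLp f) = hf.toLp f := by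
    rw [Lp.toLp_compMeasurePreserving]
    congr 1
    ext x
    simp [G]
  have ht : Tendsto (fun y => edist (Lp.compMeasurePreserving (G y) (hGm y) (hf.toLp f))
      (hf.toLp f) ^ 2) (𝓝 0) (𝓝 0) := by
    have := ((ENNReal.continuous_pow 2).comp
      (hcont.edist (continuous_const (y := hf.toLp f)))).tendsto 0
    simpa [h0, Function.comp_def] using this
  have hev := (ENNReal.tendsto_nhds_zero.1 ht) ε hε
  obtain ⟨r, hr, hball⟩ := Metric.eventually_nhds_iff.1 hev
  refine ⟨r / 2, by positivity, fun y hy => ?_⟩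
  have h1 := hball (y := y) (by rw [dist_zero_right]; linarith)
  rw [Lp.toLp_compMeasurePreserving, Lp.edist_toLp_toLp, ← lintegral_enorm_sq_eq] at h1
  exact h1

/-- Mollifications with shrinking kernels converge in `L²`. -/
theorem tendsto_lintegral_mollify_sub_sq {k : ℕ → Eu d → ℝ} {s : ℕ → ℝ}
    (h : ∀ n, IsMollifier (k n) (s n)) (hs : Tendsto s atTop (𝓝 0)) (hf : MemLp f 2 volume) :
    Tendsto (fun n => ∫⁻ x, ‖mollify (k n) f x - f x‖ₑ ^ 2) atTop (𝓝 0) := by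
  rw [ENNReal.tendsto_nhds_zero]
  intro ε hε
  obtain ⟨r, hr, hry⟩ := exists_translation_lintegral_sq_le hf hε
  filter_upwards [hs.eventually (gt_mem_nhds hr)] with n hn
  simp only [mollify_sub_const (h n) hf]
  refine lintegral_sq_average_le (h n) (q := fun x y => f (x + y) - f x) ?_ fun y hy => ?_
  · exact (aestronglyMeasurable_uncurry_add hf.1).sub hf.1.comp_fst
  · refine hry y ?_
    by_contra! hlt
    exact hy ((h n).eq_zero (hn.trans hlt))

theorem memLp_mollify (h : IsMollifier k s) (hf : MemLp f 2 volume) :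
    MemLp (mollify k f) 2 volume := by
  have hc := (contDiff_mollify h (hf.locallyIntegrable (by norm_num))).continuous
  refine memLp_two_of_lintegral_lt_top hc.aestronglyMeasurable ?_
  refine (lintegral_mollify_sq_le h hf.1).trans_lt ?_
  rw [lintegral_enorm_sq_eq]
  exact ENNReal.pow_lt_top hf.2

/-- The mollifier built from a bump function centred at `c`. -/
theorem isMollifier_normed {c : Eu d} (φ : ContDiffBump c) :
    IsMollifier (φ.normed volume) (‖c‖ + φ.rOut) where
  smooth := φ.contDiff_normed
  nonneg := φ.nonneg_normed
  integral_eq := φ.integral_normed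
  tsupport_subset := by
    rw [φ.tsupport_normed_eq]
    intro y hy
    rw [mem_closedBall_zero_iff]
    have := norm_sub_norm_le y c
    rw [Metric.mem_closedBall, dist_eq_norm] at hy
    linarith

end

/-! ### Lipschitz charts -/

/-- Near `z` the set `Ω` is the superlevel set `{0 < Γ}` of a Lipschitz height function `Γ` that
grows with unit speed in the direction `e`. Interior points are allowed. -/
structure IsChart {d : ℕ} (Ω : Set (Eu d)) (z e : Eu d) (Γ : Eu d → ℝ) (K : ℝ≥0) (ε : ℝ) :
    Prop where
  norm_dir : ‖e‖ = 1
  lip : LipschitzWith K Γ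
  shift : ∀ x (t : ℝ), Γ (x + t • e) = Γ x + t
  pos : 0 < ε
  mem_iff : ∀ x ∈ Metric.ball z ε, (x ∈ Ω ↔ 0 < Γ x)

section
variable {d : ℕ} {Ω : Set (Eu d)}

theorem exists_isChart_of_mem_frontier (hΩ : HasLipschitzBoundary Ω) {z : Eu d}
    (hz : z ∈ frontier Ω) : ∃ e Γ K ε, IsChart Ω z e Γ K ε := by
  obtain ⟨e, he, γ, L, ε, hγ, hε, hmem⟩ := hΩ z hz
  refine ⟨e, fun x => inner ℝ e x - γ (x - inner ℝ e x • e), 1 + L * 2, ε, he, ?_, ?_, hε, ?_⟩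
  · refine LipschitzWith.of_dist_le_mul fun x y => ?_
    have h1 : |(inner ℝ e x : ℝ) - inner ℝ e y| ≤ dist x y := by
      rw [← inner_sub_right, dist_eq_norm]
      simpa [he] using abs_real_inner_le_norm e (x - y)
    have h2 : dist (x - (inner ℝ e x : ℝ) • e) (y - (inner ℝ e y : ℝ) • e) ≤ 2 * dist x y := by
      have : x - (inner ℝ e x : ℝ) • e - (y - (inner ℝ e y : ℝ) • e)
          = (x - y) - ((inner ℝ e x : ℝ) - inner ℝ e y) • e := by
        rw [sub_smul]; abel
      rw [dist_eq_norm, this]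
      refine (norm_sub_le _ _).trans ?_
      rw [norm_smul, he, mul_one, Real.norm_eq_abs, ← dist_eq_norm]
      linarith
    have h3 := (hγ.dist_le_mul (x - (inner ℝ e x : ℝ) • e) (y - (inner ℝ e y : ℝ) • e)).trans
      (mul_le_mul_of_nonneg_left h2 L.2)
    rw [Real.dist_eq] at h3 ⊢
    push_cast
    rw [abs_le] at *
    constructor <;> nlinarith
  · intro x t
    have h1 : (inner ℝ e (x + t • e) : ℝ) = inner ℝ e x + t := by
      rw [inner_add_right, inner_smul_right, real_inner_self_eq_norm_sq, he]; ring
    simp only [h1]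
    have h2 : x + t • e - ((inner ℝ e x : ℝ) + t) • e = x - (inner ℝ e x : ℝ) • e := by
      rw [add_smul]; abel
    rw [h2]; ring
  · intro x hx
    rw [hmem x hx, sub_pos]

theorem exists_isChart_of_mem (hd : 1 ≤ d) (hΩ : IsOpen Ω) {z : Eu d} (hz : z ∈ Ω) :
    ∃ e Γ K ε, IsChart Ω z e Γ K ε := by
  obtain ⟨ε, hε, hball⟩ := Metric.isOpen_iff.1 hΩ z hz
  set e : Eu d := EuclideanSpace.single ⟨0, hd⟩ 1 with he
  have hne : ‖e‖ = 1 := by simp [he]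
  have hlip : ∀ x y : Eu d, |(inner ℝ e x : ℝ) - inner ℝ e y| ≤ dist x y := by
    intro x y
    rw [← inner_sub_right, dist_eq_norm]
    simpa [hne] using abs_real_inner_le_norm e (x - y)
  refine ⟨e, fun x => inner ℝ e x - (inner ℝ e z - ε), 1, ε, hne, ?_, ?_, hε, ?_⟩
  · refine LipschitzWith.of_dist_le_mul fun x y => ?_
    rw [Real.dist_eq]
    simpa using hlip x y
  · intro x t
    rw [inner_add_right, inner_smul_right, real_inner_self_eq_norm_sq, hne]; ring
  · intro x hx
    have := (abs_le.1 (hlip x z)).1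
    rw [Metric.mem_ball] at hx
    exact ⟨fun _ => by linarith, fun _ => hball hx⟩

/-- Interior points have charts too, so no distinction is made below. -/
theorem exists_isChart (hd : 1 ≤ d) (hΩ : IsLipschitzDomain Ω) {z : Eu d}
    (hz : z ∈ closure Ω) : ∃ e Γ K ε, IsChart Ω z e Γ K ε := by
  by_cases h : z ∈ Ω
  · exact exists_isChart_of_mem hd hΩ.isOpen h
  · refine exists_isChart_of_mem_frontier hΩ.lipschitz ⟨hz, ?_⟩
    rwa [hΩ.isOpen.interior_eq]

theorem IsChart.abs_sub_le {z e : Eu d} {Γ : Eu d → ℝ} {K : ℝ≥0} {ε : ℝ}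
    (h : IsChart Ω z e Γ K ε) (x y : Eu d) : |Γ x - Γ y| ≤ K * ‖x - y‖ := by
  have := h.lip.dist_le_mul x y
  rwa [Real.dist_eq, dist_eq_norm] at this

/-! ### Translation estimates -/

theorem exists_isMollifier_seq (d : ℕ) : ∃ (k : ℕ → Eu d → ℝ) (s : ℕ → ℝ),
    (∀ n, IsMollifier (k n) (s n)) ∧ Tendsto s atTop (𝓝 0) := by
  let φ : ℕ → ContDiffBump (0 : Eu d) := fun n =>
    ⟨(1 / ((n : ℝ) + 1)) / 2, 1 / ((n : ℝ) + 1), by positivity, half_lt_self (by positivity)⟩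
  refine ⟨fun n => (φ n).normed volume, fun n => ‖(0 : Eu d)‖ + (φ n).rOut,
    fun n => isMollifier_normed _, ?_⟩
  simpa [φ] using tendsto_one_div_add_atTop_nhds_zero_nat (𝕜 := ℝ)

theorem memLp_indicator {E : Type*} [NormedAddCommGroup E] {f : Eu d → E} (hΩ : MeasurableSet Ω)
    (hf : MemLp f 2 (volume.restrict Ω)) : MemLp (Ω.indicator f) 2 volume :=
  (memLp_indicator_iff_restrict hΩ).2 hf

theorem memLp_inner_indicator {g : Eu d → Eu d} (hΩ : MeasurableSet Ω)
    (hg : MemLp g 2 (volume.restrict Ω)) (a : Eu d) :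
    MemLp (Ω.indicator fun w => (inner ℝ (g w) a : ℝ)) 2 volume :=
  memLp_indicator hΩ (hg.inner_const a)

theorem enorm_intervalIntegral_sq_le {q : ℝ → ℝ} (hq : Continuous q) :
    ‖∫ t in (0 : ℝ)..1, q t‖ₑ ^ 2 ≤ ∫⁻ t in Icc (0 : ℝ) 1, ‖q t‖ₑ ^ 2 := by
  rw [intervalIntegral.integral_of_le zero_le_one, ← integral_Icc_eq_integral_Ioc]
  have hp : IsProbabilityMeasure (volume.restrict (Icc (0 : ℝ) 1)) := ⟨by simp⟩
  have h1 : ‖∫ t in Icc (0 : ℝ) 1, q t‖ₑ ≤ eLpNorm q 1 (volume.restrict (Icc (0 : ℝ) 1)) := by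
    rw [eLpNorm_one_eq_lintegral_enorm]
    exact enorm_integral_le_lintegral_enorm _
  rw [lintegral_enorm_sq_eq]
  gcongr
  exact h1.trans (eLpNorm_le_eLpNorm_of_exponent_le (by norm_num) hq.aestronglyMeasurable)

theorem lintegral_inner_indicator_sq_le {g : Eu d → Eu d} (hΩ : MeasurableSet Ω) (a : Eu d) :
    ∫⁻ x, ‖Ω.indicator (fun w => (inner ℝ (g w) a : ℝ)) x‖ₑ ^ 2
      ≤ ‖a‖ₑ ^ 2 * ∫⁻ x in Ω, ‖g x‖ₑ ^ 2 := by
  rw [← lintegral_const_mul' _ _ (by finiteness), ← lintegral_indicator hΩ]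
  refine lintegral_mono fun x => ?_
  by_cases hx : x ∈ Ω
  · simp only [indicator_of_mem hx, ← mul_pow]
    gcongr
    rw [mul_comm]
    simpa [enorm_eq_nnnorm, ← ENNReal.coe_mul] using nnnorm_inner_le_nnnorm (𝕜 := ℝ) (g x) a
  · simp [hx]

/-- The translation estimate for a smooth mollification, on a set whose points keep a distance
from the complement of `Ω` along the whole segment in the direction `h`. -/
theorem lintegral_mollify_translation_sq_le (hΩ : MeasurableSet Ω) {k f : Eu d → ℝ}
    {g : Eu d → Eu d} {s : ℝ} (hk : IsMollifier k s) (hf : MemLp f 2 (volume.restrict Ω))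
    (hg : MemLp g 2 (volume.restrict Ω)) (hw : IsWeakGradient Ω f g) (h : Eu d) {A : Set (Eu d)}
    (hA : MeasurableSet A)
    (hAs : ∀ x ∈ A, ∀ t ∈ Icc (0 : ℝ) 1, Metric.closedBall (x + t • h) s ⊆ Ω) :
    ∫⁻ x in A, ‖mollify k (Ω.indicator f) (x + h) - mollify k (Ω.indicator f) x‖ₑ ^ 2
      ≤ ‖h‖ₑ ^ 2 * ∫⁻ x in Ω, ‖g x‖ₑ ^ 2 := by
  set m := mollify k (Ω.indicator f)
  set G := mollify k (Ω.indicator fun w => (inner ℝ (g w) h : ℝ))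
  have hloc := (memLp_indicator hΩ hf).locallyIntegrable (by norm_num)
  have hlocg := (memLp_inner_indicator hΩ hg h).locallyIntegrable (by norm_num)
  have hm : ContDiff ℝ ∞ m := contDiff_mollify hk hloc
  have hG : Continuous G := (contDiff_mollify hk hlocg).continuous
  have hder : ∀ x ∈ A, ∀ t ∈ Icc (0 : ℝ) 1, fderiv ℝ m (x + t • h) h = G (x + t • h) := by
    intro x hx t ht
    refine fderiv_mollify_of_isWeakGradient hΩ hk hloc hw (fun y hy => hAs x hx t ht ?_) h
    have := hk.tsupport_subset hy
    simpa [Metric.mem_closedBall, dist_eq_norm] using this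
  have hftc : ∀ x ∈ A, m (x + h) - m x = ∫ t in (0 : ℝ)..1, G (x + t • h) := by
    intro x hx
    have hd : ∀ t : ℝ, HasDerivAt (fun t : ℝ => m (x + t • h)) (fderiv ℝ m (x + t • h) h) t := by
      intro t
      have h1 : HasFDerivAt m (fderiv ℝ m (x + t • h)) (x + t • h) :=
        (hm.differentiable (by simp) _).hasFDerivAt
      have h2 : HasDerivAt (fun t : ℝ => x + t • h) h t := by
        simpa using ((hasDerivAt_id t).smul_const h).const_add x
      exact h1.comp_hasDerivAt t h2
    have hcont : Continuous (fun t : ℝ => fderiv ℝ m (x + t • h) h) :=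
      ((hm.continuous_fderiv (by simp)).comp (by fun_prop)).clm_apply continuous_const
    have := intervalIntegral.integral_eq_sub_of_hasDerivAt (fun t _ => hd t)
      (hcont.intervalIntegrable 0 1)
    simp only [one_smul, zero_smul, add_zero] at this
    rw [← this]
    refine intervalIntegral.integral_congr fun t ht => ?_
    rw [uIcc_of_le zero_le_one] at ht
    exact hder x hx t ht
  calc ∫⁻ x in A, ‖m (x + h) - m x‖ₑ ^ 2
      ≤ ∫⁻ x in A, ∫⁻ t in Icc (0 : ℝ) 1, ‖G (x + t • h)‖ₑ ^ 2 := by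
        refine setLIntegral_mono' hA fun x hx => ?_
        rw [hftc x hx]
        exact enorm_intervalIntegral_sq_le (by fun_prop)
    _ ≤ ∫⁻ x, ∫⁻ t in Icc (0 : ℝ) 1, ‖G (x + t • h)‖ₑ ^ 2 := setLIntegral_le_lintegral _ _
    _ = ∫⁻ t in Icc (0 : ℝ) 1, ∫⁻ x, ‖G (x + t • h)‖ₑ ^ 2 := by
        refine lintegral_lintegral_swap ?_
        have : Continuous (fun p : Eu d × ℝ => G (p.1 + p.2 • h)) := by fun_prop
        exact (this.measurable.enorm.pow_const 2).aemeasurable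
    _ = ∫⁻ t in Icc (0 : ℝ) 1, ∫⁻ x, ‖G x‖ₑ ^ 2 := by
        refine lintegral_congr fun t => ?_
        exact lintegral_add_right_eq_self (fun x => ‖G x‖ₑ ^ 2) _
    _ = ∫⁻ x, ‖G x‖ₑ ^ 2 := by simp
    _ ≤ _ := (lintegral_mollify_sq_le hk (memLp_inner_indicator hΩ hg h).1).trans
        (lintegral_inner_indicator_sq_le hΩ h)

/-- The translation estimate: the increment of an `H¹` function over segments inside `Ω`. -/
theorem lintegral_translation_sq_le (hΩ : IsOpen Ω) {f : Eu d → ℝ} {g : Eu d → Eu d}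
    (hf : MemLp f 2 (volume.restrict Ω)) (hg : MemLp g 2 (volume.restrict Ω))
    (hw : IsWeakGradient Ω f g) (h : Eu d) {A : Set (Eu d)} (hA : MeasurableSet A)
    (hAs : ∀ x ∈ A, ∀ t ∈ Icc (0 : ℝ) 1, x + t • h ∈ Ω) :
    ∫⁻ x in A, ‖f (x + h) - f x‖ₑ ^ 2 ≤ ‖h‖ₑ ^ 2 * ∫⁻ x in Ω, ‖g x‖ₑ ^ 2 := by
  set f₀ := Ω.indicator f with hf₀
  have hf₀L : MemLp f₀ 2 volume := memLp_indicator hΩ.measurableSet hf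
  set B := ‖h‖ₑ ^ 2 * ∫⁻ x in Ω, ‖g x‖ₑ ^ 2 with hB
  obtain ⟨k, s, hk, hs⟩ := exists_isMollifier_seq d
  -- `A` is exhausted by the sets of points whose segment keeps distance `1 / (j + 1)` from `Ωᶜ`
  let S : ℕ → Set (Eu d) := fun j =>
    {x | ∀ t ∈ Icc (0 : ℝ) 1, ((j : ℝ≥0∞) + 1)⁻¹ ≤ Metric.infEDist (x + t • h) Ωᶜ}
  have hSclosed : ∀ j, IsClosed (S j) := by
    intro j
    have : S j = ⋂ t ∈ Icc (0 : ℝ) 1,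
        {x | ((j : ℝ≥0∞) + 1)⁻¹ ≤ Metric.infEDist (x + t • h) Ωᶜ} := by
      ext x; simp [S]
    rw [this]
    refine isClosed_biInter fun t _ => isClosed_le continuous_const ?_
    exact Metric.continuous_infEDist.comp (by fun_prop)
  have hSmono : Monotone S := by
    intro i j hij x hx t ht
    refine le_trans ?_ (hx t ht)
    gcongr
  have hUnion : A = ⋃ j, A ∩ S j := by
    rw [← inter_iUnion]
    refine (inter_eq_left.2 fun x hx => ?_).symm
    have hcont : Continuous (fun t : ℝ => Metric.infEDist (x + t • h) Ωᶜ) :=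
      Metric.continuous_infEDist.comp (by fun_prop)
    obtain ⟨t₀, ht₀, hmin⟩ := isCompact_Icc.exists_isMinOn (nonempty_Icc.2 zero_le_one)
      hcont.continuousOn (s := Icc (0 : ℝ) 1)
    have hpos : Metric.infEDist (x + t₀ • h) Ωᶜ ≠ 0 := by
      intro h0
      exact (Metric.mem_iff_infEDist_zero_of_closed hΩ.isClosed_compl).2 h0 (hAs x hx t₀ ht₀)
    obtain ⟨j, hj⟩ := ENNReal.exists_inv_nat_lt hpos
    refine mem_iUnion.2 ⟨j, fun t ht => ?_⟩
    refine le_trans ?_ ((hj.le).trans (hmin ht))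
    rw [ENNReal.inv_le_inv]
    exact le_self_add
  have key : ∀ j, ∫⁻ x in A ∩ S j, ‖f (x + h) - f x‖ₑ ^ 2 ≤ B := by
    intro j
    set D := A ∩ S j
    have hD : MeasurableSet D := hA.inter (hSclosed j).measurableSet
    have hf₀eq : ∫⁻ x in D, ‖f (x + h) - f x‖ₑ ^ 2 = ∫⁻ x in D, ‖f₀ (x + h) - f₀ x‖ₑ ^ 2 := by
      refine setLIntegral_congr_fun hD fun x hx => ?_
      have h0 := hAs x hx.1 0 (by simp)
      have h1 := hAs x hx.1 1 (by simp)
      simp only [zero_smul, one_smul, add_zero] at h0 h1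
      simp [hf₀, h0, h1]
    rw [hf₀eq, lintegral_enorm_sq_eq]
    -- the estimate holds for the mollifications on `A ∩ S j`; `N n` is the error of mollifying
    set N : ℕ → ℝ≥0∞ := fun n => eLpNorm (fun x => mollify (k n) f₀ x - f₀ x) 2 volume with hN
    have hNt : Tendsto N atTop (𝓝 0) := by
      have h1 := tendsto_lintegral_mollify_sub_sq hk hs hf₀L
      simp only [lintegral_enorm_sq_eq] at h1
      have h2 := (ENNReal.continuous_rpow_const (y := (1 / 2 : ℝ))).tendsto 0 |>.comp h1
      simp only [Function.comp_def] at h2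
      rw [ENNReal.zero_rpow_of_pos (by norm_num)] at h2
      refine h2.congr fun n => ?_
      rw [← ENNReal.rpow_natCast, ← ENNReal.rpow_mul]
      norm_num [hN]
    have hbound : ∀ᶠ n in atTop, eLpNorm (fun x => f₀ (x + h) - f₀ x) 2 (volume.restrict D)
        ≤ N n + B ^ (1 / 2 : ℝ) + N n := by
      have hev : ∀ᶠ n in atTop, ENNReal.ofReal (s n) < ((j : ℝ≥0∞) + 1)⁻¹ := by
        have : Tendsto (fun n => ENNReal.ofReal (s n)) atTop (𝓝 0) := by
          simpa [Function.comp_def] using (ENNReal.continuous_ofReal.tendsto 0).comp hs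
        exact this.eventually (gt_mem_nhds (by simp))
      filter_upwards [hev] with n hn
      set m := mollify (k n) f₀ with hm
      have hmc : Continuous m :=
        (contDiff_mollify (hk n) (hf₀L.locallyIntegrable (by norm_num))).continuous
      have hdm : AEStronglyMeasurable (fun x => m x - f₀ x) volume :=
        hmc.aestronglyMeasurable.sub hf₀L.1
      have hdm' : AEStronglyMeasurable (fun x => f₀ (x + h) - m (x + h)) volume :=
        (aestronglyMeasurable_comp_add_right (hf₀L.1.sub hmc.aestronglyMeasurable) h)
      have hmm : AEStronglyMeasurable (fun x => m (x + h) - m x) volume :=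
        (Continuous.aestronglyMeasurable (by fun_prop))
      have e1 : (fun x => f₀ (x + h) - f₀ x)
          = ((fun x => f₀ (x + h) - m (x + h)) + fun x => m (x + h) - m x)
            + fun x => m x - f₀ x := by
        ext x; simp
      rw [e1]
      refine (eLpNorm_add_le (hdm'.add hmm).restrict hdm.restrict (by norm_num)).trans ?_
      refine add_le_add ((eLpNorm_add_le hdm'.restrict hmm.restrict (by norm_num)).trans
        (add_le_add ?_ ?_)) (eLpNorm_mono_measure _ Measure.restrict_le_self)
      · refine (eLpNorm_mono_measure _ Measure.restrict_le_self).trans (le_of_eq ?_)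
        have e2 := eLpNorm_comp_measurePreserving (p := 2) (hdm.neg)
          (measurePreserving_add_right volume h)
        have e3 : (fun x => f₀ (x + h) - m (x + h)) = (-fun x => m x - f₀ x) ∘ fun x => x + h := by
          ext x; simp
        rw [e3, e2, eLpNorm_neg]
      · have h3 := lintegral_mollify_translation_sq_le hΩ.measurableSet (hk n) hf hg hw h hD
          (fun x hx t ht y hy => ?_)
        · rw [lintegral_enorm_sq_eq] at h3
          have h4 := ENNReal.rpow_le_rpow h3 (z := (1 / 2 : ℝ)) (by norm_num)
          rw [← ENNReal.rpow_natCast, ← ENNReal.rpow_mul] at h4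
          norm_num at h4
          norm_num
          exact h4
        · by_contra hy'
          have h5 := (hx.2 t ht).trans (Metric.infEDist_le_edist_of_mem (show y ∈ Ωᶜ from hy'))
          rw [Metric.mem_closedBall, dist_comm] at hy
          rw [edist_dist] at h5
          exact absurd (h5.trans (ENNReal.ofReal_le_ofReal hy)) (not_le.2 hn)
    have hlim : Tendsto (fun n => N n + B ^ (1 / 2 : ℝ) + N n) atTop (𝓝 (B ^ (1 / 2 : ℝ))) := by
      simpa using (hNt.add tendsto_const_nhds).add hNt
    have hfin := ge_of_tendsto hlim hbound
    calc _ ≤ (B ^ (1 / 2 : ℝ)) ^ 2 := by gcongr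
      _ = B := by rw [← ENNReal.rpow_natCast, ← ENNReal.rpow_mul]; norm_num
  rw [hUnion, setLIntegral_iUnion_of_directed]
  · exact iSup_le key
  · exact (monotone_const.inter hSmono).directed_le

end

/-! ### Nonlocal Poincaré inequalities -/

section
variable {d : ℕ} {Ω : Set (Eu d)}

/-- The Dirichlet energy `∫_Ω |∇v|²`, as an extended nonnegative number. -/
noncomputable def gradEnergy (v : H1 Ω) : ℝ≥0∞ := ∫⁻ x in Ω, ‖sobGrad v x‖ₑ ^ 2

theorem enorm_add_sq_le (a b : ℝ) : ‖a + b‖ₑ ^ 2 ≤ 2 * (‖a‖ₑ ^ 2 + ‖b‖ₑ ^ 2) := by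
  simp only [Real.enorm_eq_ofReal_abs, ← ENNReal.ofReal_pow (abs_nonneg _), sq_abs]
  rw [← ENNReal.ofReal_add (by positivity) (by positivity),
    show (2 : ℝ≥0∞) = ENNReal.ofReal 2 by norm_num, ← ENNReal.ofReal_mul (by norm_num)]
  refine ENNReal.ofReal_le_ofReal ?_
  nlinarith [sq_nonneg (a - b)]

theorem enorm_add_add_sq_le (a b c : ℝ) :
    ‖a + b + c‖ₑ ^ 2 ≤ 3 * (‖a‖ₑ ^ 2 + ‖b‖ₑ ^ 2 + ‖c‖ₑ ^ 2) := by
  simp only [Real.enorm_eq_ofReal_abs, ← ENNReal.ofReal_pow (abs_nonneg _), sq_abs]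
  rw [← ENNReal.ofReal_add (by positivity) (by positivity),
    ← ENNReal.ofReal_add (by positivity) (by positivity),
    show (3 : ℝ≥0∞) = ENNReal.ofReal 3 by norm_num, ← ENNReal.ofReal_mul (by norm_num)]
  refine ENNReal.ofReal_le_ofReal ?_
  nlinarith [sq_nonneg (a - b), sq_nonneg (a - c), sq_nonneg (b - c)]

theorem measurable_sobVal (v : H1 Ω) : Measurable (sobVal v : Eu d → ℝ) :=
  (Lp.stronglyMeasurable (sobVal v)).measurable

theorem lintegral_sobVal_translation_sq_le (hΩ : IsOpen Ω) (v : H1 Ω) (a h : Eu d)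
    {A : Set (Eu d)} (hA : MeasurableSet A)
    (hAs : ∀ x ∈ A, ∀ t ∈ Icc (0 : ℝ) 1, x + a + t • h ∈ Ω) :
    ∫⁻ x in A, ‖sobVal v (x + a + h) - sobVal v (x + a)‖ₑ ^ 2 ≤ ‖h‖ₑ ^ 2 * gradEnergy v := by
  have hmp : MeasurePreserving (fun x : Eu d => x + a) volume volume :=
    measurePreserving_add_right volume a
  have hemb : MeasurableEmbedding (fun x : Eu d => x + a) :=
    (MeasurableEquiv.addRight a).measurableEmbedding
  rw [hmp.setLIntegral_comp_emb hemb
    (fun y => ‖sobVal v (y + h) - sobVal v y‖ₑ ^ 2) A]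
  refine lintegral_translation_sq_le hΩ (Lp.memLp (sobVal v)) (Lp.memLp (sobGrad v)) v.2 h
    (hemb.measurableSet_image.2 hA) ?_
  rintro _ ⟨x, hx, rfl⟩ t ht
  exact hAs x hx t ht

/-- In a chart, points `x` and `x + h` of `Ω` are joined inside `Ω` by going up, across and down
again. -/
theorem IsChart.lintegral_translation_sq_le (hΩ : IsOpen Ω) {z e : Eu d} {Γ : Eu d → ℝ}
    {K : ℝ≥0} {ε : ℝ} (hc : IsChart Ω z e Γ K ε) (v : H1 Ω) {h : Eu d}
    (hh : (K + 2) * ‖h‖ ≤ ε / 2) :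
    ∫⁻ x in {x | x ∈ Ω ∧ x + h ∈ Ω} ∩ Metric.ball z (ε / 2), ‖sobVal v (x + h) - sobVal v x‖ₑ ^ 2
      ≤ ENNReal.ofReal (3 * (2 * (K + 1) ^ 2 + 1) * ‖h‖ ^ 2) * gradEnergy v := by
  set A := {x | x ∈ Ω ∧ x + h ∈ Ω} ∩ Metric.ball z (ε / 2)
  have hAm : MeasurableSet A := by
    have : IsOpen {x | x ∈ Ω ∧ x + h ∈ Ω} :=
      hΩ.inter (hΩ.preimage (continuous_id.add continuous_const))
    exact (this.inter Metric.isOpen_ball).measurableSet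
  -- the height changes by at most `K ‖h‖` along `h`: after going up by `T` there is room for it
  set T : ℝ := (K + 1) * ‖h‖ with hT
  have hT0 : 0 ≤ T := by positivity
  have hTK : T = K * ‖h‖ + ‖h‖ := by rw [hT]; ring
  have hTsum : T + ‖h‖ ≤ ε / 2 := by rw [hT]; linarith
  have hh0 := norm_nonneg h
  have hnT : ‖T • e‖ = T := by rw [norm_smul, hc.norm_dir, mul_one, Real.norm_of_nonneg hT0]
  have hball : ∀ x ∈ Metric.ball z (ε / 2), ∀ w : Eu d, ‖w‖ ≤ ε / 2 →
      x + w ∈ Metric.ball z ε := by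
    intro x hx w hw
    rw [mem_ball_iff_norm] at *
    calc ‖x + w - z‖ = ‖(x - z) + w‖ := by congr 1; abel
      _ ≤ _ := norm_add_le _ _
      _ < ε := by linarith
  have hmem0 : ∀ x, x ∈ Metric.ball z (ε / 2) → ∀ w : Eu d, ‖w‖ ≤ ε / 2 → 0 < Γ (x + w) →
      x + w ∈ Ω := fun x hx w hw hpos => (hc.mem_iff _ (hball x hx w hw)).2 hpos
  have hΓ : ∀ x ∈ A, 0 < Γ x ∧ 0 < Γ (x + h) := by
    rintro x ⟨⟨hx1, hx2⟩, hxb⟩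
    constructor
    · have := hball x hxb 0 (by rw [norm_zero]; linarith [hc.pos])
      rw [add_zero] at this
      exact (hc.mem_iff _ this).1 hx1
    · exact (hc.mem_iff _ (hball x hxb h (by linarith))).1 hx2
  have h1 : ∫⁻ x in A, ‖sobVal v (x + 0 + T • e) - sobVal v (x + 0)‖ₑ ^ 2
      ≤ ‖T • e‖ₑ ^ 2 * gradEnergy v := by
    refine lintegral_sobVal_translation_sq_le hΩ v 0 (T • e) hAm fun x hx t ht => ?_
    rw [add_zero]
    refine hmem0 x hx.2 _ ?_ ?_
    · rw [norm_smul, hnT, Real.norm_of_nonneg ht.1]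
      nlinarith [ht.2]
    · rw [smul_smul, hc.shift]
      have := mul_nonneg ht.1 hT0
      linarith [(hΓ x hx).1]
  have h2 : ∫⁻ x in A, ‖sobVal v (x + T • e + h) - sobVal v (x + T • e)‖ₑ ^ 2
      ≤ ‖h‖ₑ ^ 2 * gradEnergy v := by
    refine lintegral_sobVal_translation_sq_le hΩ v _ h hAm fun x hx t ht => ?_
    have hth : ‖t • h‖ ≤ ‖h‖ := by
      rw [norm_smul, Real.norm_of_nonneg ht.1]
      nlinarith [ht.2]
    rw [add_assoc]
    refine hmem0 x hx.2 _ ((norm_add_le _ _).trans (by rw [hnT]; linarith)) ?_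
    have e1 : x + (T • e + t • h) = (x + t • h) + T • e := by abel
    rw [e1, hc.shift]
    have := (abs_le.1 (hc.abs_sub_le (x + t • h) x)).1
    rw [add_sub_cancel_left] at this
    have hK : (K : ℝ) * ‖t • h‖ ≤ K * ‖h‖ := mul_le_mul_of_nonneg_left hth K.2
    linarith [(hΓ x hx).1]
  have h3 : ∫⁻ x in A, ‖sobVal v (x + h + T • e) - sobVal v (x + h)‖ₑ ^ 2
      ≤ ‖T • e‖ₑ ^ 2 * gradEnergy v := by
    refine lintegral_sobVal_translation_sq_le hΩ v h (T • e) hAm fun x hx t ht => ?_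
    have htT : ‖t • T • e‖ ≤ T := by
      rw [norm_smul, hnT, Real.norm_of_nonneg ht.1]
      nlinarith [ht.2]
    rw [add_assoc]
    refine hmem0 x hx.2 _ ((norm_add_le _ _).trans (by linarith)) ?_
    rw [← add_assoc, smul_smul, hc.shift]
    have := mul_nonneg ht.1 hT0
    linarith [(hΓ x hx).2]
  have hm : ∀ w w' : Eu d, Measurable fun x => ‖sobVal v (x + w) - sobVal v (x + w')‖ₑ ^ 2 :=
    fun w w' => ((((measurable_sobVal v).comp (measurable_add_const w)).sub
      ((measurable_sobVal v).comp (measurable_add_const w'))).enorm).pow_const 2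
  calc ∫⁻ x in A, ‖sobVal v (x + h) - sobVal v x‖ₑ ^ 2
      ≤ ∫⁻ x in A, 3 * (‖sobVal v (x + 0 + T • e) - sobVal v (x + 0)‖ₑ ^ 2
          + ‖sobVal v (x + T • e + h) - sobVal v (x + T • e)‖ₑ ^ 2
          + ‖sobVal v (x + h + T • e) - sobVal v (x + h)‖ₑ ^ 2) := by
        refine lintegral_mono fun x => ?_
        have e1 : x + h + T • e = x + T • e + h := by abel
        have e2 : sobVal v (x + h) - sobVal v x = (sobVal v (x + 0 + T • e) - sobVal v (x + 0))
            + (sobVal v (x + T • e + h) - sobVal v (x + T • e))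
            + -(sobVal v (x + h + T • e) - sobVal v (x + h)) := by
          rw [e1, add_zero]; ring
        rw [e2]
        refine (enorm_add_add_sq_le _ _ _).trans (le_of_eq ?_)
        rw [enorm_neg]
    _ ≤ 3 * (‖T • e‖ₑ ^ 2 * gradEnergy v + ‖h‖ₑ ^ 2 * gradEnergy v
          + ‖T • e‖ₑ ^ 2 * gradEnergy v) := by
        simp only [add_assoc] at h1 h2 h3 ⊢
        rw [lintegral_const_mul' _ _ (by norm_num), lintegral_add_left (hm _ _),
          lintegral_add_left (hm _ _)]
        gcongr
    _ = _ := by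
        rw [← ofReal_norm, ← ofReal_norm, hnT, ← ENNReal.ofReal_pow hT0,
          ← ENNReal.ofReal_pow hh0, ← add_mul, ← add_mul,
          ← ENNReal.ofReal_add (by positivity) (by positivity),
          ← ENNReal.ofReal_add (by positivity) (by positivity), ← mul_assoc,
          show (3 : ℝ≥0∞) = ENNReal.ofReal 3 by norm_num, ← ENNReal.ofReal_mul (by norm_num)]
        congr 2
        rw [hT]; ring

theorem isCompact_closure (hΩ : IsLipschitzDomain Ω) : IsCompact (closure Ω) :=
  hΩ.isBounded.isCompact_closure

/-- Translation estimate up to the boundary of a Lipschitz domain. -/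
theorem exists_translation_bound (hd : 1 ≤ d) (hΩ : IsLipschitzDomain Ω) :
    ∃ ρ > 0, ∃ C : ℝ, 0 ≤ C ∧ ∀ (v : H1 Ω) (h : Eu d), ‖h‖ ≤ ρ →
      ∫⁻ x in {x | x ∈ Ω ∧ x + h ∈ Ω}, ‖sobVal v (x + h) - sobVal v x‖ₑ ^ 2
        ≤ ENNReal.ofReal (C * ‖h‖ ^ 2) * gradEnergy v := by
  have main : ∃ ρ > 0, ∃ C : ℝ, 0 ≤ C ∧ ∀ (v : H1 Ω) (h : Eu d), ‖h‖ ≤ ρ →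
      ∫⁻ x in {x | x ∈ Ω ∧ x + h ∈ Ω} ∩ closure Ω, ‖sobVal v (x + h) - sobVal v x‖ₑ ^ 2
        ≤ ENNReal.ofReal (C * ‖h‖ ^ 2) * gradEnergy v := by
    refine (isCompact_closure hΩ).induction_on (p := fun S => ∃ ρ > 0, ∃ C : ℝ, 0 ≤ C ∧
      ∀ (v : H1 Ω) (h : Eu d), ‖h‖ ≤ ρ →
      ∫⁻ x in {x | x ∈ Ω ∧ x + h ∈ Ω} ∩ S, ‖sobVal v (x + h) - sobVal v x‖ₑ ^ 2
        ≤ ENNReal.ofReal (C * ‖h‖ ^ 2) * gradEnergy v) ?_ ?_ ?_ ?_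
    · exact ⟨1, one_pos, 0, le_rfl, fun v h _ => by simp⟩
    · rintro S S' hSS' ⟨ρ, hρ, C, hC, hb⟩
      exact ⟨ρ, hρ, C, hC, fun v h hh =>
        (lintegral_mono_set (inter_subset_inter_right _ hSS')).trans (hb v h hh)⟩
    · rintro S S' ⟨ρ, hρ, C, hC, hb⟩ ⟨ρ', hρ', C', hC', hb'⟩
      refine ⟨min ρ ρ', lt_min hρ hρ', C + C', by positivity, fun v h hh => ?_⟩
      rw [inter_union_distrib_left]
      refine (lintegral_union_le _ _ _).trans ?_
      refine (add_le_add (hb v h (hh.trans (min_le_left _ _)))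
        (hb' v h (hh.trans (min_le_right _ _)))).trans (le_of_eq ?_)
      rw [← add_mul, ← ENNReal.ofReal_add (by positivity) (by positivity), add_mul]
    · intro z hz
      obtain ⟨e, Γ, K, ε, hc⟩ := exists_isChart hd hΩ hz
      refine ⟨Metric.ball z (ε / 2), mem_nhdsWithin_of_mem_nhds
        (Metric.ball_mem_nhds z (half_pos hc.pos)), ε / 2 / (K + 2), ?_,
        3 * (2 * (K + 1) ^ 2 + 1), by positivity, fun v h hh => ?_⟩
      · have := hc.pos
        positivity
      · refine hc.lintegral_translation_sq_le hΩ.isOpen v ?_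
        rwa [le_div_iff₀ (by positivity), mul_comm] at hh
  obtain ⟨ρ, hρ, C, hC, hb⟩ := main
  refine ⟨ρ, hρ, C, hC, fun v h hh => ?_⟩
  convert hb v h hh using 3
  exact (inter_eq_left.2 fun x hx => subset_closure hx.1).symm

theorem measurable_enorm_sobVal_sub_sq (v : H1 Ω) :
    Measurable (fun p : Eu d × Eu d => ‖sobVal v p.1 - sobVal v p.2‖ₑ ^ 2) :=
  ((((measurable_sobVal v).comp measurable_fst).sub
    ((measurable_sobVal v).comp measurable_snd)).enorm).pow_const 2

/-- Points of `Ω` at distance less than a small number `s` from each other: the double integral of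
the squared increments is of the order `s² |B_s|`. -/
theorem exists_local_poincare (hd : 1 ≤ d) (hΩ : IsLipschitzDomain Ω) :
    ∃ ρ > 0, ∃ C : ℝ, 0 ≤ C ∧ ∀ (v : H1 Ω) (s : ℝ), 0 < s → s ≤ ρ →
      ∫⁻ x in Ω, ∫⁻ y in Ω ∩ Metric.ball x s, ‖sobVal v x - sobVal v y‖ₑ ^ 2
        ≤ ENNReal.ofReal (C * s ^ 2) * volume (Metric.ball (0 : Eu d) s) * gradEnergy v := by
  obtain ⟨ρ, hρ, C, hC, hb⟩ := exists_translation_bound hd hΩ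
  refine ⟨ρ, hρ, C, hC, fun v s hs hsρ => ?_⟩
  have hΩm := hΩ.isOpen.measurableSet
  set F : Eu d × Eu d → ℝ≥0∞ := fun p => ‖sobVal v p.1 - sobVal v p.2‖ₑ ^ 2 with hF
  have hFm : Measurable F := measurable_enorm_sobVal_sub_sq v
  set W : Set (Eu d × Eu d) := {p | p.1 ∈ Ω ∧ p.1 + p.2 ∈ Ω ∧ p.2 ∈ Metric.ball 0 s} with hW
  have hWmem : ∀ x h, (x, h) ∈ W ↔ x ∈ Ω ∧ x + h ∈ Ω ∧ h ∈ Metric.ball 0 s :=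
    fun _ _ => Iff.rfl
  have hWm : MeasurableSet W :=
    ((hΩ.isOpen.preimage continuous_fst).inter
      ((hΩ.isOpen.preimage (continuous_fst.add continuous_snd)).inter
        (Metric.isOpen_ball.preimage continuous_snd))).measurableSet
  set H : Eu d × Eu d → ℝ≥0∞ := W.indicator (fun p => F (p.1, p.1 + p.2)) with hH
  have hHm : Measurable H := by
    refine Measurable.indicator ?_ hWm
    exact hFm.comp (measurable_fst.prodMk (measurable_fst.add measurable_snd))
  calc ∫⁻ x in Ω, ∫⁻ y in Ω ∩ Metric.ball x s, F (x, y)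
      = ∫⁻ x, ∫⁻ h, H (x, h) := by
        rw [← lintegral_indicator hΩm]
        refine lintegral_congr fun x => ?_
        by_cases hx : x ∈ Ω
        · rw [indicator_of_mem hx, ← lintegral_indicator (hΩm.inter measurableSet_ball),
            ← lintegral_add_left_eq_self _ x]
          refine lintegral_congr fun h => ?_
          have hiff : (x, h) ∈ W ↔ x + h ∈ Ω ∩ Metric.ball x s := by
            simp [hWmem, hx]
          by_cases hm : (x, h) ∈ W
          · rw [hH, indicator_of_mem hm, indicator_of_mem (hiff.1 hm)]
          · rw [hH, indicator_of_notMem hm, indicator_of_notMem (fun h' => hm (hiff.2 h'))]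
        · rw [indicator_of_notMem hx]
          simp [hH, hWmem, hx]
    _ = ∫⁻ h, ∫⁻ x, H (x, h) := lintegral_lintegral_swap hHm.aemeasurable
    _ ≤ ∫⁻ h in Metric.ball (0 : Eu d) s, ENNReal.ofReal (C * s ^ 2) * gradEnergy v := by
        rw [← lintegral_indicator measurableSet_ball]
        refine lintegral_mono fun h => ?_
        by_cases hh : h ∈ Metric.ball (0 : Eu d) s
        · have hn : ‖h‖ < s := by simpa using hh
          rw [indicator_of_mem hh]
          have hm : MeasurableSet {x | x ∈ Ω ∧ x + h ∈ Ω} :=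
            (hΩ.isOpen.inter (hΩ.isOpen.preimage (continuous_id.add continuous_const))).measurableSet
          calc ∫⁻ x, H (x, h)
              = ∫⁻ x in {x | x ∈ Ω ∧ x + h ∈ Ω}, ‖sobVal v (x + h) - sobVal v x‖ₑ ^ 2 := by
                rw [← lintegral_indicator hm]
                refine lintegral_congr fun x => ?_
                have hsym : F (x, x + h) = ‖sobVal v (x + h) - sobVal v x‖ₑ ^ 2 := by
                  simp only [hF]
                  rw [← enorm_neg, neg_sub]
                have hiff : (x, h) ∈ W ↔ x ∈ {x | x ∈ Ω ∧ x + h ∈ Ω} :=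
                  ⟨fun h' => ⟨h'.1, h'.2.1⟩, fun h' => ⟨h'.1, h'.2, hh⟩⟩
                by_cases hm : (x, h) ∈ W
                · rw [hH, indicator_of_mem hm, indicator_of_mem (hiff.1 hm), ← hsym]
                · rw [hH, indicator_of_notMem hm, indicator_of_notMem (fun h' => hm (hiff.2 h'))]
            _ ≤ _ := hb v h (hn.le.trans hsρ)
            _ ≤ _ := by gcongr
        · simp only [hH, indicator, hWmem, hh, and_false, if_false, lintegral_zero,
            le_refl]
    _ = _ := by
        rw [setLIntegral_const]; ring

/-- `S` and `T` are linked if the squared increments of `H¹(Ω)` functions between `S` and `T` are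
controlled by the Dirichlet energy. -/
def IsLinked (Ω S T : Set (Eu d)) : Prop :=
  ∃ C : ℝ≥0, ∀ v : H1 Ω,
    ∫⁻ x in S, ∫⁻ y in T, ‖sobVal v x - sobVal v y‖ₑ ^ 2 ≤ C * gradEnergy v

theorem IsLinked.symm {S T : Set (Eu d)} (h : IsLinked Ω S T) : IsLinked Ω T S := by
  obtain ⟨C, hC⟩ := h
  refine ⟨C, fun v => le_trans (le_of_eq ?_) (hC v)⟩
  rw [lintegral_lintegral_swap (measurable_enorm_sobVal_sub_sq v).aemeasurable]
  refine lintegral_congr fun x => lintegral_congr fun y => ?_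
  rw [← enorm_neg, neg_sub]

/-- Increments between `S` and `U` are compared through the points of an intermediate set `T`. -/
theorem lintegral_lintegral_le_of_quasi_triangle {X : Type*} [MeasurableSpace X] {μ : Measure X}
    [SFinite μ] {F : X → X → ℝ≥0∞} (hFm : Measurable (Function.uncurry F))
    (htri : ∀ x y z, F x z ≤ 2 * (F x y + F z y)) {S T U : Set X} (hT : μ T ≠ ⊤) :
    μ T * ∫⁻ x in S, ∫⁻ z in U, F x z ∂μ ∂μ
      ≤ 2 * (μ U * (∫⁻ x in S, ∫⁻ y in T, F x y ∂μ ∂μ)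
          + μ S * ∫⁻ z in U, ∫⁻ y in T, F z y ∂μ ∂μ) := by
  have hF1 : ∀ x, Measurable (F x) := fun x => hFm.comp measurable_prodMk_left
  have hF2 : Measurable (fun x => ∫⁻ y in T, F x y ∂μ) := Measurable.lintegral_prod_right' hFm
  have hpt : ∀ x z, μ T * F x z ≤ 2 * ((∫⁻ y in T, F x y ∂μ) + ∫⁻ y in T, F z y ∂μ) := by
    intro x z
    rw [mul_comm, ← setLIntegral_const, ← lintegral_add_left (hF1 x),
      ← lintegral_const_mul' _ _ (by norm_num)]
    exact lintegral_mono fun y => htri x y z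
  calc μ T * ∫⁻ x in S, ∫⁻ z in U, F x z ∂μ ∂μ
      = ∫⁻ x in S, ∫⁻ z in U, μ T * F x z ∂μ ∂μ := by
        rw [← lintegral_const_mul' _ _ hT]
        refine lintegral_congr fun x => ?_
        rw [← lintegral_const_mul' _ _ hT]
    _ ≤ ∫⁻ x in S, ∫⁻ z in U, 2 * ((∫⁻ y in T, F x y ∂μ) + ∫⁻ y in T, F z y ∂μ) ∂μ ∂μ :=
        lintegral_mono fun x => lintegral_mono fun z => hpt x z
    _ = ∫⁻ x in S, 2 * (μ U * (∫⁻ y in T, F x y ∂μ)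
          + ∫⁻ z in U, ∫⁻ y in T, F z y ∂μ ∂μ) ∂μ := by
        refine lintegral_congr fun x => ?_
        rw [lintegral_const_mul' _ _ (by norm_num), lintegral_add_left measurable_const,
          setLIntegral_const, mul_comm (μ U)]
    _ = _ := by
        rw [lintegral_const_mul' _ _ (by norm_num),
          lintegral_add_left (hF2.const_mul _), lintegral_const_mul _ hF2,
          setLIntegral_const, mul_comm (μ S)]

/-- Links can be chained through a set of positive measure. -/
theorem IsLinked.trans {S T U : Set (Eu d)} (hST : IsLinked Ω S T) (hTU : IsLinked Ω T U)
    (hS : volume S ≠ ⊤) (hU : volume U ≠ ⊤) (hT : volume T ≠ ⊤) (hT0 : volume T ≠ 0) :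
    IsLinked Ω S U := by
  obtain ⟨C₁, h₁⟩ := hST
  obtain ⟨C₂, h₂⟩ := hTU.symm
  set c : ℝ≥0∞ := (volume T)⁻¹ * (2 * (volume U * C₁ + volume S * C₂)) with hc
  have hcT : c ≠ ⊤ := by
    rw [hc]
    have := ENNReal.inv_ne_top.2 hT0
    finiteness
  refine ⟨c.toNNReal, fun v => ?_⟩
  rw [ENNReal.coe_toNNReal hcT]
  have h3 := lintegral_lintegral_le_of_quasi_triangle (μ := volume) (S := S) (U := U)
    (F := fun x y => ‖sobVal v x - sobVal v y‖ₑ ^ 2) (measurable_enorm_sobVal_sub_sq v)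
    (fun x y z => by
      have e1 : sobVal v x - sobVal v z
          = (sobVal v x - sobVal v y) + -(sobVal v z - sobVal v y) := by ring
      rw [e1]
      refine (enorm_add_sq_le _ _).trans (le_of_eq ?_)
      rw [enorm_neg]) hT
  have h4 : volume T * ∫⁻ x in S, ∫⁻ z in U, ‖sobVal v x - sobVal v z‖ₑ ^ 2
      ≤ 2 * (volume U * (C₁ * gradEnergy v) + volume S * (C₂ * gradEnergy v)) := by
    refine h3.trans ?_
    gcongr
    · exact h₁ v
    · exact h₂ v
  have h5 := mul_le_mul_right h4 (volume T)⁻¹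
  rw [← mul_assoc, ENNReal.inv_mul_cancel hT0 hT, one_mul] at h5
  refine h5.trans (le_of_eq ?_)
  rw [hc]
  ring

/-- The Poincaré inequality on the whole domain: pieces of `Ω` of diameter less than the range of the
local inequality are linked to their neighbours, hence all to each other since `Ω` is connected,
and finitely many of them cover `Ω` by compactness of its closure. -/
theorem isLinked_self (hd : 1 ≤ d) (hΩ : IsLipschitzDomain Ω) : IsLinked Ω Ω Ω := by
  obtain ⟨ρ, hρ, C, hC, hb⟩ := exists_local_poincare hd hΩ
  have hfin : ∀ S ⊆ Ω, volume S ≠ ⊤ := fun S hS =>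
    ((measure_mono hS).trans_lt hΩ.isBounded.measure_lt_top).ne
  set A : Eu d → Set (Eu d) := fun c => Ω ∩ Metric.ball c (ρ / 4) with hA
  have hAΩ : ∀ c, A c ⊆ Ω := fun c => inter_subset_left
  have hA0 : ∀ c ∈ closure Ω, volume (A c) ≠ 0 := by
    intro c hc
    refine ((hΩ.isOpen.inter Metric.isOpen_ball).measure_pos volume ?_).ne'
    rw [inter_comm]
    exact mem_closure_iff_nhds.1 hc _ (Metric.ball_mem_nhds c (by positivity))
  have hnear : ∀ c c' : Eu d, dist c' c < ρ / 4 → IsLinked Ω (A c) (A c') := by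
    intro c c' hcc
    refine ⟨(ENNReal.ofReal (C * ρ ^ 2) * volume (Metric.ball (0 : Eu d) ρ)).toNNReal,
      fun v => ?_⟩
    have hne : ENNReal.ofReal (C * ρ ^ 2) * volume (Metric.ball (0 : Eu d) ρ) ≠ ⊤ :=
      ENNReal.mul_ne_top ENNReal.ofReal_ne_top measure_ball_lt_top.ne
    rw [ENNReal.coe_toNNReal hne]
    refine le_trans ?_ (hb v ρ hρ le_rfl)
    refine (setLIntegral_mono' (hΩ.isOpen.inter Metric.isOpen_ball).measurableSet
      (fun x hx => ?_)).trans (lintegral_mono_set (hAΩ c))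
    refine lintegral_mono_set fun y hy => ⟨hy.1, ?_⟩
    have h1 := hx.2
    have h2 := hy.2
    rw [Metric.mem_ball] at *
    have h3 := dist_triangle4 y c' c x
    rw [dist_comm c x] at h3
    linarith
  obtain ⟨c₀, hc₀⟩ := hΩ.isConnected.nonempty
  have hlink : ∀ c ∈ Ω, IsLinked Ω (A c₀) (A c) := by
    intro c hc
    refine hΩ.isConnected.isPreconnected.induction₂ (fun a b => IsLinked Ω (A a) (A b))
      (fun x hx => ?_) (fun x y z hx hy hz hxy hyz => ?_) (fun x y _ _ h => h.symm) hc₀ hc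
    · exact mem_nhdsWithin_of_mem_nhds (mem_of_superset
        (Metric.ball_mem_nhds x (show 0 < ρ / 4 by positivity)) fun y hy => hnear x y hy)
    · exact hxy.trans hyz (hfin _ (hAΩ x)) (hfin _ (hAΩ z)) (hfin _ (hAΩ y))
        (hA0 y (subset_closure hy))
  have hall : IsLinked Ω (A c₀) (Ω ∩ closure Ω) := by
    refine (isCompact_closure hΩ).induction_on (p := fun S => IsLinked Ω (A c₀) (Ω ∩ S))
      ⟨0, fun v => by simp⟩ ?_ ?_ ?_
    · rintro S S' hSS' ⟨C', hC'⟩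
      exact ⟨C', fun v => (lintegral_mono fun x => lintegral_mono_set
        (inter_subset_inter_right _ hSS')).trans (hC' v)⟩
    · rintro S S' ⟨C₁, h₁⟩ ⟨C₂, h₂⟩
      refine ⟨C₁ + C₂, fun v => ?_⟩
      have hm : Measurable (fun x => ∫⁻ y in Ω ∩ S, ‖sobVal v x - sobVal v y‖ₑ ^ 2) :=
        Measurable.lintegral_prod_right' (measurable_enorm_sobVal_sub_sq v)
      rw [ENNReal.coe_add, add_mul, inter_union_distrib_left]
      refine le_trans ?_ (add_le_add (h₁ v) (h₂ v))
      rw [← lintegral_add_left hm]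
      exact lintegral_mono fun x => lintegral_union_le _ _ _
    · intro c hc
      refine ⟨Metric.ball c (ρ / 4), mem_nhdsWithin_of_mem_nhds
        (Metric.ball_mem_nhds c (by positivity)), ?_⟩
      obtain ⟨c', hc', hdist⟩ := Metric.mem_closure_iff.1 hc (ρ / 4) (by positivity)
      exact (hlink c' hc').trans (hnear c' c hdist) (hfin _ (hAΩ _)) (hfin _ (hAΩ _))
        (hfin _ (hAΩ _)) (hA0 c' (subset_closure hc'))
  rw [inter_eq_left.2 subset_closure] at hall
  exact hall.symm.trans hall (hfin _ subset_rfl) (hfin _ subset_rfl) (hfin _ (hAΩ _))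
    (hA0 c₀ (subset_closure hc₀))

/-- The interior cone condition in its weakest form: `Ω` contains a ball of comparable size near
each of its points. -/
theorem exists_ball_subset_inter (hd : 1 ≤ d) (hΩ : IsLipschitzDomain Ω) :
    ∃ ρ > 0, ∃ κ : ℝ, 0 < κ ∧ ∀ x ∈ Ω, ∀ r, 0 < r → r ≤ ρ →
      ∃ y, Metric.ball y (κ * r) ⊆ Ω ∩ Metric.ball x r := by
  have main : ∃ ρ > 0, ∃ κ : ℝ, 0 < κ ∧ ∀ x ∈ Ω ∩ closure Ω, ∀ r, 0 < r → r ≤ ρ →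
      ∃ y, Metric.ball y (κ * r) ⊆ Ω ∩ Metric.ball x r := by
    refine (isCompact_closure hΩ).induction_on (p := fun S => ∃ ρ > 0, ∃ κ : ℝ, 0 < κ ∧
      ∀ x ∈ Ω ∩ S, ∀ r, 0 < r → r ≤ ρ → ∃ y, Metric.ball y (κ * r) ⊆ Ω ∩ Metric.ball x r)
      ⟨1, one_pos, 1, one_pos, fun x hx => by simp at hx⟩ ?_ ?_ ?_
    · rintro S S' hSS' ⟨ρ, hρ, κ, hκ, hb⟩
      exact ⟨ρ, hρ, κ, hκ, fun x hx => hb x ⟨hx.1, hSS' hx.2⟩⟩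
    · rintro S S' ⟨ρ, hρ, κ, hκ, hb⟩ ⟨ρ', hρ', κ', hκ', hb'⟩
      refine ⟨min ρ ρ', lt_min hρ hρ', min κ κ', lt_min hκ hκ', ?_⟩
      rintro x ⟨hx, hxS | hxS⟩ r hr hrρ
      · obtain ⟨y, hy⟩ := hb x ⟨hx, hxS⟩ r hr (hrρ.trans (min_le_left _ _))
        exact ⟨y, (Metric.ball_subset_ball
          (mul_le_mul_of_nonneg_right (min_le_left _ _) hr.le)).trans hy⟩
      · obtain ⟨y, hy⟩ := hb' x ⟨hx, hxS⟩ r hr (hrρ.trans (min_le_right _ _))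
        exact ⟨y, (Metric.ball_subset_ball
          (mul_le_mul_of_nonneg_right (min_le_right _ _) hr.le)).trans hy⟩
    · intro z hz
      obtain ⟨e, Γ, K, ε, hc⟩ := exists_isChart hd hΩ hz
      have hε := hc.pos
      -- going up by `r / 2` raises the height by `r / 2`, and a ball of radius `r / (2 (K + 1))`
      -- around the new point loses at most that much
      refine ⟨Metric.ball z (ε / 2), mem_nhdsWithin_of_mem_nhds
        (Metric.ball_mem_nhds z (half_pos hε)), ε / 2, half_pos hε, 1 / (2 * (K + 1)),
        by positivity, fun x hx r hr hrρ => ⟨x + (r / 2) • e, fun y hy => ?_⟩⟩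
      have hK : (K : ℝ) * (1 / (2 * (K + 1)) * r) ≤ r / 2 := by
        rw [show (K : ℝ) * (1 / (2 * (K + 1)) * r) = (r / 2) * (K / (K + 1)) by
          field_simp]
        refine mul_le_of_le_one_right (by positivity) ?_
        rw [div_le_one (by positivity)]
        linarith
      have hκ : 1 / (2 * ((K : ℝ) + 1)) * r ≤ r / 2 := by
        rw [div_mul_eq_mul_div, one_mul, div_le_div_iff₀ (by positivity) (by norm_num)]
        nlinarith [K.2, mul_nonneg K.2 hr.le]
      rw [mem_ball_iff_norm] at hy
      have hyx : ‖y - x‖ < r := by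
        calc ‖y - x‖ = ‖(y - (x + (r / 2) • e)) + (r / 2) • e‖ := by congr 1; abel
          _ ≤ ‖y - (x + (r / 2) • e)‖ + ‖(r / 2) • e‖ := norm_add_le _ _
          _ < r := by
            rw [norm_smul, hc.norm_dir, mul_one, Real.norm_of_nonneg (by positivity)]
            linarith
      have hxz := mem_ball_iff_norm.1 hx.2
      have hyz : y ∈ Metric.ball z ε := by
        rw [mem_ball_iff_norm]
        calc ‖y - z‖ = ‖(y - x) + (x - z)‖ := by congr 1; abel
          _ ≤ _ := norm_add_le _ _
          _ < ε := by linarith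
      refine ⟨(hc.mem_iff y hyz).2 ?_, mem_ball_iff_norm.2 hyx⟩
      have h1 : 0 < Γ x := (hc.mem_iff x (Metric.ball_subset_ball (by linarith) hx.2)).1 hx.1
      have h2 := (abs_le.1 (hc.abs_sub_le y (x + (r / 2) • e))).1
      rw [hc.shift] at h2
      have h3 : (K : ℝ) * ‖y - (x + (r / 2) • e)‖ ≤ K * (1 / (2 * (K + 1)) * r) :=
        mul_le_mul_of_nonneg_left hy.le K.2
      linarith
  obtain ⟨ρ, hρ, κ, hκ, hb⟩ := main
  exact ⟨ρ, hρ, κ, hκ, fun x hx => hb x ⟨hx, subset_closure hx⟩⟩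

end

/-! ### Stability of local averages -/

section
variable {d : ℕ} {Ω : Set (Eu d)} {m : ℕ} {B K : Fin m → Set (Eu d)}

theorem diam_le_maxDiam (S : Fin m → Set (Eu d)) (i : Fin m) : Metric.diam (S i) ≤ maxDiam S :=
  le_ciSup (f := fun i => Metric.diam (S i)) (finite_range _).bddAbove i

theorem bddAbove_overlap (Ω : Set (Eu d)) (K : Fin m → Set (Eu d)) :
    BddAbove (range fun x : Ω => Set.ncard {i | (x : Eu d) ∈ K i}) := by
  refine ⟨m, ?_⟩
  rintro _ ⟨x, rfl⟩
  have := Set.ncard_le_ncard (subset_univ {i | (x : Eu d) ∈ K i}) finite_univ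
  simpa [Set.ncard_univ] using this

theorem ncard_le_overlap {x : Eu d} (hx : x ∈ Ω) (K : Fin m → Set (Eu d)) :
    Set.ncard {i | x ∈ K i} ≤ overlap Ω K :=
  le_ciSup (bddAbove_overlap Ω K) (⟨x, hx⟩ : Ω)

theorem IsDataCovering.exists_index (h : IsDataCovering Ω B K) (hΩ : Ω.Nonempty) :
    Nonempty (Fin m) := by
  obtain ⟨x, hx⟩ := hΩ
  obtain ⟨i, -⟩ := mem_iUnion.1 (h.cover hx)
  exact ⟨i⟩

theorem IsDataCovering.one_le_overlap (h : IsDataCovering Ω B K) (hΩ : Ω.Nonempty) :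
    1 ≤ overlap Ω K := by
  obtain ⟨i⟩ := h.exists_index hΩ
  obtain ⟨x, hx⟩ := h.nonempty i
  refine le_trans ?_ (ncard_le_overlap (h.subset i hx) K)
  exact (Set.ncard_pos (toFinite _)).2 ⟨i, h.subset_K i hx⟩

theorem IsDataCovering.maxDiam_pos (hd : 1 ≤ d) (h : IsDataCovering Ω B K) (hΩ : Ω.Nonempty) :
    0 < maxDiam K := by
  obtain ⟨i⟩ := h.exists_index hΩ
  refine lt_of_lt_of_le ?_ (diam_le_maxDiam K i)
  obtain ⟨x, hx⟩ := h.nonempty i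
  obtain ⟨r, hr, hball⟩ := Metric.isOpen_iff.1 (h.isOpen i) x hx
  set e : Eu d := EuclideanSpace.single ⟨0, hd⟩ 1 with he
  have hne : ‖e‖ = 1 := by simp [he]
  have hmem : x + (r / 2) • e ∈ B i := hball (by
    rw [mem_ball_iff_norm, add_sub_cancel_left, norm_smul, hne, Real.norm_of_nonneg (by positivity)]
    linarith)
  have hdist := Metric.dist_le_diam_of_mem (h.bounded i) (h.subset_K i hmem) (h.subset_K i hx)
  rw [dist_eq_norm, add_sub_cancel_left, norm_smul, hne,
    Real.norm_of_nonneg (by positivity)] at hdist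
  linarith

theorem IsDataCovering.measure_B_ne_top (h : IsDataCovering Ω B K) (i : Fin m) :
    volume (B i) ≠ ⊤ := ((h.bounded i).subset (h.subset_K i)).measure_lt_top.ne

theorem IsDataCovering.measure_B_pos (h : IsDataCovering Ω B K) (i : Fin m) :
    0 < volume (B i) := (h.isOpen i).measure_pos volume (h.nonempty i)

/-- The closures of the convex sets are not larger than the data sets, up to a factor. -/
theorem IsDataCovering.measure_closure_le (h : IsDataCovering Ω B K) {η : ℝ}
    (hη : mismatch B K ≤ η) (i : Fin m) :
    volume (closure (K i)) ≤ ENNReal.ofReal (max 1 (η / 3)) * volume (B i) := by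
  have hcl : volume (closure (K i)) = volume (K i) := by
    refine le_antisymm ?_ (measure_mono subset_closure)
    rw [closure_eq_self_union_frontier]
    refine (measure_union_le _ _).trans ?_
    rw [(h.convex i).addHaar_frontier volume, add_zero]
  rw [hcl]
  by_cases hBK : ∀ i, B i = K i
  · rw [← hBK i]
    calc volume (B i) = ENNReal.ofReal 1 * volume (B i) := by simp
      _ ≤ _ := by gcongr; exact le_max_left _ _
  · rw [mismatch, if_neg hBK] at hη
    have h1 : volume.real (K i) / volume.real (B i) ≤ η / 3 := by
      have := le_ciSup (f := fun i => volume.real (K i) / volume.real (B i))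
        (finite_range _).bddAbove i
      linarith [this]
    have hBpos : 0 < volume.real (B i) :=
      ENNReal.toReal_pos (h.measure_B_pos i).ne' (h.measure_B_ne_top i)
    rw [div_le_iff₀ hBpos] at h1
    have hK : volume (K i) = ENNReal.ofReal (volume.real (K i)) :=
      (ENNReal.ofReal_toReal (h.bounded i).measure_lt_top.ne).symm
    have hB : volume (B i) = ENNReal.ofReal (volume.real (B i)) :=
      (ENNReal.ofReal_toReal (h.measure_B_ne_top i)).symm
    rw [hK, hB, ← ENNReal.ofReal_mul (by positivity)]
    refine ENNReal.ofReal_le_ofReal (h1.trans ?_)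
    gcongr
    exact le_max_right _ _

/-- The data sets cover each point of `Ω` at most `overlap Ω K` times. -/
theorem IsDataCovering.sum_lintegral_le (h : IsDataCovering Ω B K) {D : Set (Eu d)}
    (hD : MeasurableSet D) (hDΩ : D ⊆ Ω) {I : Finset (Fin m)} (hI : ∀ i ∈ I, B i ⊆ D)
    {G : Eu d → ℝ≥0∞} (hG : Measurable G) :
    ∑ i ∈ I, ∫⁻ y in B i, G y ≤ overlap Ω K * ∫⁻ y in D, G y := by
  have e : ∀ i ∈ I, ∫⁻ y in B i, G y = ∫⁻ y in D, (B i).indicator G y := by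
    intro i hi
    rw [lintegral_indicator (h.isOpen i).measurableSet,
      Measure.restrict_restrict (h.isOpen i).measurableSet, inter_eq_left.2 (hI i hi)]
  rw [Finset.sum_congr rfl e, ← lintegral_finsetSum _ fun i _ =>
    hG.indicator (h.isOpen i).measurableSet, ← lintegral_const_mul _ hG]
  refine setLIntegral_mono' hD fun y hy => ?_
  classical
  calc ∑ i ∈ I, (B i).indicator G y ≤ ∑ i ∈ Finset.univ.filter (fun i => y ∈ K i), G y := by
        rw [Finset.sum_filter]
        refine (Finset.sum_le_sum_of_subset (Finset.subset_univ I)).trans ?_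
        refine Finset.sum_le_sum fun i _ => ?_
        by_cases hyB : y ∈ B i
        · rw [indicator_of_mem hyB, if_pos (h.subset_K i hyB)]
        · rw [indicator_of_notMem hyB]; exact zero_le
    _ ≤ overlap Ω K * G y := by
        rw [Finset.sum_const, nsmul_eq_mul]
        gcongr
        have := ncard_le_overlap (hDΩ hy) K
        rwa [Set.ncard_eq_toFinset_card', Set.toFinset_ofPred] at this

theorem enorm_average_sq_le {X : Type*} [MeasurableSpace X] {μ : Measure X} {S : Set X}
    (hS0 : μ S ≠ 0) (hS : μ S ≠ ⊤) {q : X → ℝ} (hq : AEStronglyMeasurable q (μ.restrict S)) :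
    μ S * ‖⨍ y in S, q y ∂μ‖ₑ ^ 2 ≤ ∫⁻ y in S, ‖q y‖ₑ ^ 2 ∂μ := by
  have hne : NeZero (μ.restrict S) := ⟨by rwa [Ne, Measure.restrict_eq_zero]⟩
  have hfin : IsFiniteMeasure (μ.restrict S) := ⟨by
    rw [Measure.restrict_apply_univ]; exact hS.lt_top⟩
  set ν := (μ.restrict S univ)⁻¹ • μ.restrict S with hν
  have hprob : IsProbabilityMeasure ν := ⟨by
    rw [hν, Measure.smul_apply, Measure.restrict_apply_univ, smul_eq_mul,
      ENNReal.inv_mul_cancel hS0 hS]⟩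
  have h1 : ‖⨍ y in S, q y ∂μ‖ₑ ≤ eLpNorm q 2 ν := by
    rw [average_eq']
    refine (enorm_integral_le_lintegral_enorm _).trans ?_
    rw [← eLpNorm_one_eq_lintegral_enorm]
    exact eLpNorm_le_eLpNorm_of_exponent_le (by norm_num) (hq.smul_measure _)
  calc μ S * ‖⨍ y in S, q y ∂μ‖ₑ ^ 2 ≤ μ S * eLpNorm q 2 ν ^ 2 := by gcongr
    _ = _ := by
      rw [← lintegral_enorm_sq_eq, hν, lintegral_smul_measure, Measure.restrict_apply_univ,
        smul_eq_mul, ← mul_assoc, ENNReal.mul_inv_cancel hS0 hS, one_mul]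

theorem integrableOn_sobVal (v : H1 Ω) {S : Set (Eu d)} (hS : S ⊆ Ω) (hfin : volume S ≠ ⊤) :
    IntegrableOn (sobVal v) S := by
  have h1 : MemLp (sobVal v) 2 (volume.restrict S) :=
    (Lp.memLp (sobVal v)).mono_measure (Measure.restrict_mono hS le_rfl)
  have : IsFiniteMeasure (volume.restrict S) := ⟨by
    rw [Measure.restrict_apply_univ]; exact hfin.lt_top⟩
  exact h1.integrable (by norm_num)

/-- A value of `v` is controlled by the average over a data set and by the increments to it. -/
theorem IsDataCovering.measure_mul_enorm_sq_le (h : IsDataCovering Ω B K) (v : H1 Ω) (i : Fin m)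
    (x : Eu d) :
    volume (B i) * ‖sobVal v x‖ₑ ^ 2 ≤ 2 * (volume (B i) * ‖⨍ y in B i, sobVal v y‖ₑ ^ 2
      + ∫⁻ y in B i, ‖sobVal v x - sobVal v y‖ₑ ^ 2) := by
  have h0 := (h.measure_B_pos i).ne'
  have h1 := h.measure_B_ne_top i
  have hint := integrableOn_sobVal v (h.subset i) h1
  have hfin : IsFiniteMeasure (volume.restrict (B i)) := ⟨by
    rw [Measure.restrict_apply_univ]; exact h1.lt_top⟩
  have hne : NeZero (volume.restrict (B i)) := ⟨by rwa [Ne, Measure.restrict_eq_zero]⟩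
  have e : sobVal v x - ⨍ y in B i, sobVal v y = ⨍ y in B i, (sobVal v x - sobVal v y) := by
    simp only [average_eq]
    rw [integral_sub (integrable_const _) hint, integral_const, smul_sub, smul_smul,
      inv_mul_cancel₀, one_smul]
    rw [measureReal_restrict_apply_univ]
    exact (ENNReal.toReal_pos h0 h1).ne'
  have h2 := enorm_average_sq_le h0 h1 (q := fun y => sobVal v x - sobVal v y)
    (aestronglyMeasurable_const.sub (measurable_sobVal v).aestronglyMeasurable)
  have e2 : sobVal v x
      = (⨍ y in B i, sobVal v y) + ⨍ y in B i, (sobVal v x - sobVal v y) := by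
    rw [← e]; ring
  calc volume (B i) * ‖sobVal v x‖ₑ ^ 2
      ≤ volume (B i) * (2 * (‖⨍ y in B i, sobVal v y‖ₑ ^ 2
          + ‖⨍ y in B i, (sobVal v x - sobVal v y)‖ₑ ^ 2)) := by
        gcongr
        conv_lhs => rw [e2]
        exact enorm_add_sq_le _ _
    _ = 2 * (volume (B i) * ‖⨍ y in B i, sobVal v y‖ₑ ^ 2
          + volume (B i) * ‖⨍ y in B i, (sobVal v x - sobVal v y)‖ₑ ^ 2) := by ring
    _ ≤ _ := by gcongr

/-- If the data sets within distance `s` of each point of `Ω` have total measure at least `c`, the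
`L²`-norm is controlled by the averages over the data sets and by the increments up to distance
`s`. -/
theorem IsDataCovering.lintegral_sq_le (hΩ : IsOpen Ω) (h : IsDataCovering Ω B K) (v : H1 Ω)
    {s : ℝ} {c : ℝ≥0∞}
    (hc : ∀ x ∈ Ω, ∃ I : Finset (Fin m), (∀ i ∈ I, B i ⊆ Metric.ball x s) ∧
      c ≤ ∑ i ∈ I, volume (B i)) :
    c * ∫⁻ x in Ω, ‖sobVal v x‖ₑ ^ 2
      ≤ 2 * (volume (Metric.ball (0 : Eu d) s)
          * ∑ i, volume (B i) * ‖⨍ y in B i, sobVal v y‖ₑ ^ 2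
        + overlap Ω K
          * ∫⁻ x in Ω, ∫⁻ y in Ω ∩ Metric.ball x s, ‖sobVal v x - sobVal v y‖ₑ ^ 2) := by
  classical
  choose p hp using h.nonempty
  set a : Fin m → ℝ≥0∞ := fun i => volume (B i) * ‖⨍ y in B i, sobVal v y‖ₑ ^ 2 with ha
  obtain ⟨D, hD⟩ : ∃ D : Eu d → ℝ≥0∞,
      D = fun x => ∫⁻ y in Ω ∩ Metric.ball x s, ‖sobVal v x - sobVal v y‖ₑ ^ 2 := ⟨_, rfl⟩
  have hpt : ∀ x ∈ Ω, c * ‖sobVal v x‖ₑ ^ 2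
      ≤ 2 * (∑ i, (Metric.ball (p i) s).indicator (fun _ => a i) x
        + overlap Ω K * D x) := by
    intro x hx
    rw [hD]
    obtain ⟨I, hI, hcI⟩ := hc x hx
    calc c * ‖sobVal v x‖ₑ ^ 2 ≤ (∑ i ∈ I, volume (B i)) * ‖sobVal v x‖ₑ ^ 2 := by gcongr
      _ = ∑ i ∈ I, volume (B i) * ‖sobVal v x‖ₑ ^ 2 := Finset.sum_mul _ _ _
      _ ≤ ∑ i ∈ I, 2 * (a i + ∫⁻ y in B i, ‖sobVal v x - sobVal v y‖ₑ ^ 2) :=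
          Finset.sum_le_sum fun i _ => h.measure_mul_enorm_sq_le v i x
      _ = 2 * (∑ i ∈ I, a i + ∑ i ∈ I, ∫⁻ y in B i, ‖sobVal v x - sobVal v y‖ₑ ^ 2) := by
          rw [← Finset.mul_sum, Finset.sum_add_distrib]
      _ ≤ _ := by
          gcongr
          · refine le_trans (Finset.sum_le_sum fun i hi => ?_)
              (Finset.sum_le_sum_of_subset (Finset.subset_univ I))
            have : x ∈ Metric.ball (p i) s := by
              rw [Metric.mem_ball, dist_comm]
              exact hI i hi (hp i)
            rw [indicator_of_mem this]
          · have hmx : Measurable (fun y => ‖sobVal v x - sobVal v y‖ₑ ^ 2) :=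
              ((measurable_const.sub (measurable_sobVal v)).enorm).pow_const 2
            exact h.sum_lintegral_le (hΩ.inter Metric.isOpen_ball).measurableSet
              inter_subset_left (fun i hi => subset_inter (h.subset i) (hI i hi)) hmx
  have hind : ∀ i, Measurable ((Metric.ball (p i) s).indicator (fun _ : Eu d => a i)) :=
    fun i => measurable_const.indicator measurableSet_ball
  calc c * ∫⁻ x in Ω, ‖sobVal v x‖ₑ ^ 2
      = ∫⁻ x in Ω, c * ‖sobVal v x‖ₑ ^ 2 :=
        (lintegral_const_mul _ ((measurable_sobVal v).enorm.pow_const 2)).symm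
    _ ≤ ∫⁻ x in Ω, 2 * (∑ i, (Metric.ball (p i) s).indicator (fun _ => a i) x
        + overlap Ω K * D x) :=
        setLIntegral_mono' hΩ.measurableSet hpt
    _ = 2 * (∑ i, (∫⁻ x in Ω, (Metric.ball (p i) s).indicator (fun _ => a i) x)
        + overlap Ω K * ∫⁻ x in Ω, D x) := by
        rw [lintegral_const_mul' _ _ (by norm_num),
          lintegral_add_left (Finset.measurable_sum _ fun i _ => hind i),
          lintegral_finsetSum _ fun i _ => hind i,
          lintegral_const_mul' _ _ (ENNReal.natCast_ne_top _)]
    _ ≤ _ := by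
        rw [hD]
        gcongr
        rw [Finset.mul_sum]
        refine Finset.sum_le_sum fun i _ => ?_
        refine (setLIntegral_le_lintegral _ _).trans ?_
        rw [lintegral_indicator measurableSet_ball, setLIntegral_const, mul_comm,
          Measure.addHaar_ball_center]

theorem lintegral_sobVal_sq (v : H1 Ω) :
    ∫⁻ x in Ω, ‖sobVal v x‖ₑ ^ 2 = ENNReal.ofReal (‖sobVal v‖ ^ 2) := by
  rw [lintegral_enorm_sq_eq, ENNReal.ofReal_pow (norm_nonneg _), Lp.norm_def,
    ENNReal.ofReal_toReal (Lp.eLpNorm_ne_top _)]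

theorem gradEnergy_eq (v : H1 Ω) : gradEnergy v = ENNReal.ofReal (‖sobGrad v‖ ^ 2) := by
  rw [gradEnergy, lintegral_enorm_sq_eq, ENNReal.ofReal_pow (norm_nonneg _), Lp.norm_def,
    ENNReal.ofReal_toReal (Lp.eLpNorm_ne_top _)]

theorem dataForm_self_nonneg (B : Fin m → Set (Eu d)) (v : H1 Ω) : 0 ≤ dataForm B v v :=
  Finset.sum_nonneg fun i _ => by
    rw [mul_assoc]
    exact mul_nonneg measureReal_nonneg (mul_self_nonneg _)

theorem IsDataCovering.sum_eq_dataForm (h : IsDataCovering Ω B K) (v : H1 Ω) :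
    ∑ i, volume (B i) * ‖⨍ y in B i, sobVal v y‖ₑ ^ 2 = ENNReal.ofReal (dataForm B v v) := by
  rw [dataForm, ENNReal.ofReal_sum_of_nonneg fun i _ => by
    rw [mul_assoc]
    exact mul_nonneg measureReal_nonneg (mul_self_nonneg _)]
  refine Finset.sum_congr rfl fun i _ => ?_
  rw [mul_assoc, ENNReal.ofReal_mul measureReal_nonneg, measureReal_def,
    ENNReal.ofReal_toReal (h.measure_B_ne_top i), Real.enorm_eq_ofReal_abs,
    ← ENNReal.ofReal_pow (abs_nonneg _), sq_abs, sq]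

theorem le_of_ofReal_estimate {c b a β p : ℝ} {n : ℕ} (hc : 0 ≤ c) (hb : 0 ≤ b) (hβ : 0 ≤ β)
    (hp : 0 ≤ p) {X : ℝ≥0∞} (hX : X ≤ ENNReal.ofReal p)
    (h : ENNReal.ofReal c * ENNReal.ofReal a
      ≤ 2 * (ENNReal.ofReal β * ENNReal.ofReal b + n * X)) :
    c * a ≤ 2 * (β * b + n * p) := by
  have h2 : ENNReal.ofReal (c * a) ≤ ENNReal.ofReal (2 * (β * b + n * p)) := by
    rw [ENNReal.ofReal_mul hc, ENNReal.ofReal_mul (by norm_num),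
      ENNReal.ofReal_add (by positivity) (by positivity), ENNReal.ofReal_mul hβ,
      ENNReal.ofReal_mul (by positivity), ENNReal.ofReal_natCast, ENNReal.ofReal_ofNat]
    refine h.trans ?_
    gcongr
  exact (ENNReal.ofReal_le_ofReal_iff (by positivity)).1 h2

/-- A family of data sets whose companions have closures covering a set of positive measure has
itself comparable total measure. -/
theorem IsDataCovering.measure_le_sum (h : IsDataCovering Ω B K) {η : ℝ}
    (hη : mismatch B K ≤ η) {S : Set (Eu d)} {I : Finset (Fin m)}
    (hS : S ⊆ ⋃ i ∈ I, closure (K i)) :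
    ENNReal.ofReal (max 1 (η / 3))⁻¹ * volume S ≤ ∑ i ∈ I, volume (B i) := by
  have hΛ : 0 < max 1 (η / 3) := lt_max_of_lt_left one_pos
  have h1 : volume S ≤ ENNReal.ofReal (max 1 (η / 3)) * ∑ i ∈ I, volume (B i) := by
    rw [Finset.mul_sum]
    refine (measure_mono hS).trans ((measure_biUnion_finset_le _ _).trans ?_)
    exact Finset.sum_le_sum fun i _ => h.measure_closure_le hη i
  calc _ ≤ ENNReal.ofReal (max 1 (η / 3))⁻¹
        * (ENNReal.ofReal (max 1 (η / 3)) * ∑ i ∈ I, volume (B i)) := by gcongr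
    _ = _ := by
      rw [← mul_assoc, ← ENNReal.ofReal_mul (by positivity), inv_mul_cancel₀ hΛ.ne',
        ENNReal.ofReal_one, one_mul]

set_option maxHeartbeats 1000000 in
/-- The stability estimate of the data: the `L²`-norm is controlled by the Dirichlet energy, with
the factor `R²`, and by the averages over the data sets. If `R` is small, the local Poincaré
inequality at distance `2 R` gives the factor `R²`; if `R` is not small, the Poincaré inequality on
`Ω` suffices, as constants may be divided by the square of the threshold `ρ`. -/
theorem exists_norm_sq_le (hd : 1 ≤ d) (hΩ : IsLipschitzDomain Ω) (M₀ η₀ : ℝ) :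
    ∃ C : ℝ, 0 < C ∧ ∀ (m : ℕ) (B K : Fin m → Set (Eu d)), IsDataCovering Ω B K →
      (overlap Ω K : ℝ) ≤ M₀ → mismatch B K ≤ η₀ → ∀ v : H1 Ω,
      ‖sobVal v‖ ^ 2 ≤ C * (maxDiam K ^ 2 * ‖sobGrad v‖ ^ 2 + dataForm B v v) := by
  obtain ⟨ρ₁, hρ₁, C₁, hC₁, hloc⟩ := exists_local_poincare hd hΩ
  obtain ⟨ρ₂, hρ₂, κ, hκ, hball⟩ := exists_ball_subset_inter hd hΩ
  obtain ⟨C₂, hglob⟩ := isLinked_self hd hΩ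
  set Λ : ℝ := max 1 (η₀ / 3) with hΛdef
  have hΛ : 0 < Λ := lt_max_of_lt_left one_pos
  set ρ : ℝ := min (ρ₁ / 2) (2 * ρ₂) with hρdef
  have hρ : 0 < ρ := lt_min (by positivity) (by positivity)
  have hΩfin : volume Ω ≠ ⊤ := hΩ.isBounded.measure_lt_top.ne
  have hΩpos : 0 < volume.real Ω := ENNReal.toReal_pos
    (hΩ.isOpen.measure_pos volume hΩ.isConnected.nonempty).ne' hΩfin
  set D : ℝ := Metric.diam Ω + 1 with hDdef
  have hD : 0 < D := by
    have := Metric.diam_nonneg (s := Ω)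
    linarith
  set V : ℝ → ℝ := fun r => volume.real (Metric.ball (0 : Eu d) r) with hV
  have hVof : ∀ r, volume (Metric.ball (0 : Eu d) r) = ENNReal.ofReal (V r) := fun r =>
    (ENNReal.ofReal_toReal measure_ball_lt_top.ne).symm
  have hVpos : ∀ r, 0 < r → 0 < V r := fun r hr =>
    ENNReal.toReal_pos (Metric.measure_ball_pos _ _ hr).ne' measure_ball_lt_top.ne
  set Cs : ℝ := 2 * (Λ * (4 / κ) ^ d) * (1 + |M₀| * (C₁ * 4)) with hCs
  set Cl : ℝ := 2 * (Λ / volume.real Ω) * (V D + |M₀| * (C₂ / ρ ^ 2)) with hCl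
  have hCs0 : 0 < Cs := by positivity
  have hCl0 : 0 ≤ Cl := by
    have := (hVpos D hD).le
    positivity
  refine ⟨Cs + Cl, by positivity, fun m B K h hM hη v => ?_⟩
  have hR := h.maxDiam_pos hd hΩ.isConnected.nonempty
  set R := maxDiam K with hRdef
  have hb := dataForm_self_nonneg B v
  have hM' : (overlap Ω K : ℝ) ≤ |M₀| := hM.trans (le_abs_self _)
  have hg : 0 ≤ R ^ 2 * ‖sobGrad v‖ ^ 2 := by positivity
  rcases le_or_gt R ρ with hRρ | hRρ
  · -- small covering sets: localize at distance `2 R`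
    have hR1 : 2 * R ≤ ρ₁ := by have := hRρ.trans (min_le_left _ _); linarith
    have hR2 : R / 2 ≤ ρ₂ := by have := hRρ.trans (min_le_right _ _); linarith
    have hc : ∀ x ∈ Ω, ∃ I : Finset (Fin m), (∀ i ∈ I, B i ⊆ Metric.ball x (2 * R)) ∧
        ENNReal.ofReal (Λ⁻¹ * ((κ / 4) ^ d * V (2 * R))) ≤ ∑ i ∈ I, volume (B i) := by
      classical
      intro x hx
      -- the closures of the `K i` that meet the ball of radius `R / 2` cover its part in `Ω`,
      -- which contains a ball of radius `κ R / 2`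
      refine ⟨Finset.univ.filter fun i => (closure (K i) ∩ Metric.ball x (R / 2)).Nonempty,
        fun i hi y hy => ?_, ?_⟩
      · obtain ⟨w, hwK, hwx⟩ := (Finset.mem_filter.1 hi).2
        have h1 : dist y w ≤ R := by
          refine (Metric.dist_le_diam_of_mem (h.bounded i).closure
            (subset_closure (h.subset_K i hy)) hwK).trans ?_
          rw [Metric.diam_closure]
          exact diam_le_maxDiam K i
        rw [Metric.mem_ball] at hwx ⊢
        have := dist_triangle y w x
        linarith
      · obtain ⟨y, hy⟩ := hball x hx (R / 2) (by positivity) hR2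
        have hsub : Ω ∩ Metric.ball x (R / 2) ⊆ ⋃ i ∈ Finset.univ.filter
            fun i => (closure (K i) ∩ Metric.ball x (R / 2)).Nonempty, closure (K i) := by
          rintro w ⟨hwΩ, hwx⟩
          obtain ⟨i, hi⟩ := mem_iUnion.1 (h.cover hwΩ)
          exact mem_biUnion (x := i) (by simpa using ⟨w, hi, hwx⟩) hi
        refine le_trans ?_ (h.measure_le_sum hη hsub)
        rw [ENNReal.ofReal_mul (by positivity), ← hΛdef]
        gcongr
        refine le_trans (le_of_eq ?_) (measure_mono hy)
        have e : κ * (R / 2) = κ / 4 * (2 * R) := by ring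
        rw [Measure.addHaar_ball_center, e, Measure.addHaar_ball_mul_of_pos _ _ (by positivity),
          ENNReal.ofReal_mul (by positivity), hVof]
        simp
    have h1 := h.lintegral_sq_le hΩ.isOpen v hc
    rw [lintegral_sobVal_sq, h.sum_eq_dataForm, hVof] at h1
    have hVp := hVpos (2 * R) (by positivity)
    have h2 := hloc v (2 * R) (by positivity) hR1
    rw [gradEnergy_eq, hVof, ← ENNReal.ofReal_mul (by positivity),
      ← ENNReal.ofReal_mul (by positivity)] at h2
    have h3 := le_of_ofReal_estimate (by positivity) hb hVp.le (by positivity) h2 h1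
    have h4 : (overlap Ω K : ℝ) * (C₁ * (2 * R) ^ 2 * V (2 * R) * ‖sobGrad v‖ ^ 2)
        ≤ |M₀| * (C₁ * (2 * R) ^ 2 * V (2 * R) * ‖sobGrad v‖ ^ 2) := by gcongr
    have h5 : Λ⁻¹ * (κ / 4) ^ d * ‖sobVal v‖ ^ 2
        ≤ 2 * (dataForm B v v + |M₀| * (C₁ * 4) * (R ^ 2 * ‖sobGrad v‖ ^ 2)) := by
      refine le_of_mul_le_mul_left ?_ hVp
      nlinarith [h3, h4]
    have h6 : ‖sobVal v‖ ^ 2 = (Λ * (4 / κ) ^ d) * (Λ⁻¹ * (κ / 4) ^ d * ‖sobVal v‖ ^ 2) := by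
      have : (4 / κ) ^ d * (κ / 4) ^ d = 1 := by
        rw [← mul_pow, div_mul_div_comm, mul_comm, div_self (by positivity), one_pow]
      field_simp
      rw [div_pow, div_pow]
      field_simp
    have h7 : (Λ * (4 / κ) ^ d) * (Λ⁻¹ * (κ / 4) ^ d * ‖sobVal v‖ ^ 2)
        ≤ (Λ * (4 / κ) ^ d)
          * (2 * (dataForm B v v + |M₀| * (C₁ * 4) * (R ^ 2 * ‖sobGrad v‖ ^ 2))) := by gcongr
    have hΛκ : 0 < Λ * (4 / κ) ^ d := by positivity
    have h8 : 0 ≤ |M₀| * (C₁ * 4) := by positivity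
    have h9 : (Λ * (4 / κ) ^ d)
          * (2 * (dataForm B v v + |M₀| * (C₁ * 4) * (R ^ 2 * ‖sobGrad v‖ ^ 2)))
        ≤ Cs * (R ^ 2 * ‖sobGrad v‖ ^ 2 + dataForm B v v) := by
      rw [hCs, mul_assoc 2, mul_assoc 2, mul_left_comm, mul_assoc (Λ * (4 / κ) ^ d)]
      gcongr
      nlinarith [mul_nonneg h8 hb]
    have h10 : 0 ≤ Cl * (R ^ 2 * ‖sobGrad v‖ ^ 2 + dataForm B v v) := by positivity
    rw [h6, add_mul]
    linarith
  · -- large covering sets: the whole domain lies within distance `D` of each of its points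
    have hΩD : ∀ x ∈ Ω, Ω ⊆ Metric.ball x D := fun x hx y hy => by
      rw [Metric.mem_ball]
      have := Metric.dist_le_diam_of_mem hΩ.isBounded hy hx
      linarith
    have hc : ∀ x ∈ Ω, ∃ I : Finset (Fin m), (∀ i ∈ I, B i ⊆ Metric.ball x D) ∧
        ENNReal.ofReal (Λ⁻¹ * volume.real Ω) ≤ ∑ i ∈ I, volume (B i) := by
      intro x hx
      refine ⟨Finset.univ, fun i _ => (h.subset i).trans (hΩD x hx), ?_⟩
      have := h.measure_le_sum hη (S := Ω) (I := Finset.univ) (by simpa using h.cover)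
      rwa [ENNReal.ofReal_mul (by positivity), measureReal_def, ENNReal.ofReal_toReal hΩfin]
    have h1 := h.lintegral_sq_le hΩ.isOpen v hc
    rw [lintegral_sobVal_sq, h.sum_eq_dataForm, hVof] at h1
    have h2 : ∫⁻ x in Ω, ∫⁻ y in Ω ∩ Metric.ball x D, ‖sobVal v x - sobVal v y‖ₑ ^ 2
        ≤ ENNReal.ofReal (C₂ * ‖sobGrad v‖ ^ 2) := by
      rw [ENNReal.ofReal_mul (NNReal.coe_nonneg C₂), ← gradEnergy_eq, ENNReal.ofReal_coe_nnreal]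
      refine le_trans (lintegral_mono fun x => lintegral_mono_set inter_subset_left) (hglob v)
    have hVp := hVpos D hD
    have h3 := le_of_ofReal_estimate (by positivity) hb hVp.le (by positivity) h2 h1
    have h4 : (overlap Ω K : ℝ) * (C₂ * ‖sobGrad v‖ ^ 2)
        ≤ |M₀| * (C₂ / ρ ^ 2) * (R ^ 2 * ‖sobGrad v‖ ^ 2) := by
      calc (overlap Ω K : ℝ) * (C₂ * ‖sobGrad v‖ ^ 2)
          ≤ |M₀| * (C₂ * ‖sobGrad v‖ ^ 2) := by gcongr
        _ = |M₀| * (C₂ / ρ ^ 2) * (ρ ^ 2 * ‖sobGrad v‖ ^ 2) := by field_simp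
        _ ≤ _ := by gcongr
    have h6 : ‖sobVal v‖ ^ 2
        = (Λ / volume.real Ω) * (Λ⁻¹ * volume.real Ω * ‖sobVal v‖ ^ 2) := by
      field_simp
    have h7 : (Λ / volume.real Ω) * (Λ⁻¹ * volume.real Ω * ‖sobVal v‖ ^ 2)
        ≤ (Λ / volume.real Ω) * (2 * (V D * dataForm B v v
          + |M₀| * (C₂ / ρ ^ 2) * (R ^ 2 * ‖sobGrad v‖ ^ 2))) := by
      refine mul_le_mul_of_nonneg_left (h3.trans ?_) (by positivity)
      linarith
    have h8 : 0 ≤ |M₀| * ((C₂ : ℝ) / ρ ^ 2) := by positivity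
    have h9 : (Λ / volume.real Ω) * (2 * (V D * dataForm B v v
          + |M₀| * (C₂ / ρ ^ 2) * (R ^ 2 * ‖sobGrad v‖ ^ 2)))
        ≤ Cl * (R ^ 2 * ‖sobGrad v‖ ^ 2 + dataForm B v v) := by
      rw [hCl, mul_assoc 2, mul_assoc 2, mul_left_comm, mul_assoc (Λ / volume.real Ω)]
      gcongr
      nlinarith [mul_nonneg h8 hb, mul_nonneg hVp.le hg]
    have h10 : 0 ≤ Cs * (R ^ 2 * ‖sobGrad v‖ ^ 2 + dataForm B v v) := by positivity
    rw [h6, add_mul]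
    linarith

end

/-! ### The divergence theorem and traces in a Lipschitz epigraph -/

/-- A Lipschitz function growing with unit speed in the direction of the unit vector `e`. -/
structure IsHeight {d : ℕ} (e : Eu d) (Γ : Eu d → ℝ) (K : ℝ≥0) : Prop where
  norm_dir : ‖e‖ = 1
  lip : LipschitzWith K Γ
  shift : ∀ x (t : ℝ), Γ (x + t • e) = Γ x + t

section
variable {d : ℕ}

theorem IsChart.isHeight {Ω : Set (Eu d)} {z e : Eu d} {Γ : Eu d → ℝ} {K : ℝ≥0} {ε : ℝ}
    (h : IsChart Ω z e Γ K ε) : IsHeight e Γ K := ⟨h.norm_dir, h.lip, h.shift⟩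

/-- The projection along `e` to the graph `{Γ = 0}`. -/
def foot (e : Eu d) (Γ : Eu d → ℝ) (x : Eu d) : Eu d := x - Γ x • e

/-- The layer of height `τ` above the graph `{Γ = 0}`. -/
def layer (Γ : Eu d → ℝ) (τ : ℝ) : Set (Eu d) := {x | 0 ≤ Γ x ∧ Γ x < τ}

variable {e : Eu d} {Γ : Eu d → ℝ} {K : ℝ≥0}

theorem mem_layer {x : Eu d} {τ : ℝ} : x ∈ layer Γ τ ↔ 0 ≤ Γ x ∧ Γ x < τ := Iff.rfl

theorem IsHeight.shift_sub (h : IsHeight e Γ K) (x : Eu d) (t : ℝ) : Γ (x - t • e) = Γ x - t := by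
  have := h.shift x (-t)
  rwa [neg_smul, ← sub_eq_add_neg, ← sub_eq_add_neg] at this

theorem IsHeight.apply_foot (h : IsHeight e Γ K) (x : Eu d) : Γ (foot e Γ x) = 0 := by
  rw [foot, h.shift_sub, sub_self]

theorem IsHeight.foot_shift (h : IsHeight e Γ K) (x : Eu d) (t : ℝ) :
    foot e Γ (x + t • e) = foot e Γ x := by
  rw [foot, foot, h.shift, add_smul]; abel

theorem IsHeight.continuous (h : IsHeight e Γ K) : Continuous Γ := h.lip.continuous

theorem IsHeight.continuous_foot (h : IsHeight e Γ K) : Continuous (foot e Γ) := by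
  have := h.continuous
  unfold foot
  fun_prop

theorem IsHeight.measurableSet_layer (h : IsHeight e Γ K) (τ : ℝ) :
    MeasurableSet (layer Γ τ) :=
  (measurableSet_le measurable_const h.continuous.measurable).inter
    (measurableSet_lt h.continuous.measurable measurable_const)

theorem IsHeight.norm_sub_foot (h : IsHeight e Γ K) (x : Eu d) : ‖x - foot e Γ x‖ = |Γ x| := by
  rw [foot, sub_sub_cancel, norm_smul, h.norm_dir, mul_one, Real.norm_eq_abs]

theorem IsHeight.lineDeriv_shift (h : IsHeight e Γ K) (x a : Eu d) (t : ℝ) :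
    lineDeriv ℝ Γ (x + t • e) a = lineDeriv ℝ Γ x a := by
  have : (fun s : ℝ => Γ (x + t • e + s • a)) = fun s => Γ (x + s • a) + t := by
    ext s
    rw [← h.shift]; congr 1; abel
  rw [lineDeriv, this, deriv_add_const, lineDeriv]

/-- Level sets of a height are null: uncountably many disjoint translates of each other. -/
theorem IsHeight.measure_level (h : IsHeight e Γ K) (c : ℝ) : volume {x | Γ x = c} = 0 := by
  have hcount := Measure.countable_meas_level_set_pos (μ := (volume : Measure (Eu d)))
    h.continuous.measurable
  by_contra hne
  have huniv : {t : ℝ | 0 < volume {a : Eu d | Γ a = t}} = univ := by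
    refine eq_univ_of_forall fun t => ?_
    have hpre : (fun x => x + (t - c) • e) ⁻¹' {a | Γ a = t} = {x | Γ x = c} := by
      ext x
      change Γ (x + (t - c) • e) = t ↔ Γ x = c
      rw [h.shift]
      constructor <;> intro h' <;> linarith
    have := measure_preimage_add_right volume ((t - c) • e) {a : Eu d | Γ a = t}
    rw [hpre] at this
    change 0 < volume {a : Eu d | Γ a = t}
    rw [← this]
    exact pos_iff_ne_zero.2 hne
  rw [huniv] at hcount
  exact not_countable (countable_univ_iff.1 hcount)

theorem integrable_of_bounded_support {q : Eu d → ℝ} (hq : AEStronglyMeasurable q volume)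
    {c r : ℝ} (hc : ∀ x, |q x| ≤ c) (hr : ∀ x, r < ‖x‖ → q x = 0) : Integrable q := by
  have hi : Integrable ((Metric.closedBall (0 : Eu d) r).indicator fun _ => c) :=
    (integrable_indicator_iff measurableSet_closedBall).2
      (integrableOn_const measure_closedBall_lt_top.ne)
  refine hi.mono' hq (ae_of_all _ fun x => ?_)
  by_cases hx : x ∈ Metric.closedBall (0 : Eu d) r
  · rw [indicator_of_mem hx]; exact hc x
  · rw [indicator_of_notMem hx, hr x (by simpa using hx), norm_zero]

/-- The layer of height `τ` consists of `n` translates of the layer of height `τ / n`. -/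
theorem integral_layer_eq_of_shift (h : IsHeight e Γ K) {q : Eu d → ℝ}
    (hq : ∀ x (t : ℝ), q (x + t • e) = q x) {τ : ℝ} (hi : IntegrableOn q (layer Γ τ))
    {n : ℕ} (hn : 0 < n) :
    ∫ x in layer Γ τ, q x = n * ∫ x in layer Γ (τ / n), q x := by
  set ε := τ / n with hε
  have hn' : (0 : ℝ) < n := by exact_mod_cast hn
  have hτ : τ = n * ε := by rw [hε]; field_simp
  rcases le_or_gt ε 0 with hε0 | hε0
  · have h1 : layer Γ ε = ∅ := by
      ext x; simp only [mem_layer, mem_empty_iff_false, iff_false, not_and, not_lt]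
      intro hx; linarith
    have h2 : layer Γ τ = ∅ := by
      ext x; simp only [mem_layer, mem_empty_iff_false, iff_false, not_and, not_lt]
      intro hx; rw [hτ]; nlinarith
    simp [h1, h2]
  have main : ∀ j : ℕ, j ≤ n → ∫ x in layer Γ (j * ε), q x = j * ∫ x in layer Γ ε, q x := by
    intro j
    induction j with
    | zero =>
      intro _
      have h1 : layer Γ ((0 : ℕ) * ε) = ∅ := by
        ext x; simp only [mem_layer, mem_empty_iff_false, iff_false, not_and, not_lt]
        intro hx; simpa using hx
      rw [h1]; simp
    | succ j ih =>
      intro hj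
      have hjn : ((j + 1 : ℕ) : ℝ) ≤ n := by exact_mod_cast hj
      have hjn' : ((j + 1 : ℕ) : ℝ) * ε ≤ τ := by rw [hτ]; gcongr
      push_cast at hjn' ⊢
      set S : Set (Eu d) := (fun x => x + (-(j * ε)) • e) ⁻¹' layer Γ ε with hS
      have hSm : ∀ x, x ∈ S ↔ j * ε ≤ Γ x ∧ Γ x < (j + 1) * ε := by
        intro x
        change (0 ≤ Γ (x + (-(j * ε)) • e) ∧ Γ (x + (-(j * ε)) • e) < ε) ↔ _
        rw [h.shift]
        constructor <;> rintro ⟨h1, h2⟩ <;> constructor <;> linarith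
      have hSmeas : MeasurableSet S := (measurable_add_const _) (h.measurableSet_layer ε)
      have hjε : 0 ≤ (j : ℝ) * ε := by positivity
      have hsplit : layer Γ ((j + 1) * ε) = layer Γ (j * ε) ∪ S := by
        ext x
        rw [mem_union, mem_layer, mem_layer, hSm]
        constructor
        · rintro ⟨h1, h2⟩
          rcases lt_or_ge (Γ x) (j * ε) with h3 | h3
          · exact Or.inl ⟨h1, h3⟩
          · exact Or.inr ⟨h3, h2⟩
        · rintro (⟨h1, h2⟩ | ⟨h1, h2⟩)
          · exact ⟨h1, by linarith⟩
          · exact ⟨by linarith, h2⟩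
      have hdisj : Disjoint (layer Γ (j * ε)) S := by
        rw [Set.disjoint_left]
        intro x h1 h2
        have := (hSm x).1 h2
        exact absurd h1.2 (not_lt.2 this.1)
      have hsub1 : layer Γ (j * ε) ⊆ layer Γ τ := fun x hx => ⟨hx.1, by linarith [hx.2]⟩
      have hsub2 : S ⊆ layer Γ τ := fun x hx => by
        have := (hSm x).1 hx
        exact ⟨by linarith, by linarith⟩
      rw [hsplit, setIntegral_union hdisj hSmeas (hi.mono_set hsub1) (hi.mono_set hsub2),
        ih (by omega)]
      have htr : ∫ x in S, q x = ∫ x in layer Γ ε, q x := by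
        rw [← (measurePreserving_add_right volume ((-(j * ε)) • e)).setIntegral_preimage_emb
          (MeasurableEquiv.addRight ((-(j * ε)) • e)).measurableEmbedding q (layer Γ ε)]
        simp only [hq]
        rfl
      rw [htr]; ring
  have := main n le_rfl
  rwa [← hτ] at this

/-- Integration by parts against the truncated height, whose gradient is that of `Γ` on the layer
and zero elsewhere. -/
theorem IsHeight.integral_layer_mul_lineDeriv (h : IsHeight e Γ K) {G : Eu d → ℝ}
    (hG : ContDiff ℝ 1 G) (hGc : HasCompactSupport G) (a : Eu d) {ε : ℝ} (hε : 0 < ε) :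
    ∫ x in layer Γ ε, G x * lineDeriv ℝ Γ x a
      = - ∫ x, fderiv ℝ G x a * min (max (Γ x) 0) ε := by
  have hf : LipschitzWith K fun x => min (max (Γ x) 0) ε := (h.lip.max_const 0).min_const ε
  obtain ⟨D, hD⟩ := hG.lipschitzWith_of_hasCompactSupport hGc one_ne_zero
  have hibp := hf.integral_lineDeriv_mul_eq (μ := volume) hD hGc a
  have hright : ∫ x, lineDeriv ℝ G x (-a) * min (max (Γ x) 0) ε
      = - ∫ x, fderiv ℝ G x a * min (max (Γ x) 0) ε := by
    rw [← integral_neg]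
    refine integral_congr_ae (ae_of_all _ fun x => ?_)
    simp only
    rw [lineDeriv_neg, (hG.differentiable one_ne_zero x).lineDeriv_eq_fderiv, neg_mul]
  rw [← hright, ← hibp, ← integral_indicator (h.measurableSet_layer ε)]
  have h0 : ∀ᵐ x : Eu d, Γ x ≠ 0 := by
    rw [ae_iff]; simpa using h.measure_level 0
  have h1 : ∀ᵐ x : Eu d, Γ x ≠ ε := by
    rw [ae_iff]; simpa using h.measure_level ε
  refine integral_congr_ae ?_
  filter_upwards [h0, h1] with x hx0 hx1
  have hcont : Continuous (fun t : ℝ => Γ (x + t • a)) := by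
    have := h.continuous
    fun_prop
  have hx : (fun t : ℝ => Γ (x + t • a)) 0 = Γ x := by simp
  rcases lt_or_gt_of_ne hx0 with hlt | hgt
  · have hev : (fun t : ℝ => min (max (Γ (x + t • a)) 0) ε) =ᶠ[𝓝 0] fun _ => 0 := by
      filter_upwards [hcont.continuousAt.eventually (gt_mem_nhds (by rwa [hx]))] with t ht
      rw [max_eq_right ht.le, min_eq_left hε.le]
    rw [indicator_of_notMem (fun hm : x ∈ layer Γ ε => absurd hm.1 (not_le.2 hlt)),
      lineDeriv, hev.deriv_eq, deriv_const, zero_mul]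
  · rcases lt_or_gt_of_ne hx1 with hlt' | hgt'
    · have hev : (fun t : ℝ => min (max (Γ (x + t • a)) 0) ε) =ᶠ[𝓝 0]
          fun t => Γ (x + t • a) := by
        filter_upwards [hcont.continuousAt.eventually (lt_mem_nhds (by rwa [hx])),
          hcont.continuousAt.eventually (gt_mem_nhds (by rwa [hx]))] with t ht ht'
        rw [max_eq_left ht.le, min_eq_left ht'.le]
      rw [indicator_of_mem (show x ∈ layer Γ ε from ⟨hgt.le, hlt'⟩), mul_comm]
      congr 1
      rw [lineDeriv, lineDeriv, hev.deriv_eq]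
    · have hev : (fun t : ℝ => min (max (Γ (x + t • a)) 0) ε) =ᶠ[𝓝 0] fun _ => ε := by
        filter_upwards [hcont.continuousAt.eventually (lt_mem_nhds (by rwa [hx]))] with t ht
        rw [max_eq_left (hε.le.trans ht.le), min_eq_right ht.le]
      rw [indicator_of_notMem (fun hm : x ∈ layer Γ ε => absurd hm.2 (not_lt.2 hgt'.le)),
        lineDeriv, hev.deriv_eq, deriv_const, zero_mul]

/-- The divergence theorem in the epigraph `{0 < Γ}`. The boundary integral is written as an
integral over a layer of height `τ`, with the integrand constant in the direction `e`. -/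
theorem IsHeight.integral_fderiv_epigraph (h : IsHeight e Γ K) {G : Eu d → ℝ}
    (hG : ContDiff ℝ 1 G) (hGc : HasCompactSupport G) (a : Eu d) {τ : ℝ} (hτ : 0 < τ) :
    ∫ x in {x | 0 < Γ x}, fderiv ℝ G x a
      = - (τ⁻¹ * ∫ x in layer Γ τ, G (foot e Γ x) * lineDeriv ℝ Γ x a) := by
  set ν : Eu d → ℝ := fun x => lineDeriv ℝ Γ x a with hν
  have hνm : Measurable ν := measurable_lineDeriv h.continuous
  have hνb : ∀ x, |ν x| ≤ K * ‖a‖ := fun x => norm_lineDeriv_le_of_lipschitz ℝ h.lip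
  obtain ⟨L, hL⟩ := hG.lipschitzWith_of_hasCompactSupport hGc one_ne_zero
  obtain ⟨c, hc⟩ := hGc.exists_bound_of_continuous hG.continuous
  have hc0 : 0 ≤ c := (norm_nonneg _).trans (hc 0)
  obtain ⟨r, hr⟩ := hGc.isCompact.isBounded.subset_closedBall 0
  have hGr : ∀ x, r < ‖x‖ → G x = 0 := fun x hx => by
    by_contra hne
    have := hr (subset_tsupport G hne)
    rw [mem_closedBall_zero_iff] at this
    linarith
  have hfootr : ∀ x, Γ x < τ → 0 ≤ Γ x → r + τ < ‖x‖ → G (foot e Γ x) = 0 := by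
    intro x hx1 hx0 hx
    refine hGr _ ?_
    have h1 := h.norm_sub_foot x
    rw [abs_of_nonneg hx0] at h1
    have h2 := norm_sub_norm_le x (foot e Γ x)
    linarith
  have hGf : Continuous fun x => G (foot e Γ x) := hG.continuous.comp h.continuous_foot
  set q : Eu d → ℝ := fun x => G (foot e Γ x) * ν x with hq
  have hqshift : ∀ x (t : ℝ), q (x + t • e) = q x := fun x t => by
    simp only [hq, hν, h.foot_shift, h.lineDeriv_shift]
  have hprodb : ∀ x y, |G x * ν y| ≤ c * (K * ‖a‖) := fun x y => by
    rw [abs_mul]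
    exact mul_le_mul (hc x) (hνb y) (abs_nonneg _) hc0
  have hqi : IntegrableOn q (layer Γ τ) := by
    rw [← integrable_indicator_iff (h.measurableSet_layer τ)]
    refine integrable_of_bounded_support (c := c * (K * ‖a‖)) (r := r + τ) ?_ ?_ ?_
    · exact ((hGf.measurable.mul hνm).indicator (h.measurableSet_layer τ)).aestronglyMeasurable
    · intro x
      by_cases hx : x ∈ layer Γ τ
      · rw [indicator_of_mem hx]; exact hprodb _ _
      · rw [indicator_of_notMem hx, abs_zero]; positivity
    · intro x hxr
      by_cases hx : x ∈ layer Γ τ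
      · rw [indicator_of_mem hx, hq]
        simp only
        rw [hfootr x hx.2 hx.1 hxr, zero_mul]
      · rw [indicator_of_notMem hx]
  have hGνi : Integrable fun x => G x * ν x := by
    refine integrable_of_bounded_support (c := c * (K * ‖a‖)) (r := r)
      (hG.continuous.measurable.mul hνm).aestronglyMeasurable (fun x => hprodb x x) ?_
    intro x hx
    rw [hGr x hx, zero_mul]
  set ε : ℕ → ℝ := fun n => τ / ((n + 1 : ℕ) : ℝ) with hε
  have hεpos : ∀ n, 0 < ε n := fun n => by
    have : (0 : ℝ) < ((n + 1 : ℕ) : ℝ) := by positivity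
    exact div_pos hτ this
  have hεle : ∀ n, ε n ≤ τ := fun n => by
    refine div_le_self hτ.le ?_
    exact_mod_cast Nat.succ_le_succ (Nat.zero_le n)
  have hεlim : Tendsto ε atTop (𝓝 0) := by
    have h1 := (tendsto_const_div_atTop_nhds_zero_nat τ).comp (tendsto_add_atTop_nat 1)
    exact h1
  have hfderiv : Continuous fun x => fderiv ℝ G x a :=
    (hG.continuous_fderiv one_ne_zero).clm_apply continuous_const
  have hfint : Integrable fun x => fderiv ℝ G x a :=
    hfderiv.integrable_of_hasCompactSupport (hGc.fderiv_apply ℝ a)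
  have hset : MeasurableSet {x | 0 < Γ x} :=
    measurableSet_lt measurable_const h.continuous.measurable
  -- the truncated heights, divided by `ε`, increase to the indicator of the epigraph
  have hlim1 : Tendsto (fun n => ∫ x, fderiv ℝ G x a * (min (max (Γ x) 0) (ε n) / ε n)) atTop
      (𝓝 (∫ x in {x | 0 < Γ x}, fderiv ℝ G x a)) := by
    rw [← integral_indicator hset]
    refine tendsto_integral_of_dominated_convergence (fun x => |fderiv ℝ G x a|) ?_ hfint.abs ?_ ?_
    · intro n
      have := h.continuous
      exact Continuous.aestronglyMeasurable (by fun_prop)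
    · intro n
      refine ae_of_all _ fun x => ?_
      rw [norm_mul, Real.norm_eq_abs, Real.norm_eq_abs]
      refine mul_le_of_le_one_right (abs_nonneg _) ?_
      rw [abs_of_nonneg (div_nonneg (le_min (le_max_right _ _) (hεpos n).le) (hεpos n).le),
        div_le_one (hεpos n)]
      exact min_le_right _ _
    · refine ae_of_all _ fun x => ?_
      by_cases hx : 0 < Γ x
      · rw [indicator_of_mem (show x ∈ {x | 0 < Γ x} from hx)]
        refine tendsto_const_nhds.congr' ?_
        filter_upwards [hεlim.eventually (gt_mem_nhds hx)] with n hn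
        rw [max_eq_left hx.le, min_eq_right hn.le, div_self (hεpos n).ne', mul_one]
      · rw [indicator_of_notMem (show x ∉ {x | 0 < Γ x} from hx)]
        refine tendsto_const_nhds.congr fun n => ?_
        rw [max_eq_right (not_lt.1 hx), min_eq_left (hεpos n).le, zero_div, mul_zero]
  -- on a thin layer `G` is close to its value at the foot point
  have hlim2 : Tendsto (fun n => ∫ x, (layer Γ (ε n)).indicator
      (fun x => (ε n)⁻¹ * ((G x - G (foot e Γ x)) * ν x)) x) atTop (𝓝 (∫ _ : Eu d, (0 : ℝ))) := by
    have hmeas : ∀ n, Measurable ((layer Γ (ε n)).indicator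
        (fun x => (ε n)⁻¹ * ((G x - G (foot e Γ x)) * ν x))) := fun n =>
      (((hG.continuous.measurable.sub hGf.measurable).mul hνm).const_mul _).indicator
        (h.measurableSet_layer _)
    refine tendsto_integral_of_dominated_convergence
      ((Metric.closedBall (0 : Eu d) (r + τ)).indicator fun _ => L * (K * ‖a‖)) ?_ ?_ ?_ ?_
    · exact fun n => (hmeas n).aestronglyMeasurable
    · exact (integrable_indicator_iff measurableSet_closedBall).2
        (integrableOn_const measure_closedBall_lt_top.ne)
    · refine fun n => ae_of_all _ fun x => ?_
      by_cases hx : x ∈ layer Γ (ε n)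
      · have hxτ : Γ x < τ := hx.2.trans_le (hεle n)
        rw [indicator_of_mem hx]
        by_cases hxr : x ∈ Metric.closedBall (0 : Eu d) (r + τ)
        · rw [indicator_of_mem hxr, norm_mul, norm_mul, Real.norm_eq_abs, Real.norm_eq_abs,
            abs_of_pos (inv_pos.2 (hεpos n)), ← mul_assoc]
          refine mul_le_mul ?_ (hνb x) (abs_nonneg _) L.2
          rw [inv_mul_le_iff₀ (hεpos n)]
          have h1 := hL.dist_le_mul x (foot e Γ x)
          rw [dist_eq_norm, dist_eq_norm, h.norm_sub_foot, abs_of_nonneg hx.1] at h1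
          rw [mul_comm]
          exact h1.trans (mul_le_mul_of_nonneg_left hx.2.le L.2)
        · rw [indicator_of_notMem hxr]
          have hxn : r + τ < ‖x‖ := by simpa using hxr
          rw [hGr x (by linarith), hfootr x hxτ hx.1 hxn]
          simp
      · rw [indicator_of_notMem hx, norm_zero]
        refine indicator_nonneg (fun _ _ => ?_) x
        positivity
    · have h0 : ∀ᵐ x : Eu d, Γ x ≠ 0 := by
        rw [ae_iff]; simpa using h.measure_level 0
      filter_upwards [h0] with x hx
      refine tendsto_const_nhds.congr' ?_
      rcases lt_or_gt_of_ne hx with hlt | hgt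
      · refine Eventually.of_forall fun n => ?_
        exact (indicator_of_notMem
          (fun hm : x ∈ layer Γ (ε n) => absurd hm.1 (not_le.2 hlt)) _).symm
      · filter_upwards [hεlim.eventually (gt_mem_nhds hgt)] with n hn
        exact (indicator_of_notMem
          (fun hm : x ∈ layer Γ (ε n) => absurd hm.2 (not_lt.2 hn.le)) _).symm
  have hlim := hlim1.add hlim2
  have hconst : ∀ n, (∫ x, fderiv ℝ G x a * (min (max (Γ x) 0) (ε n) / ε n))
      + (∫ x, (layer Γ (ε n)).indicator
        (fun x => (ε n)⁻¹ * ((G x - G (foot e Γ x)) * ν x)) x)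
      = - (τ⁻¹ * ∫ x in layer Γ τ, q x) := by
    intro n
    have hsub : layer Γ (ε n) ⊆ layer Γ τ := fun x hx => ⟨hx.1, hx.2.trans_le (hεle n)⟩
    have e1 : ∫ x, fderiv ℝ G x a * (min (max (Γ x) 0) (ε n) / ε n)
        = - ((ε n)⁻¹ * ∫ x in layer Γ (ε n), G x * ν x) := by
      rw [h.integral_layer_mul_lineDeriv hG hGc a (hεpos n), mul_neg, neg_neg,
        ← integral_const_mul]
      refine integral_congr_ae (ae_of_all _ fun x => ?_)
      simp only
      ring
    have e2 : ∫ x, (layer Γ (ε n)).indicator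
        (fun x => (ε n)⁻¹ * ((G x - G (foot e Γ x)) * ν x)) x
        = (ε n)⁻¹ * ((∫ x in layer Γ (ε n), G x * ν x) - ∫ x in layer Γ (ε n), q x) := by
      rw [integral_indicator (h.measurableSet_layer _), integral_const_mul,
        ← integral_sub hGνi.integrableOn (hqi.mono_set hsub)]
      congr 1
      refine integral_congr_ae (ae_of_all _ fun x => ?_)
      simp only [hq]
      ring
    rw [e1, e2, integral_layer_eq_of_shift h hqshift hqi (Nat.succ_pos n)]
    have hε' : ε n = τ / ((n + 1 : ℕ) : ℝ) := rfl
    rw [← hε', hε']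
    have hn : (0 : ℝ) < ((n + 1 : ℕ) : ℝ) := by positivity
    field_simp
    ring
  simp only [hconst, integral_zero, add_zero] at hlim
  exact (tendsto_nhds_unique tendsto_const_nhds hlim).symm

end

section
variable {d : ℕ} {e : Eu d} {Γ : Eu d → ℝ} {K : ℝ≥0}

theorem enorm_setIntegral_sq_le {X : Type*} [MeasurableSpace X] {μ : Measure X} {S : Set X}
    (hS : μ S ≠ ⊤) {q : X → ℝ} (hq : AEStronglyMeasurable q (μ.restrict S)) :
    ‖∫ y in S, q y ∂μ‖ₑ ^ 2 ≤ μ S * ∫⁻ y in S, ‖q y‖ₑ ^ 2 ∂μ := by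
  by_cases h0 : μ S = 0
  · simp [Measure.restrict_eq_zero.2 h0]
  have h1 := enorm_average_sq_le h0 hS hq
  have h2 : ‖∫ y in S, q y ∂μ‖ₑ = μ S * ‖⨍ y in S, q y ∂μ‖ₑ := by
    have hpos : 0 < μ.real S := ENNReal.toReal_pos h0 hS
    have : ∫ y in S, q y ∂μ = μ.real S * ⨍ y in S, q y ∂μ := by
      rw [average_eq, measureReal_restrict_apply_univ, smul_eq_mul, ← mul_assoc,
        mul_inv_cancel₀ hpos.ne', one_mul]
    rw [this, enorm_mul, Real.enorm_eq_ofReal hpos.le, measureReal_def, ENNReal.ofReal_toReal hS]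
  rw [h2, mul_pow, sq (μ S), mul_assoc]
  gcongr

/-- The trace inequality: values on the graph are controlled by the function and its derivative
in the layer above. -/
theorem IsHeight.lintegral_foot_sq_le (h : IsHeight e Γ K) {w : Eu d → ℝ} (hw : ContDiff ℝ 1 w)
    {τ : ℝ} (hτ : 0 < τ) :
    ∫⁻ x in layer Γ τ, ‖w (foot e Γ x)‖ₑ ^ 2
      ≤ 2 * ((∫⁻ x in layer Γ τ, ‖w x‖ₑ ^ 2)
        + ENNReal.ofReal (τ ^ 2) * ∫⁻ x in layer Γ τ, ‖fderiv ℝ w x e‖ₑ ^ 2) := by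
  set D : Eu d → ℝ := fun x => fderiv ℝ w x e with hD
  have hDc : Continuous D := (hw.continuous_fderiv one_ne_zero).clm_apply continuous_const
  have hLm := h.measurableSet_layer τ
  -- the fundamental theorem of calculus along the segment from the foot point to `x`
  have hftc : ∀ x, w x - w (foot e Γ x) = ∫ s in (0 : ℝ)..Γ x, D (x - s • e) := by
    intro x
    have hd : ∀ s : ℝ, HasDerivAt (fun s : ℝ => -w (x - s • e)) (D (x - s • e)) s := by
      intro s
      have h1 : HasFDerivAt w (fderiv ℝ w (x - s • e)) (x - s • e) :=
        (hw.differentiable one_ne_zero _).hasFDerivAt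
      have h2 : HasDerivAt (fun s : ℝ => x - s • e) (-e) s := by
        simpa using ((hasDerivAt_id s).smul_const e).const_sub x
      have h3 : HasDerivAt (fun s : ℝ => -w (x - s • e)) (-(fderiv ℝ w (x - s • e) (-e))) s :=
        (h1.comp_hasDerivAt s h2).neg
      simpa [hD] using h3
    have hc : Continuous fun s : ℝ => D (x - s • e) := by fun_prop
    have := intervalIntegral.integral_eq_sub_of_hasDerivAt (a := 0) (b := Γ x)
      (fun s _ => hd s) (hc.intervalIntegrable 0 (Γ x))
    rw [this, foot, zero_smul, sub_zero]; ring
  set W : Set (Eu d × ℝ) := {p | p.1 ∈ layer Γ τ ∧ 0 < p.2 ∧ p.2 ≤ Γ p.1} with hW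
  have hWm : MeasurableSet W := by
    have h1 : MeasurableSet {p : Eu d × ℝ | p.1 ∈ layer Γ τ} := measurable_fst hLm
    have h2 : MeasurableSet {p : Eu d × ℝ | 0 < p.2} := measurableSet_lt measurable_const
      measurable_snd
    have h3 : MeasurableSet {p : Eu d × ℝ | p.2 ≤ Γ p.1} := measurableSet_le measurable_snd
      (h.continuous.measurable.comp measurable_fst)
    exact h1.inter (h2.inter h3)
  set H : Eu d × ℝ → ℝ≥0∞ := W.indicator fun p => ‖D (p.1 - p.2 • e)‖ₑ ^ 2 with hH
  have hHm : Measurable H := by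
    have : Continuous fun p : Eu d × ℝ => D (p.1 - p.2 • e) := by fun_prop
    exact (this.measurable.enorm.pow_const 2).indicator hWm
  have hdiff : ∀ x ∈ layer Γ τ,
      ‖w x - w (foot e Γ x)‖ₑ ^ 2 ≤ ENNReal.ofReal τ * ∫⁻ s, H (x, s) := by
    intro x hx
    have hc : Continuous fun s : ℝ => D (x - s • e) := by fun_prop
    rw [hftc, intervalIntegral.integral_of_le hx.1]
    refine (enorm_setIntegral_sq_le (by simp) hc.aestronglyMeasurable).trans ?_
    rw [Real.volume_Ioc, sub_zero, ← lintegral_indicator measurableSet_Ioc]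
    gcongr with s
    · exact hx.2.le
    · by_cases hs : s ∈ Ioc 0 (Γ x)
      · rw [indicator_of_mem hs, hH, indicator_of_mem (show (x, s) ∈ W from ⟨hx, hs.1, hs.2⟩)]
      · rw [indicator_of_notMem hs]; exact zero_le
  have hswap : ∫⁻ x in layer Γ τ, ∫⁻ s, H (x, s)
      ≤ ENNReal.ofReal τ * ∫⁻ x in layer Γ τ, ‖D x‖ₑ ^ 2 := by
    calc ∫⁻ x in layer Γ τ, ∫⁻ s, H (x, s) ≤ ∫⁻ x, ∫⁻ s, H (x, s) := setLIntegral_le_lintegral _ _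
      _ = ∫⁻ s, ∫⁻ x, H (x, s) := lintegral_lintegral_swap hHm.aemeasurable
      _ ≤ ∫⁻ s in Ioc 0 τ, ∫⁻ x in layer Γ τ, ‖D x‖ₑ ^ 2 := by
          rw [← lintegral_indicator measurableSet_Ioc]
          refine lintegral_mono fun s => ?_
          by_cases hs : s ∈ Ioc 0 τ
          · rw [indicator_of_mem hs, ← lintegral_indicator hLm]
            refine le_trans (lintegral_mono fun x => ?_)
              (le_of_eq (lintegral_sub_right_eq_self _ (s • e)))
            by_cases hx : (x, s) ∈ W
            · have hmem : x - s • e ∈ layer Γ τ := by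
                rw [mem_layer, h.shift_sub]
                have h1 := hx.1.2
                have h2 := hx.2.2
                have h3 := hs.1
                simp only at h1 h2
                exact ⟨by linarith, by linarith⟩
              rw [hH, indicator_of_mem hx, indicator_of_mem hmem]
            · rw [hH, indicator_of_notMem hx]; exact zero_le
          · have hzero : ∀ x, H (x, s) = 0 := fun x =>
              indicator_of_notMem (fun hx => hs ⟨hx.2.1, hx.2.2.trans hx.1.2.le⟩) _
            simp [hzero]
      _ = _ := by
          rw [setLIntegral_const, Real.volume_Ioc, sub_zero, mul_comm]
  calc ∫⁻ x in layer Γ τ, ‖w (foot e Γ x)‖ₑ ^ 2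
      ≤ ∫⁻ x in layer Γ τ, 2 * (‖w x‖ₑ ^ 2 + ENNReal.ofReal τ * ∫⁻ s, H (x, s)) := by
        refine setLIntegral_mono' hLm fun x hx => ?_
        have e1 : w (foot e Γ x) = w x + -(w x - w (foot e Γ x)) := by ring
        rw [e1]
        refine (enorm_add_sq_le _ _).trans ?_
        rw [enorm_neg]
        gcongr
        exact hdiff x hx
    _ = 2 * ((∫⁻ x in layer Γ τ, ‖w x‖ₑ ^ 2)
          + ENNReal.ofReal τ * ∫⁻ x in layer Γ τ, ∫⁻ s, H (x, s)) := by
        rw [lintegral_const_mul' _ _ (by norm_num),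
          lintegral_add_left (hw.continuous.measurable.enorm.pow_const 2),
          lintegral_const_mul' _ _ ENNReal.ofReal_ne_top]
    _ ≤ _ := by
        refine mul_le_mul_right (add_le_add le_rfl ?_) 2
        refine (mul_le_mul_right hswap _).trans (le_of_eq ?_)
        rw [← mul_assoc, ← ENNReal.ofReal_mul hτ.le, ← sq]

/-- A set of vanishing surface measure is the foot of a Lebesgue null set: in coordinates with
`e` as an axis, the foot map forgets at most the coordinate along `e`. -/
theorem IsHeight.volume_foot_preimage_eq_zero (hd : 1 ≤ d) (h : IsHeight e Γ K) {N : Set (Eu d)}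
    (hN : Measure.hausdorffMeasure ((d : ℝ) - 1) N = 0) :
    volume (foot e Γ ⁻¹' N) = 0 := by
  obtain ⟨n, rfl⟩ : ∃ n, d = n + 1 := ⟨d - 1, by omega⟩
  obtain ⟨b, hb⟩ := Orthonormal.exists_orthonormalBasis_extension_of_card_eq (𝕜 := ℝ)
    (E := Eu (n + 1)) (ι := Fin (n + 1)) (by simp) (v := fun _ => e) (s := {0}) (by
      constructor
      · intro i; simpa using h.norm_dir
      · intro i j hij
        exact absurd (Subsingleton.elim i j) hij)
  -- the coordinates orthogonal to `e`: invariant under the foot map, and `1`-Lipschitz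
  set q : Eu (n + 1) → (Fin n → ℝ) := fun x i => b.repr x i.succ with hq
  have hqe : ∀ i : Fin n, b.repr e i.succ = 0 := by
    intro i
    have h0 : b 0 = e := hb 0 rfl
    rw [← h0, b.repr_self]
    simp [Fin.succ_ne_zero]
  have hqfoot : ∀ x, q (foot e Γ x) = q x := by
    intro x
    ext i
    simp only [hq, foot, map_sub, map_smul]
    simp [hqe]
  have hqlip : LipschitzWith 1 q := by
    refine LipschitzWith.of_dist_le_mul fun x y => ?_
    rw [NNReal.coe_one, one_mul, dist_pi_le_iff dist_nonneg]
    intro i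
    simp only [hq]
    rw [Real.dist_eq, dist_eq_norm, ← b.repr.norm_map (x - y), map_sub]
    have := PiLp.norm_apply_le (b.repr x - b.repr y) i.succ
    simpa using this
  have hqN : volume (q '' N) = 0 := by
    have h1 := hqlip.hausdorffMeasure_image_le (d := (n : ℝ)) (by positivity) N
    have e1 : ((n + 1 : ℕ) : ℝ) - 1 = n := by push_cast; ring
    rw [e1] at hN
    have e2 : (Measure.hausdorffMeasure (n : ℝ) : Measure (Fin n → ℝ)) = volume := by
      have := hausdorffMeasure_pi_real (ι := Fin n)
      rwa [Fintype.card_fin] at this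
    rw [hN, mul_zero, e2] at h1
    exact le_antisymm h1 zero_le
  have hqmp : Measure.QuasiMeasurePreserving q volume volume := by
    have h1 := b.repr.measurePreserving
    have h2 := PiLp.volume_preserving_ofLp (Fin (n + 1))
    have h3 := volume_preserving_piFinSuccAbove (fun _ : Fin (n + 1) => ℝ) 0
    have h4 := (h3.comp (h2.comp h1)).quasiMeasurePreserving
    have h5 := (Measure.quasiMeasurePreserving_snd (μ := (volume : Measure ℝ))
      (ν := (volume : Measure (Fin n → ℝ)))).comp h4
    have e3 : q = Prod.snd ∘ (⇑(MeasurableEquiv.piFinSuccAbove (fun _ : Fin (n + 1) => ℝ) 0) ∘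
        (WithLp.ofLp ∘ ⇑b.repr)) := by
      refine funext fun x => funext fun i => ?_
      simp [hq, MeasurableEquiv.piFinSuccAbove, Fin.tail]
    rw [e3]
    exact h5
  refine measure_mono_null ?_ (hqmp.preimage_null hqN)
  intro x hx
  exact ⟨foot e Γ x, hx, hqfoot x⟩

/-- At a point of the graph, the gradient of the height is parallel to the outer normal. -/
theorem IsChart.fderiv_eq_zero_of_isOuterNormalAt {Ω : Set (Eu d)} {z₀ : Eu d} {ε : ℝ}
    (h : IsChart Ω z₀ e Γ K ε) {z n : Eu d} (hz : z ∈ Metric.ball z₀ ε) (hz0 : Γ z = 0)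
    (hdiff : DifferentiableAt ℝ Γ z) (hn : IsOuterNormalAt Ω z n) {p : Eu d}
    (hp : (inner ℝ p n : ℝ) = 0) : fderiv ℝ Γ z p = 0 := by
  -- along a direction `w` pointing into `Ω` the height cannot decrease
  have hin : ∀ w : Eu d, (inner ℝ w n : ℝ) < 0 → 0 ≤ fderiv ℝ Γ z w := by
    intro w hw
    have hw0 : 0 < ‖w‖ := by
      rw [norm_pos_iff]; rintro rfl; simp at hw
    set c : ℝ := -(inner ℝ w n : ℝ) / (2 * ‖w‖) with hc
    have hc0 : 0 < c := div_pos (by linarith) (by positivity)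
    obtain ⟨ρ, hρ, hcone⟩ := hn.2 c hc0
    have hder : HasDerivAt (fun t : ℝ => Γ (z + t • w)) (fderiv ℝ Γ z w) 0 := by
      have h1 : HasFDerivAt Γ (fderiv ℝ Γ z) (z + (0 : ℝ) • w) := by
        simpa using hdiff.hasFDerivAt
      have h2 : HasDerivAt (fun t : ℝ => z + t • w) w 0 := by
        simpa using ((hasDerivAt_id (0 : ℝ)).smul_const w).const_add z
      exact h1.comp_hasDerivAt 0 h2
    have hslope := (hasDerivAt_iff_tendsto_slope.1 hder).mono_left
      (nhdsWithin_mono 0 (show Ioi (0 : ℝ) ⊆ {0}ᶜ from fun t ht => ne_of_gt ht))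
    refine ge_of_tendsto hslope ?_
    have hcont : Continuous fun t : ℝ => z + t • w := by fun_prop
    have hev : ∀ᶠ t : ℝ in 𝓝 0, z + t • w ∈ Metric.ball z ρ ∩ Metric.ball z₀ ε := by
      refine hcont.continuousAt.eventually_mem ?_
      rw [zero_smul, add_zero]
      exact inter_mem (Metric.ball_mem_nhds z hρ) (Metric.isOpen_ball.mem_nhds hz)
    filter_upwards [nhdsWithin_le_nhds hev, self_mem_nhdsWithin] with t ht htpos
    have htpos' : (0 : ℝ) < t := htpos
    have hmem : z + t • w ∈ Ω := by
      refine (hcone _ ht.1).1 ?_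
      rw [add_sub_cancel_left, inner_smul_left, norm_smul, Real.norm_of_nonneg htpos'.le]
      simp only [conj_trivial]
      have : c * ‖w‖ = -(inner ℝ w n : ℝ) / 2 := by rw [hc]; field_simp
      nlinarith
    have hpos := (h.mem_iff _ ht.2).1 hmem
    rw [slope_def_field]
    simp only [zero_smul, add_zero, sub_zero, hz0]
    positivity
  have hnn : (inner ℝ n n : ℝ) = 1 := by rw [real_inner_self_eq_norm_sq, hn.1, one_pow]
  -- tangential directions are limits of inward ones; they come in pairs `±p`
  have hperp : ∀ w : Eu d, (inner ℝ w n : ℝ) = 0 → 0 ≤ fderiv ℝ Γ z w := by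
    intro w hw
    have hlim : Tendsto (fun s : ℝ => fderiv ℝ Γ z (w - s • n)) (𝓝[>] 0)
        (𝓝 (fderiv ℝ Γ z w)) := by
      have : Continuous fun s : ℝ => fderiv ℝ Γ z (w - s • n) := by fun_prop
      have h2 := this.tendsto 0
      rw [zero_smul, sub_zero] at h2
      exact h2.mono_left nhdsWithin_le_nhds
    refine ge_of_tendsto hlim ?_
    filter_upwards [self_mem_nhdsWithin] with s hs
    refine hin _ ?_
    rw [inner_sub_left, hw, inner_smul_left, hnn]
    simpa using hs
  refine le_antisymm ?_ (hperp p hp)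
  have := hperp (-p) (by rw [inner_neg_left, hp, neg_zero])
  rw [map_neg] at this
  linarith

end

/-! ### Limits of products -/

section
variable {X : Type*} [MeasurableSpace X] {μ : Measure X}

theorem lintegral_enorm_mul_le {a b : X → ℝ} (ha : AEStronglyMeasurable a μ)
    (hb : AEStronglyMeasurable b μ) :
    ∫⁻ x, ‖a x * b x‖ₑ ∂μ
      ≤ (∫⁻ x, ‖a x‖ₑ ^ 2 ∂μ) ^ (1 / 2 : ℝ) * (∫⁻ x, ‖b x‖ₑ ^ 2 ∂μ) ^ (1 / 2 : ℝ) := by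
  have h := ENNReal.lintegral_mul_le_Lp_mul_Lq μ (p := 2) (q := 2)
    Real.HolderConjugate.two_two ha.enorm hb.enorm
  have e : ∀ y : ℝ≥0∞, y ^ (2 : ℝ) = y ^ 2 := fun y => by
    rw [← ENNReal.rpow_natCast]; norm_num
  simpa only [Pi.mul_apply, ← enorm_mul, e] using h

theorem lintegral_sq_ne_top {f : X → ℝ} (hf : MemLp f 2 μ) : ∫⁻ x, ‖f x‖ₑ ^ 2 ∂μ ≠ ⊤ := by
  rw [lintegral_enorm_sq_eq]
  exact (ENNReal.pow_lt_top hf.2).ne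

/-- Products of sequences converging in `L²` converge in `L¹`. -/
theorem tendsto_lintegral_mul_sub {f h : X → ℝ} {F H : ℕ → X → ℝ}
    (hf : MemLp f 2 μ) (hh : MemLp h 2 μ)
    (hF : ∀ n, AEStronglyMeasurable (F n) μ) (hH : ∀ n, AEStronglyMeasurable (H n) μ)
    (hFt : Tendsto (fun n => ∫⁻ x, ‖F n x - f x‖ₑ ^ 2 ∂μ) atTop (𝓝 0))
    (hHt : Tendsto (fun n => ∫⁻ x, ‖H n x - h x‖ₑ ^ 2 ∂μ) atTop (𝓝 0)) :
    Tendsto (fun n => ∫⁻ x, ‖F n x * H n x - f x * h x‖ₑ ∂μ) atTop (𝓝 0) := by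
  have hpow : ∀ {u : ℕ → ℝ≥0∞}, Tendsto u atTop (𝓝 0) →
      Tendsto (fun n => u n ^ (1 / 2 : ℝ)) atTop (𝓝 0) := by
    intro u hu
    have h2 := (ENNReal.continuous_rpow_const (y := (1 / 2 : ℝ))).tendsto 0 |>.comp hu
    simp only [Function.comp_def] at h2
    rwa [ENNReal.zero_rpow_of_pos (by norm_num)] at h2
  have hA := hpow hFt
  have hB := hpow hHt
  have hfc : (∫⁻ x, ‖f x‖ₑ ^ 2 ∂μ) ^ (1 / 2 : ℝ) ≠ ⊤ :=
    ENNReal.rpow_ne_top_of_nonneg (by norm_num) (lintegral_sq_ne_top hf)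
  have hhc : (∫⁻ x, ‖h x‖ₑ ^ 2 ∂μ) ^ (1 / 2 : ℝ) ≠ ⊤ :=
    ENNReal.rpow_ne_top_of_nonneg (by norm_num) (lintegral_sq_ne_top hh)
  have hbound : Tendsto (fun n =>
      (∫⁻ x, ‖F n x - f x‖ₑ ^ 2 ∂μ) ^ (1 / 2 : ℝ) * (∫⁻ x, ‖H n x - h x‖ₑ ^ 2 ∂μ) ^ (1 / 2 : ℝ)
      + (∫⁻ x, ‖f x‖ₑ ^ 2 ∂μ) ^ (1 / 2 : ℝ) * (∫⁻ x, ‖H n x - h x‖ₑ ^ 2 ∂μ) ^ (1 / 2 : ℝ)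
      + (∫⁻ x, ‖F n x - f x‖ₑ ^ 2 ∂μ) ^ (1 / 2 : ℝ) * (∫⁻ x, ‖h x‖ₑ ^ 2 ∂μ) ^ (1 / 2 : ℝ))
      atTop (𝓝 (0 * 0 + _ * 0 + 0 * _)) :=
    ((ENNReal.Tendsto.mul hA (Or.inr (by norm_num)) hB (Or.inr (by norm_num))).add
      (ENNReal.Tendsto.const_mul hB (Or.inr hfc))).add
      (ENNReal.Tendsto.mul_const hA (Or.inr hhc))
  simp only [zero_mul, mul_zero, add_zero] at hbound
  refine tendsto_of_tendsto_of_tendsto_of_le_of_le tendsto_const_nhds hbound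
    (fun n => zero_le) fun n => ?_
  have m1 := (hF n).sub hf.1
  have m2 := (hH n).sub hh.1
  calc ∫⁻ x, ‖F n x * H n x - f x * h x‖ₑ ∂μ
      ≤ ∫⁻ x, (‖(F n x - f x) * (H n x - h x)‖ₑ + ‖f x * (H n x - h x)‖ₑ
          + ‖(F n x - f x) * h x‖ₑ) ∂μ := by
        refine lintegral_mono fun x => ?_
        have e : F n x * H n x - f x * h x = (F n x - f x) * (H n x - h x)
          + f x * (H n x - h x) + (F n x - f x) * h x := by ring
        rw [e]
        exact (enorm_add_le _ _).trans (add_le_add (enorm_add_le _ _) le_rfl)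
    _ = (∫⁻ x, ‖(F n x - f x) * (H n x - h x)‖ₑ ∂μ) + (∫⁻ x, ‖f x * (H n x - h x)‖ₑ ∂μ)
          + ∫⁻ x, ‖(F n x - f x) * h x‖ₑ ∂μ := by
        rw [lintegral_add_left', lintegral_add_left']
        · exact (m1.mul m2).enorm
        · exact (m1.mul m2).enorm.add (hf.1.mul m2).enorm
    _ ≤ _ := add_le_add (add_le_add (lintegral_enorm_mul_le m1 m2)
        (lintegral_enorm_mul_le hf.1 m2)) (lintegral_enorm_mul_le m1 hh.1)

/-- A sequence which is Cauchy in `L²` and converges almost everywhere converges in `L²`. -/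
theorem tendsto_lintegral_sub_of_cauchy {F : ℕ → X → ℝ} {f : X → ℝ}
    (hF : ∀ n, AEStronglyMeasurable (F n) μ)
    (hcauchy : ∀ ε > 0, ∃ N, ∀ n ≥ N, ∀ m ≥ N, ∫⁻ x, ‖F n x - F m x‖ₑ ^ 2 ∂μ ≤ ε)
    (hlim : ∀ᵐ x ∂μ, Tendsto (fun n => F n x) atTop (𝓝 (f x))) :
    Tendsto (fun n => ∫⁻ x, ‖F n x - f x‖ₑ ^ 2 ∂μ) atTop (𝓝 0) := by
  rw [ENNReal.tendsto_nhds_zero]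
  intro ε hε
  obtain ⟨N, hN⟩ := hcauchy ε hε
  filter_upwards [eventually_ge_atTop N] with n hn
  calc ∫⁻ x, ‖F n x - f x‖ₑ ^ 2 ∂μ
      = ∫⁻ x, liminf (fun m => ‖F n x - F m x‖ₑ ^ 2) atTop ∂μ := by
        refine lintegral_congr_ae ?_
        filter_upwards [hlim] with x hx
        refine (Tendsto.liminf_eq ?_).symm
        exact ((ENNReal.continuous_pow 2).comp continuous_enorm).tendsto _ |>.comp
          (tendsto_const_nhds.sub hx)
    _ ≤ liminf (fun m => ∫⁻ x, ‖F n x - F m x‖ₑ ^ 2 ∂μ) atTop :=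
        lintegral_liminf_le' fun m => ((hF n).sub (hF m)).enorm.pow_const 2
    _ ≤ ε := by
        refine liminf_le_of_frequently_le' (Eventually.frequently ?_)
        filter_upwards [eventually_ge_atTop N] with m hm
        exact hN n hn m hm

theorem memLp_of_tendsto_lintegral_sub {F : ℕ → X → ℝ} {f : X → ℝ}
    (hF : ∀ n, MemLp (F n) 2 μ) (hf : AEStronglyMeasurable f μ)
    (hlim : Tendsto (fun n => ∫⁻ x, ‖F n x - f x‖ₑ ^ 2 ∂μ) atTop (𝓝 0)) : MemLp f 2 μ := by
  obtain ⟨n, hn⟩ := (hlim.eventually (gt_mem_nhds one_pos)).exists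
  have h1 : MemLp (fun x => F n x - f x) 2 μ :=
    memLp_two_of_lintegral_lt_top ((hF n).1.sub hf) (hn.trans ENNReal.one_lt_top)
  have h2 := (hF n).sub h1
  rwa [show F n - (fun x => F n x - f x) = f from by ext x; simp] at h2

/-- A uniformly bounded sequence times a sequence tending to `0` in `L¹`. The first one need not
converge: no traces of the weight are needed on the boundary. -/
theorem tendsto_integral_bdd_mul_zero {b D : ℕ → X → ℝ} {c : ℝ}
    (hb : ∀ n, AEStronglyMeasurable (b n) μ) (hbc : ∀ n x, |b n x| ≤ c)
    (hD : ∀ n, Integrable (D n) μ) (hlim : Tendsto (fun n => ∫⁻ x, ‖D n x‖ₑ ∂μ) atTop (𝓝 0)) :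
    Tendsto (fun n => ∫ x, b n x * D n x ∂μ) atTop (𝓝 0) := by
  have h3 := tendsto_integral_of_L1 (μ := μ) (fun _ : X => (0 : ℝ)) aestronglyMeasurable_const
    (F := fun n x => b n x * D n x) (l := atTop)
    (Eventually.of_forall fun n => (hD n).bdd_mul (hb n) (ae_of_all _ (hbc n))) ?_
  · simpa using h3
  have h4 := ENNReal.Tendsto.const_mul (a := ENNReal.ofReal c) hlim (Or.inr ENNReal.ofReal_ne_top)
  rw [mul_zero] at h4
  refine tendsto_of_tendsto_of_tendsto_of_le_of_le tendsto_const_nhds h4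
    (fun n => zero_le) fun n => ?_
  simp only [sub_zero]
  rw [← lintegral_const_mul' _ _ ENNReal.ofReal_ne_top]
  refine lintegral_mono fun x => ?_
  rw [enorm_mul]
  gcongr
  rw [← ofReal_norm]
  exact ENNReal.ofReal_le_ofReal (hbc n x)

/-- The integral of a product of four factors: a bounded weight, a bounded sequence and two
sequences converging in `L²`. -/
theorem tendsto_integral_mul_mul_mul {θ b f h : X → ℝ} {B F H : ℕ → X → ℝ} {cθ cb : ℝ}
    (hθ : AEStronglyMeasurable θ μ) (hθb : ∀ x, |θ x| ≤ cθ)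
    (hb : MemLp b 2 μ) (hf : MemLp f 2 μ) (hh : MemLp h 2 μ)
    (hB : ∀ n, MemLp (B n) 2 μ) (hF : ∀ n, MemLp (F n) 2 μ) (hH : ∀ n, MemLp (H n) 2 μ)
    (hBb : ∀ n x, |B n x| ≤ cb)
    (hBt : Tendsto (fun n => ∫⁻ x, ‖B n x - b x‖ₑ ^ 2 ∂μ) atTop (𝓝 0))
    (hFt : Tendsto (fun n => ∫⁻ x, ‖F n x - f x‖ₑ ^ 2 ∂μ) atTop (𝓝 0))
    (hHt : Tendsto (fun n => ∫⁻ x, ‖H n x - h x‖ₑ ^ 2 ∂μ) atTop (𝓝 0)) :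
    Tendsto (fun n => ∫ x, θ x * B n x * F n x * H n x ∂μ) atTop
      (𝓝 (∫ x, θ x * b x * f x * h x ∂μ)) := by
  have hprod := tendsto_lintegral_mul_sub hf hh (fun n => (hF n).1) (fun n => (hH n).1) hFt hHt
  refine tendsto_of_subseq_tendsto fun ns hns => ?_
  -- along a further subsequence the bounded factor converges almost everywhere
  have hBm : TendstoInMeasure μ (fun n => B (ns n)) atTop b := by
    refine tendstoInMeasure_of_tendsto_eLpNorm (p := 2) (by norm_num) (fun n => (hB _).1) hb.1 ?_
    have h2 := (ENNReal.continuous_rpow_const (y := (1 / 2 : ℝ))).tendsto 0 |>.comp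
      (hBt.comp hns)
    simp only [Function.comp_def, lintegral_enorm_sq_eq] at h2
    rw [ENNReal.zero_rpow_of_pos (by norm_num)] at h2
    refine h2.congr fun n => ?_
    rw [← ENNReal.rpow_natCast, ← ENNReal.rpow_mul]
    norm_num
    rfl
  obtain ⟨ms, hms, hae⟩ := hBm.exists_seq_tendsto_ae
  refine ⟨ms, ?_⟩
  set N : ℕ → ℕ := fun n => ns (ms n) with hN
  have hNt : Tendsto N atTop atTop := hns.comp hms.tendsto_atTop
  have hfh : Integrable (fun x => f x * h x) μ := hf.integrable_mul hh
  have hbb : ∀ᵐ x ∂μ, |b x| ≤ cb := by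
    filter_upwards [hae] with x hx
    exact le_of_tendsto hx.abs (Eventually.of_forall fun n => hBb _ x)
  have h1 : Tendsto (fun n => ∫ x, θ x * B (N n) x * (f x * h x) ∂μ) atTop
      (𝓝 (∫ x, θ x * b x * (f x * h x) ∂μ)) := by
    refine tendsto_integral_of_dominated_convergence (fun x => cθ * cb * |f x * h x|) ?_ ?_ ?_ ?_
    · exact fun n => (hθ.mul (hB _).1).mul hfh.1
    · exact hfh.abs.const_mul _
    · refine fun n => ae_of_all _ fun x => ?_
      rw [norm_mul, norm_mul, Real.norm_eq_abs, Real.norm_eq_abs, Real.norm_eq_abs]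
      have := (abs_nonneg (θ x)).trans (hθb x)
      gcongr
      · exact hθb x
      · exact hBb _ x
    · filter_upwards [hae] with x hx
      exact (hx.const_mul (θ x)).mul_const _
  have hFH : ∀ n, Integrable (fun x => F (N n) x * H (N n) x - f x * h x) μ :=
    fun n => ((hF _).integrable_mul (hH _)).sub hfh
  have hθB : ∀ n x, ‖θ x * B (N n) x‖ ≤ cθ * cb := fun n x => by
    rw [norm_mul]
    exact mul_le_mul (hθb x) (hBb _ x) (norm_nonneg _) ((abs_nonneg _).trans (hθb x))
  have i1 : ∀ n, Integrable (fun x => θ x * B (N n) x * (f x * h x)) μ := fun n =>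
    hfh.bdd_mul (hθ.mul (hB _).1) (ae_of_all _ (hθB n))
  have i2 : ∀ n, Integrable
      (fun x => θ x * B (N n) x * (F (N n) x * H (N n) x - f x * h x)) μ := fun n =>
    (hFH n).bdd_mul (hθ.mul (hB _).1) (ae_of_all _ (hθB n))
  have h2 : Tendsto (fun n => ∫ x, θ x * B (N n) x * (F (N n) x * H (N n) x - f x * h x) ∂μ)
      atTop (𝓝 0) := tendsto_integral_bdd_mul_zero (fun n => hθ.mul (hB _).1)
      (fun n x => hθB n x) hFH (hprod.comp hNt)
  have h3 := h1.add h2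
  rw [add_zero] at h3
  have e1 : ∫ x, θ x * b x * f x * h x ∂μ = ∫ x, θ x * b x * (f x * h x) ∂μ := by
    simp only [mul_assoc]
  rw [e1]
  refine h3.congr fun n => ?_
  rw [← integral_add (i1 n) (i2 n)]
  refine integral_congr_ae (ae_of_all _ fun x => ?_)
  simp only
  ring

end

/-! ### Inward mollification and traces -/

/-- Kernels that shrink to the origin and look from `{0 ≤ Γ}` into `{0 < Γ}` only. The last bound
says that the kernels are not too concentrated; it makes them detect traces. -/
structure IsInwardKernelSeq {d : ℕ} (Γ : Eu d → ℝ) (k : ℕ → Eu d → ℝ) (s : ℕ → ℝ) (A : ℝ) :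
    Prop where
  isMollifier : ∀ n, IsMollifier (k n) (s n)
  pos : ∀ n, 0 < s n
  tendsto : Tendsto s atTop (𝓝 0)
  inward : ∀ n, ∀ y ∈ tsupport (k n), ∀ x, 0 ≤ Γ x → 0 < Γ (x + y)
  mul_le : ∀ n y, k n y * volume.real (Metric.closedBall (0 : Eu d) (2 * s n)) ≤ A

section
variable {d : ℕ} {Ω : Set (Eu d)} {e : Eu d} {Γ : Eu d → ℝ} {K : ℝ≥0}

/-- Smooth bumps of radius `δ` centred at `δ (K + 1) e` look inward, since on their support the
height gains at least `δ (K + 1) - K δ`. -/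
theorem IsHeight.exists_isInwardKernelSeq (h : IsHeight e Γ K) :
    ∃ k s A, IsInwardKernelSeq Γ k s A := by
  set δ : ℕ → ℝ := fun n => 1 / ((n : ℝ) + 1) with hδ
  have hδ0 : ∀ n, 0 < δ n := fun n => by simp only [hδ]; positivity
  let c : ℕ → Eu d := fun n => (δ n * (K + 1)) • e
  let φ : ∀ n, ContDiffBump (c n) := fun n =>
    ⟨δ n / 2, δ n, half_pos (hδ0 n), half_lt_self (hδ0 n)⟩
  have hK := K.2
  have hc : ∀ n, ‖c n‖ = δ n * (K + 1) := fun n => by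
    simp only [c]
    rw [norm_smul, h.norm_dir, mul_one, Real.norm_eq_abs, abs_of_nonneg]
    exact mul_nonneg (hδ0 n).le (add_nonneg hK zero_le_one)
  have hs : ∀ n, ‖c n‖ + (φ n).rOut = δ n * (K + 2) := fun n => by
    rw [hc]; simp only [φ]; ring
  refine ⟨fun n => (φ n).normed volume, fun n => δ n * (K + 2),
    (4 * (K + 2)) ^ d, fun n => hs n ▸ isMollifier_normed (φ n),
    fun n => mul_pos (hδ0 n) (by positivity), ?_, ?_, ?_⟩
  · simpa [δ] using (tendsto_one_div_add_atTop_nhds_zero_nat (𝕜 := ℝ)).mul_const ((K : ℝ) + 2)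
  · intro n y hy x hx
    rw [(φ n).tsupport_normed_eq, Metric.mem_closedBall, dist_eq_norm] at hy
    have e1 : x + y = (x + (y - c n)) + (δ n * (K + 1)) • e := by
      simp only [c]; abel
    rw [e1, h.shift]
    have h1 := h.lip.dist_le_mul (x + (y - c n)) x
    rw [Real.dist_eq, dist_eq_norm, add_sub_cancel_left] at h1
    have h2 : (K : ℝ) * ‖y - c n‖ ≤ K * δ n := mul_le_mul_of_nonneg_left hy hK
    have h3 := (abs_le.1 (h1.trans h2)).1
    nlinarith [hδ0 n]
  · intro n y
    have hv : 0 < volume.real (Metric.ball (0 : Eu d) 1) :=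
      ENNReal.toReal_pos (Metric.measure_ball_pos _ _ one_pos).ne' measure_ball_lt_top.ne
    have h1 := (φ n).normed_le_div_measure_closedBall_rIn volume y
    rw [Measure.addHaar_real_closedBall _ _ (φ n).rIn_pos.le, finrank_euclideanSpace_fin] at h1
    have hδn := hδ0 n
    rw [Measure.addHaar_real_closedBall _ _ (by positivity), finrank_euclideanSpace_fin]
    refine (mul_le_mul_of_nonneg_right h1 (by positivity)).trans (le_of_eq ?_)
    change 1 / ((δ n / 2) ^ d * _) * _ = _
    have e2 : 2 * (δ n * ((K : ℝ) + 2)) = (δ n / 2) * (4 * (K + 2)) := by ring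
    rw [e2, mul_pow]
    field_simp

/-- Inward mollifications converge to the trace wherever the trace exists. -/
theorem IsInwardKernelSeq.tendsto_mollify_of_isTraceAt {k : ℕ → Eu d → ℝ} {s : ℕ → ℝ} {A : ℝ}
    (hk : IsInwardKernelSeq Γ k s A) (hΩ : MeasurableSet Ω) {f : Eu d → ℝ}
    (hf : MemLp f 2 (volume.restrict Ω)) {z : Eu d} {c : ℝ}
    (hz : ∀ᶠ n in atTop, ∀ y ∈ tsupport (k n), z + y ∈ Ω) (htr : IsTraceAt Ω f z c) :
    Tendsto (fun n => mollify (k n) (Ω.indicator f) z) atTop (𝓝 c) := by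
  have h2s : Tendsto (fun n => 2 * s n) atTop (𝓝[>] 0) := by
    refine tendsto_nhdsWithin_iff.2 ⟨by simpa using hk.tendsto.const_mul 2, ?_⟩
    exact Eventually.of_forall fun n => mul_pos two_pos (hk.pos n)
  have hA := ((htr.comp h2s).const_mul A)
  rw [mul_zero] at hA
  rw [tendsto_iff_norm_sub_tendsto_zero]
  refine squeeze_zero' (Eventually.of_forall fun n => norm_nonneg _) ?_ hA
  filter_upwards [hz] with n hn
  have hf0 : MemLp (Ω.indicator f) 2 volume := memLp_indicator hΩ hf
  set S : Set (Eu d) := Ω ∩ Metric.ball z (2 * s n) with hS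
  have hSm : MeasurableSet S := hΩ.inter measurableSet_ball
  have hSfin : volume S ≠ ⊤ := ((measure_mono inter_subset_right).trans_lt
    measure_ball_lt_top).ne
  have hsn := hk.pos n
  set V : ℝ := volume.real (Metric.closedBall (0 : Eu d) (2 * s n)) with hV
  have hVpos : 0 < V := ENNReal.toReal_pos
    (Metric.measure_closedBall_pos _ _ (by positivity)).ne' measure_closedBall_lt_top.ne
  have hSV : volume.real S ≤ V := by
    have e1 : V = volume.real (Metric.closedBall z (2 * s n)) := by
      rw [hV, Measure.addHaar_real_closedBall _ _ (by positivity),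
        Measure.addHaar_real_closedBall _ _ (by positivity)]
    rw [e1]
    exact measureReal_mono (inter_subset_right.trans Metric.ball_subset_closedBall)
      measure_closedBall_lt_top.ne
  have hint : IntegrableOn (fun w => |f w - c|) S := by
    have : IsFiniteMeasure (volume.restrict S) := ⟨by simpa using hSfin.lt_top⟩
    have h1 : MemLp f 2 (volume.restrict S) :=
      hf.mono_measure (Measure.restrict_mono inter_subset_left le_rfl)
    exact ((h1.integrable (by norm_num)).sub (integrable_const c)).abs
  have hav0 : 0 ≤ ⨍ w in S, |f w - c| := by
    rw [setAverage_eq]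
    exact smul_nonneg (by positivity) (integral_nonneg fun w => abs_nonneg _)
  have hA0 : 0 ≤ A := (mul_nonneg ((hk.isMollifier n).nonneg 0) hVpos.le).trans (hk.mul_le n 0)
  have hi2 : Integrable (S.indicator fun w => |f w - c|) :=
    (integrable_indicator_iff hSm).2 hint
  calc ‖mollify (k n) (Ω.indicator f) z - c‖
      ≤ ∫ y, A / V * S.indicator (fun w => |f w - c|) (z + y) := by
        rw [mollify_sub_const (hk.isMollifier n) hf0]
        refine norm_integral_le_of_norm_le ((hi2.comp_add_left z).const_mul _)
          (ae_of_all _ fun y => ?_)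
        by_cases hy : y ∈ tsupport (k n)
        · have hyΩ := hn y hy
          have hyS : z + y ∈ S := by
            refine ⟨hyΩ, ?_⟩
            have := (hk.isMollifier n).tsupport_subset hy
            rw [mem_closedBall_zero_iff] at this
            rw [Metric.mem_ball, dist_eq_norm, add_sub_cancel_left]
            linarith
          rw [indicator_of_mem hyS, indicator_of_mem hyΩ, norm_mul, Real.norm_eq_abs,
            Real.norm_eq_abs, abs_of_nonneg ((hk.isMollifier n).nonneg y)]
          refine mul_le_mul_of_nonneg_right ?_ (abs_nonneg _)
          rw [le_div_iff₀ hVpos]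
          exact hk.mul_le n y
        · rw [image_eq_zero_of_notMem_tsupport hy, zero_mul, norm_zero]
          refine mul_nonneg (by positivity) (indicator_nonneg (fun w _ => abs_nonneg _) _)
    _ = A / V * ∫ w in S, |f w - c| := by
        rw [integral_const_mul,
          integral_add_left_eq_self (fun w => S.indicator (fun w => |f w - c|) w) z,
          integral_indicator hSm]
    _ = A / V * (volume.real S * ⨍ w in S, |f w - c|) := by
        rw [← measure_smul_setAverage _ hSfin, smul_eq_mul]
    _ ≤ A / V * (V * ⨍ w in S, |f w - c|) := by gcongr
    _ = A * ⨍ w in S, |f w - c| := by field_simp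
    _ = _ := rfl

/-! ### Limits of mollified products -/

/-- The bounded factor `b` converges in `L²` only, so it has to be kept bounded along the
mollification. -/
theorem tendsto_setIntegral_mollify {k : ℕ → Eu d → ℝ} {s : ℕ → ℝ}
    (hk : ∀ n, IsMollifier (k n) (s n)) (hs : Tendsto s atTop (𝓝 0)) (hΩ : MeasurableSet Ω)
    {θ b f h : Eu d → ℝ} {cθ cb : ℝ} (hθ : Continuous θ) (hθb : ∀ x, |θ x| ≤ cθ)
    (hb : MemLp b 2 (volume.restrict Ω)) (hbb : ∀ᵐ x, |Ω.indicator b x| ≤ cb)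
    (hf : MemLp f 2 (volume.restrict Ω)) (hh : MemLp h 2 (volume.restrict Ω)) :
    Tendsto (fun n => ∫ x in Ω, θ x * mollify (k n) (Ω.indicator b) x
        * mollify (k n) (Ω.indicator f) x * mollify (k n) (Ω.indicator h) x) atTop
      (𝓝 (∫ x in Ω, θ x * b x * f x * h x)) := by
  have hL : ∀ {g : Eu d → ℝ}, MemLp g 2 (volume.restrict Ω) →
      Tendsto (fun n => ∫⁻ x in Ω, ‖mollify (k n) (Ω.indicator g) x - g x‖ₑ ^ 2) atTop
        (𝓝 0) := by
    intro g hg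
    refine tendsto_of_tendsto_of_tendsto_of_le_of_le tendsto_const_nhds
      (tendsto_lintegral_mollify_sub_sq hk hs (memLp_indicator hΩ hg))
      (fun n => zero_le) fun n => ?_
    rw [← lintegral_indicator hΩ]
    refine lintegral_mono fun x => ?_
    by_cases hx : x ∈ Ω
    · rw [indicator_of_mem hx]
      simp only [indicator_of_mem hx]
      exact le_rfl
    · rw [indicator_of_notMem hx]; exact zero_le
  have hM : ∀ {g : Eu d → ℝ}, MemLp g 2 (volume.restrict Ω) → ∀ n,
      MemLp (mollify (k n) (Ω.indicator g)) 2 (volume.restrict Ω) := fun hg n =>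
    (memLp_mollify (hk n) (memLp_indicator hΩ hg)).restrict Ω
  exact tendsto_integral_mul_mul_mul hθ.aestronglyMeasurable hθb hb hf hh (hM hb) (hM hf) (hM hh)
    (fun n x => abs_mollify_le (hk n) hbb x) (hL hb) (hL hf) (hL hh)

end

/-! ### Green's formula in a chart -/

/-- `f ∈ L²(Ω)` with weak gradient `g ∈ L²(Ω; ℝᵈ)`, for functions instead of classes. -/
structure IsSobolevPair {d : ℕ} (Ω : Set (Eu d)) (f : Eu d → ℝ) (g : Eu d → Eu d) : Prop where
  memLp : MemLp f 2 (volume.restrict Ω)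
  memLp_grad : MemLp g 2 (volume.restrict Ω)
  weak : IsWeakGradient Ω f g

section
variable {d : ℕ} {Ω : Set (Eu d)} {z e : Eu d} {Γ : Eu d → ℝ} {K : ℝ≥0} {ε : ℝ}
  {k : ℕ → Eu d → ℝ} {s : ℕ → ℝ} {A : ℝ}

/-- Near the centre of a chart, kernels with small support see only points of `Ω`, also from points
of the graph. -/
theorem IsChart.add_mem (hc : IsChart Ω z e Γ K ε) (hk : IsInwardKernelSeq Γ k s A) {n : ℕ}
    (hn : s n < ε / 2) {x : Eu d} (hx : x ∈ Metric.ball z (ε / 2)) (hΓ : 0 ≤ Γ x) {y : Eu d}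
    (hy : y ∈ tsupport (k n)) : x + y ∈ Ω := by
  refine (hc.mem_iff _ ?_).2 (hk.inward n y hy x hΓ)
  have h1 := (hk.isMollifier n).tsupport_subset hy
  rw [mem_closedBall_zero_iff] at h1
  rw [Metric.mem_ball, dist_eq_norm] at hx ⊢
  have : x + y - z = (x - z) + y := by abel
  rw [this]
  linarith [norm_add_le (x - z) y]

/-- Inward mollification commutes with weak derivatives up to the boundary. -/
theorem IsSobolevPair.fderiv_mollify {f : Eu d → ℝ} {g : Eu d → Eu d}
    (hf : IsSobolevPair Ω f g) (hΩ : MeasurableSet Ω) (hc : IsChart Ω z e Γ K ε)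
    (hk : IsInwardKernelSeq Γ k s A) {n : ℕ} (hn : s n < ε / 2) {x : Eu d}
    (hx : x ∈ Metric.ball z (ε / 2)) (hΓ : 0 ≤ Γ x) (a : Eu d) :
    fderiv ℝ (mollify (k n) (Ω.indicator f)) x a
      = mollify (k n) (Ω.indicator fun w => inner ℝ (g w) a) x :=
  fderiv_mollify_of_isWeakGradient hΩ (hk.isMollifier n)
    ((memLp_indicator hΩ hf.memLp).locallyIntegrable (by norm_num)) hf.weak
    (fun _ hy => hc.add_mem hk hn hx hΓ hy) a

theorem IsSobolevPair.contDiff_mollify {f : Eu d → ℝ} {g : Eu d → Eu d}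
    (hf : IsSobolevPair Ω f g) (hΩ : MeasurableSet Ω) {κ : Eu d → ℝ} {r : ℝ}
    (hk : IsMollifier κ r) : ContDiff ℝ ∞ (mollify κ (Ω.indicator f)) :=
  PDELearning.contDiff_mollify hk ((memLp_indicator hΩ hf.memLp).locallyIntegrable (by norm_num))

theorem fderiv_mul_mul_mul {p q r t : Eu d → ℝ} {x : Eu d} (hp : DifferentiableAt ℝ p x)
    (hq : DifferentiableAt ℝ q x) (hr : DifferentiableAt ℝ r x) (ht : DifferentiableAt ℝ t x)
    (a : Eu d) : fderiv ℝ (fun x => p x * q x * r x * t x) x a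
      = fderiv ℝ p x a * q x * r x * t x + p x * fderiv ℝ q x a * r x * t x
        + p x * q x * fderiv ℝ r x a * t x + p x * q x * r x * fderiv ℝ t x a := by
  have h := ((hp.hasFDerivAt.mul hq.hasFDerivAt).mul hr.hasFDerivAt).mul ht.hasFDerivAt
  have h2 : fderiv ℝ (fun x => p x * q x * r x * t x) x = _ := h.fderiv
  rw [h2]
  simp
  ring

theorem exists_ae_abs_indicator_le {b : Eu d → ℝ} (hΩ : MeasurableSet Ω)
    (hb : MemLp b ⊤ (volume.restrict Ω)) : ∃ c, ∀ᵐ x, |Ω.indicator b x| ≤ c := by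
  have h := (memLp_indicator_iff_restrict hΩ).2 hb
  refine ⟨(eLpNorm (Ω.indicator b) ⊤ volume).toReal, ?_⟩
  filter_upwards [ae_le_eLpNormEssSup (f := Ω.indicator b) (μ := volume)] with x hx
  rw [eLpNorm_exponent_top, ← Real.norm_eq_abs, ← toReal_enorm]
  refine ENNReal.toReal_mono ?_ hx
  rw [← eLpNorm_exponent_top]
  exact h.2.ne

/-- The derivative of the product `φ β v U` in the direction `a`, as given by the product rule with
the weak gradients `Dβ`, `Dv`, `DU` in place of the classical ones; `φ` is a smooth cut-off. -/
noncomputable def greenIntegrand (φ β : Eu d → ℝ) (Dβ : Eu d → Eu d) (v : Eu d → ℝ)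
    (Dv : Eu d → Eu d) (U : Eu d → ℝ) (DU : Eu d → Eu d) (a x : Eu d) : ℝ :=
  fderiv ℝ φ x a * β x * v x * U x + φ x * inner ℝ (Dβ x) a * v x * U x
    + φ x * β x * inner ℝ (Dv x) a * U x + φ x * β x * v x * inner ℝ (DU x) a

theorem integrable_bdd_mul_four {θ b f h : Eu d → ℝ} {cθ : ℝ} (hθ : Continuous θ)
    (hθb : ∀ x, |θ x| ≤ cθ) (hb : MemLp b ⊤ (volume.restrict Ω))
    (hf : MemLp f 2 (volume.restrict Ω)) (hh : MemLp h 2 (volume.restrict Ω)) :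
    Integrable (fun x => θ x * b x * f x * h x) (volume.restrict Ω) := by
  have h1 : Integrable (fun x => b x * (f x * h x)) (volume.restrict Ω) :=
    (hf.integrable_mul hh).bdd_mul hb.1 (by
      have := ae_le_eLpNormEssSup (f := b) (μ := volume.restrict Ω)
      filter_upwards [this] with x hx
      rw [← toReal_enorm]
      refine ENNReal.toReal_mono ?_ hx
      rw [← eLpNorm_exponent_top]
      exact hb.2.ne)
  have h2 := h1.bdd_mul hθ.aestronglyMeasurable (ae_of_all _ hθb)
  refine h2.congr (ae_of_all _ fun x => ?_)
  simp only
  ring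

theorem exists_abs_le_of_compact {φ : Eu d → ℝ} (hφ : ContDiff ℝ ∞ φ)
    (hφc : HasCompactSupport φ) (a : Eu d) :
    ∃ c, (∀ x, |φ x| ≤ c) ∧ ∀ x, |fderiv ℝ φ x a| ≤ c := by
  obtain ⟨c₁, h₁⟩ := hφc.exists_bound_of_continuous hφ.continuous
  obtain ⟨c₂, h₂⟩ := (hφc.fderiv_apply ℝ a).exists_bound_of_continuous
    ((hφ.continuous_fderiv (by simp)).clm_apply continuous_const)
  exact ⟨max c₁ c₂, fun x => (h₁ x).trans (le_max_left _ _),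
    fun x => (h₂ x).trans (le_max_right _ _)⟩

theorem integrable_greenIntegrand {φ β v U : Eu d → ℝ} {Dβ Dv DU : Eu d → Eu d}
    (hφ : ContDiff ℝ ∞ φ) (hφc : HasCompactSupport φ) (hβ : MemW1inf Ω β Dβ)
    (hv : IsSobolevPair Ω v Dv) (hU : IsSobolevPair Ω U DU) (a : Eu d) :
    Integrable (greenIntegrand φ β Dβ v Dv U DU a) (volume.restrict Ω) := by
  obtain ⟨c, hc, hc'⟩ := exists_abs_le_of_compact hφ hφc a
  have hD : Continuous fun x => fderiv ℝ φ x a :=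
    (hφ.continuous_fderiv (by simp)).clm_apply continuous_const
  exact (((integrable_bdd_mul_four hD hc' hβ.memLp hv.memLp hU.memLp).add
    (integrable_bdd_mul_four hφ.continuous hc (hβ.memLp_grad.inner_const a) hv.memLp
      hU.memLp)).add
    (integrable_bdd_mul_four hφ.continuous hc hβ.memLp (hv.memLp_grad.inner_const a)
      hU.memLp)).add
    (integrable_bdd_mul_four hφ.continuous hc hβ.memLp hv.memLp (hU.memLp_grad.inner_const a))

/-- In a chart the interior integrals of the mollified products converge. -/
theorem IsChart.tendsto_integral_fderiv (hc : IsChart Ω z e Γ K ε) (hΩ : MeasurableSet Ω)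
    (hfin : volume Ω ≠ ⊤) (hk : IsInwardKernelSeq Γ k s A) {φ β v U : Eu d → ℝ}
    {Dβ Dv DU : Eu d → Eu d} (hφ : ContDiff ℝ ∞ φ) (hφs : tsupport φ ⊆ Metric.ball z (ε / 2))
    (hβ : MemW1inf Ω β Dβ) (hv : IsSobolevPair Ω v Dv) (hU : IsSobolevPair Ω U DU) (a : Eu d) :
    Tendsto (fun n => ∫ x in {x | 0 < Γ x}, fderiv ℝ (fun x => φ x
        * mollify (k n) (Ω.indicator β) x * mollify (k n) (Ω.indicator v) x
        * mollify (k n) (Ω.indicator U) x) x a) atTop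
      (𝓝 (∫ x in Ω, greenIntegrand φ β Dβ v Dv U DU a x)) := by
  have : IsFiniteMeasure (volume.restrict Ω) := ⟨by simpa using hfin.lt_top⟩
  have hφc : HasCompactSupport φ := (isCompact_closedBall z (ε / 2)).of_isClosed_subset
    (isClosed_tsupport φ) (hφs.trans Metric.ball_subset_closedBall)
  obtain ⟨c, hcb, hcb'⟩ := exists_abs_le_of_compact hφ hφc a
  have hD : Continuous fun x => fderiv ℝ φ x a :=
    (hφ.continuous_fderiv (by simp)).clm_apply continuous_const
  have hβ2 : IsSobolevPair Ω β Dβ :=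
    ⟨hβ.memLp.mono_exponent le_top, hβ.memLp_grad.mono_exponent le_top, hβ.weak⟩
  obtain ⟨b₁, hb₁⟩ := exists_ae_abs_indicator_le hΩ hβ.memLp
  obtain ⟨b₂, hb₂⟩ := exists_ae_abs_indicator_le hΩ (hβ.memLp_grad.inner_const a)
  have hm := hk.isMollifier
  have hs := hk.tendsto
  have i1 := integrable_bdd_mul_four hD hcb' hβ.memLp hv.memLp hU.memLp
  have i2 := integrable_bdd_mul_four hφ.continuous hcb (hβ.memLp_grad.inner_const a) hv.memLp
    hU.memLp
  have i3 := integrable_bdd_mul_four hφ.continuous hcb hβ.memLp (hv.memLp_grad.inner_const a)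
    hU.memLp
  have i4 := integrable_bdd_mul_four hφ.continuous hcb hβ.memLp hv.memLp
    (hU.memLp_grad.inner_const a)
  have t1 := tendsto_setIntegral_mollify hm hs hΩ hD hcb' hβ2.memLp hb₁ hv.memLp hU.memLp
  have t2 := tendsto_setIntegral_mollify hm hs hΩ hφ.continuous hcb
    (hβ2.memLp_grad.inner_const a) hb₂ hv.memLp hU.memLp
  have t3 := tendsto_setIntegral_mollify hm hs hΩ hφ.continuous hcb hβ2.memLp hb₁
    (hv.memLp_grad.inner_const a) hU.memLp
  have t4 := tendsto_setIntegral_mollify hm hs hΩ hφ.continuous hcb hβ2.memLp hb₁ hv.memLp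
    (hU.memLp_grad.inner_const a)
  have hlim : ∫ x in Ω, greenIntegrand φ β Dβ v Dv U DU a x = _ :=
    (integral_add ((i1.add i2).add i3) i4).trans (congrArg (· + _)
      ((integral_add (i1.add i2) i3).trans (congrArg (· + _) (integral_add i1 i2))))
  rw [hlim]
  refine (((t1.add t2).add t3).add t4).congr' ?_
  filter_upwards [hs.eventually (gt_mem_nhds (half_pos hc.pos))] with n hn
  have mL : ∀ {f : Eu d → ℝ}, MemLp f 2 (volume.restrict Ω) →
      MemLp (mollify (k n) (Ω.indicator f)) 2 (volume.restrict Ω) := fun hf =>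
    (memLp_mollify (hm n) (memLp_indicator hΩ hf)).restrict Ω
  have mT : ∀ {f : Eu d → ℝ} {c : ℝ}, MemLp f 2 (volume.restrict Ω) →
      (∀ᵐ x, |Ω.indicator f x| ≤ c) →
      MemLp (mollify (k n) (Ω.indicator f)) ⊤ (volume.restrict Ω) := fun hf hb =>
    memLp_top_of_bound (mL hf).1 _ (ae_of_all _ fun x => abs_mollify_le (hm n) hb x)
  have j1 := integrable_bdd_mul_four hD hcb' (mT hβ2.memLp hb₁) (mL hv.memLp) (mL hU.memLp)
  have j2 := integrable_bdd_mul_four hφ.continuous hcb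
    (mT (hβ2.memLp_grad.inner_const a) hb₂) (mL hv.memLp) (mL hU.memLp)
  have j3 := integrable_bdd_mul_four hφ.continuous hcb (mT hβ2.memLp hb₁)
    (mL (hv.memLp_grad.inner_const a)) (mL hU.memLp)
  have j4 := integrable_bdd_mul_four hφ.continuous hcb (mT hβ2.memLp hb₁) (mL hv.memLp)
    (mL (hU.memLp_grad.inner_const a))
  have hsum := (integral_add ((j1.add j2).add j3) j4).trans (congrArg (· + _)
      ((integral_add (j1.add j2) j3).trans (congrArg (· + _) (integral_add j1 j2))))
  refine hsum.symm.trans ?_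
  have hΓm : MeasurableSet {x | 0 < Γ x} :=
    measurableSet_lt measurable_const hc.isHeight.continuous.measurable
  rw [← integral_indicator hΩ, ← integral_indicator hΓm]
  refine integral_congr_ae (ae_of_all _ fun x => ?_)
  have hdiff : ∀ {f : Eu d → ℝ} {g : Eu d → Eu d}, IsSobolevPair Ω f g →
      DifferentiableAt ℝ (mollify (k n) (Ω.indicator f)) x := fun hf =>
    (hf.contDiff_mollify hΩ (hm n)).differentiable (by simp) x
  have hprod := fderiv_mul_mul_mul (hφ.differentiable (by simp) x) (hdiff hβ2) (hdiff hv)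
    (hdiff hU) a
  by_cases hx : x ∈ tsupport φ
  · have hxb := hφs hx
    have hiff := hc.mem_iff x (Metric.ball_subset_ball (by linarith [hc.pos]) hxb)
    by_cases hxΩ : x ∈ Ω
    · have hΓx : x ∈ {x | 0 < Γ x} := hiff.1 hxΩ
      have hΓ0 : 0 ≤ Γ x := (hiff.1 hxΩ).le
      rw [indicator_of_mem hxΩ, indicator_of_mem hΓx, hprod,
        hβ2.fderiv_mollify hΩ hc hk hn hxb hΓ0, hv.fderiv_mollify hΩ hc hk hn hxb hΓ0,
        hU.fderiv_mollify hΩ hc hk hn hxb hΓ0]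
      rfl
    · have hΓx : x ∉ {x | 0 < Γ x} := fun h => hxΩ (hiff.2 h)
      rw [indicator_of_notMem hxΩ, indicator_of_notMem hΓx]
  · have h0 : φ x = 0 := image_eq_zero_of_notMem_tsupport hx
    have h1 : fderiv ℝ φ x a = 0 := by
      rw [image_eq_zero_of_notMem_tsupport (fun h => hx (tsupport_fderiv_subset ℝ h))]
      rfl
    rw [h0, h1] at hprod
    have hz : fderiv ℝ (fun x => φ x * mollify (k n) (Ω.indicator β) x
        * mollify (k n) (Ω.indicator v) x * mollify (k n) (Ω.indicator U) x) x a = 0 := by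
      rw [hprod]; ring
    trans 0
    · by_cases hxΩ : x ∈ Ω
      · rw [indicator_of_mem hxΩ]
        simp [h0, h1]
      · rw [indicator_of_notMem hxΩ]
    · by_cases hΓx : x ∈ {x | 0 < Γ x}
      · rw [indicator_of_mem hΓx, hz]
      · rw [indicator_of_notMem hΓx]

end

/-! ### Boundary values of mollified products -/

section
variable {d : ℕ} {Ω : Set (Eu d)} {z e : Eu d} {Γ : Eu d → ℝ} {K : ℝ≥0} {ε : ℝ}
  {k : ℕ → Eu d → ℝ} {s : ℕ → ℝ} {A : ℝ}

theorem lintegral_sub_sq_le {X : Type*} [MeasurableSpace X] {μ : Measure X} {F G q : X → ℝ}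
    (hF : AEStronglyMeasurable F μ) (hq : AEStronglyMeasurable q μ) :
    ∫⁻ x, ‖F x - G x‖ₑ ^ 2 ∂μ
      ≤ 2 * ((∫⁻ x, ‖F x - q x‖ₑ ^ 2 ∂μ) + ∫⁻ x, ‖G x - q x‖ₑ ^ 2 ∂μ) := by
  have hm : AEMeasurable (fun x => ‖F x - q x‖ₑ ^ 2) μ := (hF.sub hq).enorm.pow_const 2
  rw [← lintegral_add_left' hm, ← lintegral_const_mul' _ _ (by norm_num)]
  refine lintegral_mono fun x => ?_
  have h := enorm_add_sq_le (F x - q x) (-(G x - q x))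
  rwa [enorm_neg, show F x - q x + -(G x - q x) = F x - G x by ring] at h

/-- The boundary values of the mollifications of a Sobolev function form a Cauchy sequence in
`L²`: the trace inequality is applied to the differences. -/
theorem IsChart.exists_lintegral_foot_sub_sq_le (hc : IsChart Ω z e Γ K ε)
    (hΩ : MeasurableSet Ω) (hk : IsInwardKernelSeq Γ k s A) {ψ f : Eu d → ℝ} {g : Eu d → Eu d}
    (hψ : ContDiff ℝ ∞ ψ) (hψs : tsupport ψ ⊆ Metric.ball z (ε / 2)) (hf : IsSobolevPair Ω f g)
    {η : ℝ≥0∞} (hη : 0 < η) :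
    ∃ N, ∀ n ≥ N, ∀ m ≥ N, ∫⁻ x in layer Γ 1,
      ‖ψ (foot e Γ x) * mollify (k n) (Ω.indicator f) (foot e Γ x)
        - ψ (foot e Γ x) * mollify (k m) (Ω.indicator f) (foot e Γ x)‖ₑ ^ 2 ≤ η := by
  have hψc : HasCompactSupport ψ := (isCompact_closedBall z (ε / 2)).of_isClosed_subset
    (isClosed_tsupport ψ) (hψs.trans Metric.ball_subset_closedBall)
  obtain ⟨c, hcb, hcb'⟩ := exists_abs_le_of_compact hψ hψc e
  set f₀ := Ω.indicator f with hf₀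
  set g₀ := Ω.indicator fun w => (inner ℝ (g w) e : ℝ) with hg₀
  have hf₀L : MemLp f₀ 2 volume := memLp_indicator hΩ hf.memLp
  have hg₀L : MemLp g₀ 2 volume := memLp_indicator hΩ (hf.memLp_grad.inner_const e)
  have hm := hk.isMollifier
  set E : ℕ → ℝ≥0∞ := fun n => (∫⁻ x, ‖mollify (k n) f₀ x - f₀ x‖ₑ ^ 2)
    + ∫⁻ x, ‖mollify (k n) g₀ x - g₀ x‖ₑ ^ 2 with hE
  have hEt : Tendsto E atTop (𝓝 0) := by
    simpa using (tendsto_lintegral_mollify_sub_sq hm hk.tendsto hf₀L).add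
      (tendsto_lintegral_mollify_sub_sq hm hk.tendsto hg₀L)
  set C : ℝ≥0∞ := ENNReal.ofReal c with hC
  have hEC : Tendsto (fun n => 12 * C ^ 2 * E n) atTop (𝓝 0) := by
    simpa using ENNReal.Tendsto.const_mul (a := 12 * C ^ 2) hEt (Or.inr (by finiteness))
  obtain ⟨N, hN⟩ := eventually_atTop.1 ((ENNReal.tendsto_nhds_zero.1 hEC) (η / 2)
    (ENNReal.half_pos hη.ne'))
  obtain ⟨N', hN'⟩ := eventually_atTop.1
    (hk.tendsto.eventually (gt_mem_nhds (half_pos hc.pos)))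
  refine ⟨max N N', fun n hn m hm' => ?_⟩
  have hnN := hN n ((le_max_left _ _).trans hn)
  have hmN := hN m ((le_max_left _ _).trans hm')
  have hns := hN' n ((le_max_right _ _).trans hn)
  have hms := hN' m ((le_max_right _ _).trans hm')
  set F : Eu d → ℝ := fun x => mollify (k n) f₀ x - mollify (k m) f₀ x with hF
  set G : Eu d → ℝ := fun x => mollify (k n) g₀ x - mollify (k m) g₀ x with hG
  set w : Eu d → ℝ := fun x => ψ x * F x with hw
  have hsm : ∀ j, ContDiff ℝ ∞ (mollify (k j) f₀) := fun j => hf.contDiff_mollify hΩ (hm j)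
  have hFs : ContDiff ℝ ∞ F := (hsm n).sub (hsm m)
  have hws : ContDiff ℝ 1 w := (hψ.mul hFs).of_le (by simp)
  have hce : ∀ {y : ℝ}, |y| ≤ c → ‖y‖ₑ ≤ C := fun hy => by
    rw [Real.enorm_eq_ofReal_abs]; exact ENNReal.ofReal_le_ofReal hy
  have hFm : AEMeasurable (fun x => ‖F x‖ₑ ^ 2) volume :=
    hFs.continuous.enorm.measurable.aemeasurable.pow_const 2
  have h1 : ∫⁻ x in layer Γ 1, ‖w x‖ₑ ^ 2 ≤ C ^ 2 * ∫⁻ x, ‖F x‖ₑ ^ 2 := by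
    rw [← lintegral_const_mul' _ _ (by finiteness)]
    refine (lintegral_mono fun x => ?_).trans (setLIntegral_le_lintegral _ _)
    rw [hw]
    simp only [enorm_mul, mul_pow]
    gcongr
    exact hce (hcb x)
  have h2 : ∫⁻ x in layer Γ 1, ‖fderiv ℝ w x e‖ₑ ^ 2
      ≤ 2 * C ^ 2 * ((∫⁻ x, ‖F x‖ₑ ^ 2) + ∫⁻ x, ‖G x‖ₑ ^ 2) := by
    rw [← lintegral_add_left' hFm, ← lintegral_const_mul' _ _ (by finiteness)]
    refine (setLIntegral_mono' (hc.isHeight.measurableSet_layer 1) fun x hx => ?_).trans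
      (setLIntegral_le_lintegral _ _)
    have hd : fderiv ℝ w x e = fderiv ℝ ψ x e * F x + ψ x * fderiv ℝ F x e := by
      have h := (hψ.differentiable (by simp) x).hasFDerivAt.mul
        (hFs.differentiable (by simp) x).hasFDerivAt
      have h2 : fderiv ℝ w x = _ := h.fderiv
      rw [h2]
      simp
      ring
    have hFG : ψ x * fderiv ℝ F x e = ψ x * G x := by
      by_cases hxs : x ∈ tsupport ψ
      · have h : fderiv ℝ F x = fderiv ℝ (mollify (k n) f₀) x - fderiv ℝ (mollify (k m) f₀) x :=
          fderiv_sub ((hsm n).differentiable (by simp) x) ((hsm m).differentiable (by simp) x)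
        rw [h, _root_.sub_apply, hf.fderiv_mollify hΩ hc hk hns (hψs hxs) hx.1,
          hf.fderiv_mollify hΩ hc hk hms (hψs hxs) hx.1]
      · rw [image_eq_zero_of_notMem_tsupport hxs, zero_mul, zero_mul]
    rw [hd, hFG]
    refine (enorm_add_sq_le _ _).trans ?_
    rw [mul_assoc]
    gcongr
    rw [mul_add]
    simp only [enorm_mul, mul_pow]
    gcongr
    · exact hce (hcb' x)
    · exact hce (hcb x)
  have hX := lintegral_sub_sq_le (G := mollify (k m) f₀) (memLp_mollify (hm n) hf₀L).1 hf₀L.1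
  have hY := lintegral_sub_sq_le (G := mollify (k m) g₀) (memLp_mollify (hm n) hg₀L).1 hg₀L.1
  calc ∫⁻ x in layer Γ 1, ‖ψ (foot e Γ x) * mollify (k n) f₀ (foot e Γ x)
        - ψ (foot e Γ x) * mollify (k m) f₀ (foot e Γ x)‖ₑ ^ 2
      = ∫⁻ x in layer Γ 1, ‖w (foot e Γ x)‖ₑ ^ 2 := by
        simp only [hw, hF, mul_sub]
    _ ≤ 2 * (C ^ 2 * (∫⁻ x, ‖F x‖ₑ ^ 2)
          + 2 * C ^ 2 * ((∫⁻ x, ‖F x‖ₑ ^ 2) + ∫⁻ x, ‖G x‖ₑ ^ 2)) := by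
        refine (hc.isHeight.lintegral_foot_sq_le hws one_pos).trans ?_
        rw [one_pow, ENNReal.ofReal_one, one_mul]
        gcongr
    _ ≤ 6 * C ^ 2 * ((∫⁻ x, ‖F x‖ₑ ^ 2) + ∫⁻ x, ‖G x‖ₑ ^ 2) := by
        have h3 : C ^ 2 * (∫⁻ x, ‖F x‖ₑ ^ 2)
            ≤ C ^ 2 * ((∫⁻ x, ‖F x‖ₑ ^ 2) + ∫⁻ x, ‖G x‖ₑ ^ 2) := by
          gcongr; exact le_self_add
        refine (mul_le_mul_right (add_le_add_left h3 _) 2).trans (le_of_eq ?_)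
        ring
    _ ≤ 6 * C ^ 2 * (2 * (E n + E m)) := by
        gcongr
        refine (add_le_add hX hY).trans (le_of_eq ?_)
        simp only [hE]
        ring
    _ = 12 * C ^ 2 * E n + 12 * C ^ 2 * E m := by ring
    _ ≤ η / 2 + η / 2 := add_le_add hnN hmN
    _ = η := ENNReal.add_halves η

end

section
variable {d : ℕ} {Ω : Set (Eu d)} {z e : Eu d} {Γ : Eu d → ℝ} {K : ℝ≥0} {ε : ℝ}
  {k : ℕ → Eu d → ℝ} {s : ℕ → ℝ} {A : ℝ}

/-- The graph `{Γ = 0}` of a chart consists of boundary points. -/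
theorem IsChart.mem_frontier (hc : IsChart Ω z e Γ K ε) {x : Eu d} (hx : x ∈ Metric.ball z ε)
    (hΓ : Γ x = 0) : x ∈ frontier Ω := by
  have hxΩ : x ∉ Ω := fun h => by
    have := (hc.mem_iff x hx).1 h
    rw [hΓ] at this
    exact lt_irrefl _ this
  refine ⟨?_, fun h => hxΩ (interior_subset h)⟩
  have ht : Tendsto (fun t : ℝ => x + t • e) (𝓝[>] 0) (𝓝 x) := by
    have h1 : Continuous fun t : ℝ => x + t • e := by fun_prop
    have h2 := h1.tendsto 0
    rw [zero_smul, add_zero] at h2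
    exact h2.mono_left nhdsWithin_le_nhds
  refine mem_closure_of_tendsto ht ?_
  filter_upwards [ht.eventually (Metric.isOpen_ball.mem_nhds hx), self_mem_nhdsWithin]
    with t h1 h2
  rw [hc.mem_iff _ h1, hc.shift, hΓ, zero_add]
  exact h2

theorem exists_ae_of_ae_exists {X Q : Type*} [Nonempty Q] [MeasurableSpace X] {μ : Measure X}
    {P : X → Q → Prop} (h : ∀ᵐ x ∂μ, ∃ q, P x q) : ∃ q : X → Q, ∀ᵐ x ∂μ, P x (q x) := by
  have h0 : ∀ x, ∃ q, (∃ q, P x q) → P x q := fun x => by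
    by_cases hx : ∃ q, P x q
    · exact ⟨hx.choose, fun _ => hx.choose_spec⟩
    · exact ⟨Classical.arbitrary Q, fun h' => absurd h' hx⟩
  choose q hq using h0
  exact ⟨q, h.mono fun x hx => hq x hx⟩

theorem sum_apply_single (L : Eu d →L[ℝ] ℝ) (p : Eu d) :
    ∑ i, p i * L (EuclideanSpace.single i 1) = L p := by
  conv_rhs => rw [← (EuclideanSpace.basisFun (Fin d) ℝ).sum_repr p]
  simp [map_sum]

/-- `((U · ν) v)|_{∂Ω} = 0`, for a vector field `U` given by its components. -/
def BoundaryFluxVanishes (Ω : Set (Eu d)) (U : Fin d → Eu d → ℝ) (v : Eu d → ℝ) : Prop :=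
  ∀ᵐ z ∂((Measure.hausdorffMeasure ((d : ℝ) - 1) : Measure (Eu d)).restrict (frontier Ω)),
    ∃ (n p : Eu d) (c : ℝ), IsOuterNormalAt Ω z n ∧
      (∀ i, IsTraceAt Ω (U i) z (p i)) ∧ IsTraceAt Ω v z c ∧ inner ℝ p n * c = 0

/-- Almost everywhere on the graph the mollifications converge to the traces, and there the
flux vanishes in the limit: the gradient of the height is normal to the boundary. -/
theorem IsChart.ae_tendsto_boundary (hd : 1 ≤ d) (hc : IsChart Ω z e Γ K ε)
    (hΩ : MeasurableSet Ω) (hk : IsInwardKernelSeq Γ k s A) {ψ φ v : Eu d → ℝ}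
    (hψs : tsupport ψ ⊆ Metric.ball z (ε / 2)) (hφs : tsupport φ ⊆ Metric.ball z (ε / 2))
    {U : Fin d → Eu d → ℝ} (hv : MemLp v 2 (volume.restrict Ω))
    (hU : ∀ i, MemLp (U i) 2 (volume.restrict Ω)) (hb : BoundaryFluxVanishes Ω U v) :
    ∀ᵐ x, ∃ q : ℝ × (Fin d → ℝ),
      Tendsto (fun n => ψ (foot e Γ x) * mollify (k n) (Ω.indicator v) (foot e Γ x)) atTop
        (𝓝 q.1) ∧
      (∀ i, Tendsto (fun n => φ (foot e Γ x) * mollify (k n) (Ω.indicator (U i)) (foot e Γ x))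
        atTop (𝓝 (q.2 i))) ∧
      ∑ i, q.1 * q.2 i * lineDeriv ℝ Γ x (EuclideanSpace.single i 1) = 0 := by
  have hε := hc.pos
  have hnull := (ae_restrict_iff' isClosed_frontier.measurableSet).1 hb
  rw [ae_iff] at hnull
  have h1 := measure_eq_zero_iff_ae_notMem.1 (hc.isHeight.volume_foot_preimage_eq_zero hd hnull)
  filter_upwards [h1, hc.lip.ae_differentiableAt (μ := volume)] with x hx1 hx2
  set y := foot e Γ x with hy
  have hxy : x = y + Γ x • e := by rw [hy, foot, sub_add_cancel]
  have hΓy : Γ y = 0 := hc.isHeight.apply_foot x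
  by_cases hyb : y ∈ Metric.ball z (ε / 2)
  · have hyb' : y ∈ Metric.ball z ε := Metric.ball_subset_ball (by linarith) hyb
    have h2 : ¬ ¬ _ := hx1
    obtain ⟨n, p, c, hn, hp, htr, hpc⟩ := not_not.1 h2 (hc.mem_frontier hyb' hΓy)
    have hin : ∀ᶠ n in atTop, ∀ w ∈ tsupport (k n), y + w ∈ Ω := by
      filter_upwards [hk.tendsto.eventually (gt_mem_nhds (half_pos hε))] with n hn w hw
      exact hc.add_mem hk hn hyb hΓy.ge hw
    refine ⟨(ψ y * c, fun i => φ y * p i),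
      (hk.tendsto_mollify_of_isTraceAt hΩ hv hin htr).const_mul _,
      fun i => (hk.tendsto_mollify_of_isTraceAt hΩ (hU i) hin (hp i)).const_mul _, ?_⟩
    have hdy : DifferentiableAt ℝ Γ y := by
      have e1 : Γ = fun w => Γ (w + Γ x • e) - Γ x := by
        ext w; rw [hc.shift]; ring
      rw [e1]
      refine DifferentiableAt.sub_const ?_ _
      rw [hxy] at hx2
      refine DifferentiableAt.comp y (g := Γ) ?_ (by fun_prop)
      exact hx2
    have hl : ∀ i, lineDeriv ℝ Γ x (EuclideanSpace.single i 1)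
        = fderiv ℝ Γ y (EuclideanSpace.single i 1) := fun i => by
      rw [← hdy.lineDeriv_eq_fderiv]
      conv_lhs => rw [hxy]
      rw [hc.isHeight.lineDeriv_shift]
    have hs : ∑ i, ψ y * c * (φ y * p i) * lineDeriv ℝ Γ x (EuclideanSpace.single i 1)
        = ψ y * φ y * (c * fderiv ℝ Γ y p) := by
      rw [← sum_apply_single, Finset.mul_sum, Finset.mul_sum]
      refine Finset.sum_congr rfl fun i _ => ?_
      rw [hl]; ring
    change ∑ i, ψ y * c * (φ y * p i) * lineDeriv ℝ Γ x (EuclideanSpace.single i 1) = 0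
    rw [hs]
    rcases mul_eq_zero.1 hpc with h | h
    · rw [hc.fderiv_eq_zero_of_isOuterNormalAt hyb' hΓy hdy hn h, mul_zero, mul_zero]
    · rw [h, zero_mul, mul_zero]
  · have hψ0 : ψ y = 0 := image_eq_zero_of_notMem_tsupport fun h => hyb (hψs h)
    have hφ0 : φ y = 0 := image_eq_zero_of_notMem_tsupport fun h => hyb (hφs h)
    refine ⟨(0, fun _ => 0), ?_, fun i => ?_, by simp⟩
    · simp only [hψ0, zero_mul]; exact tendsto_const_nhds
    · simp only [hφ0, zero_mul]; exact tendsto_const_nhds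

theorem IsHeight.memLp_comp_foot (h : IsHeight e Γ K) {w : Eu d → ℝ} (hw : ContDiff ℝ 1 w)
    (hwc : HasCompactSupport w) :
    MemLp (fun x => w (foot e Γ x)) 2 (volume.restrict (layer Γ 1)) := by
  refine memLp_two_of_lintegral_lt_top
    (hw.continuous.comp h.continuous_foot).aestronglyMeasurable ?_
  refine (h.lintegral_foot_sq_le hw one_pos).trans_lt ?_
  have h1 : ∫⁻ x in layer Γ 1, ‖w x‖ₑ ^ 2 ≠ ⊤ :=
    lintegral_sq_ne_top ((hw.continuous.memLp_of_hasCompactSupport hwc).restrict _)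
  have hD : Continuous fun x => fderiv ℝ w x e :=
    (hw.continuous_fderiv one_ne_zero).clm_apply continuous_const
  have h2 : ∫⁻ x in layer Γ 1, ‖fderiv ℝ w x e‖ₑ ^ 2 ≠ ⊤ :=
    lintegral_sq_ne_top ((hD.memLp_of_hasCompactSupport (hwc.fderiv_apply ℝ e)).restrict _)
  finiteness

/-- The boundary integrals of the mollified products tend to `0`. -/
theorem IsChart.tendsto_boundary_integral (hd : 1 ≤ d) (hc : IsChart Ω z e Γ K ε)
    (hΩ : MeasurableSet Ω) (hk : IsInwardKernelSeq Γ k s A) {ψ φ β v : Eu d → ℝ}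
    (hψ : ContDiff ℝ ∞ ψ) (hψs : tsupport ψ ⊆ Metric.ball z (ε / 2))
    (hφ : ContDiff ℝ ∞ φ) (hφs : tsupport φ ⊆ Metric.ball z (ε / 2))
    (hψφ : ∀ x, φ x = φ x * ψ x) (hβ2 : MemLp β 2 (volume.restrict Ω))
    (hβ : MemLp β ⊤ (volume.restrict Ω)) {Dv : Eu d → Eu d} (hv : IsSobolevPair Ω v Dv)
    {U : Fin d → Eu d → ℝ} {DU : Fin d → Eu d → Eu d} (hU : ∀ i, IsSobolevPair Ω (U i) (DU i))
    (hb : BoundaryFluxVanishes Ω U v) :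
    Tendsto (fun n => ∑ i, ∫ x in layer Γ 1, φ (foot e Γ x)
        * mollify (k n) (Ω.indicator β) (foot e Γ x) * mollify (k n) (Ω.indicator v) (foot e Γ x)
        * mollify (k n) (Ω.indicator (U i)) (foot e Γ x)
        * lineDeriv ℝ Γ x (EuclideanSpace.single i 1)) atTop (𝓝 0) := by
  have hm := hk.isMollifier
  have hheight := hc.isHeight
  have hcomp : ∀ {q : Eu d → ℝ}, tsupport q ⊆ Metric.ball z (ε / 2) → HasCompactSupport q :=
    fun hq => (isCompact_closedBall z (ε / 2)).of_isClosed_subset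
      (isClosed_tsupport _) (hq.trans Metric.ball_subset_closedBall)
  obtain ⟨cb, hcb⟩ := exists_ae_abs_indicator_le hΩ hβ
  set μ := (volume : Measure (Eu d)).restrict (layer Γ 1) with hμ
  obtain ⟨q, hae⟩ := exists_ae_of_ae_exists (μ := μ) (ae_restrict_of_ae
    (hc.ae_tendsto_boundary hd hΩ hk hψs hφs hv.memLp (fun i => (hU i).memLp) hb))
  -- `L²` convergence on the layer of a cut-off mollified function
  have hL : ∀ {χ f : Eu d → ℝ} {g : Eu d → Eu d} {l : Eu d → ℝ}, ContDiff ℝ ∞ χ →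
      tsupport χ ⊆ Metric.ball z (ε / 2) → IsSobolevPair Ω f g →
      (∀ᵐ x ∂μ, Tendsto (fun n => χ (foot e Γ x) * mollify (k n) (Ω.indicator f) (foot e Γ x))
        atTop (𝓝 (l x))) →
      (∀ n, MemLp (fun x => χ (foot e Γ x) * mollify (k n) (Ω.indicator f) (foot e Γ x)) 2 μ) ∧
      Tendsto (fun n => ∫⁻ x, ‖χ (foot e Γ x) * mollify (k n) (Ω.indicator f) (foot e Γ x)
        - l x‖ₑ ^ 2 ∂μ) atTop (𝓝 0) ∧ MemLp l 2 μ := by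
    intro χ f g l hχ hχs hf hlim
    have hF : ∀ n, MemLp (fun x => χ (foot e Γ x)
        * mollify (k n) (Ω.indicator f) (foot e Γ x)) 2 μ := fun n =>
      hheight.memLp_comp_foot (w := fun y => χ y * mollify (k n) (Ω.indicator f) y)
        ((hχ.mul (hf.contDiff_mollify hΩ (hm n))).of_le (by simp)) ((hcomp hχs).mul_right)
    have ht := tendsto_lintegral_sub_of_cauchy (fun n => (hF n).1)
      (fun η hη => hc.exists_lintegral_foot_sub_sq_le hΩ hk hχ hχs hf hη) hlim
    exact ⟨hF, ht, memLp_of_tendsto_lintegral_sub hF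
      (aestronglyMeasurable_of_tendsto_ae atTop (fun n => (hF n).1) hlim) ht⟩
  obtain ⟨hV, hVt, hVl⟩ := hL hψ hψs hv (hae.mono fun x hx => hx.1)
  have hUi := fun i => hL hφ hφs (hU i) (hae.mono fun x hx => hx.2.1 i)
  have hν : ∀ i : Fin d, Measurable fun x => lineDeriv ℝ Γ x (EuclideanSpace.single i (1 : ℝ)) :=
    fun i => measurable_lineDeriv hheight.continuous
  have hνb : ∀ (i : Fin d) x, |lineDeriv ℝ Γ x (EuclideanSpace.single i (1 : ℝ))| ≤ K :=
    fun i x => by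
      have := norm_lineDeriv_le_of_lipschitz ℝ (v := EuclideanSpace.single i (1 : ℝ)) hheight.lip
        (x₀ := x)
      simpa using this
  have hβn : ∀ n, Continuous fun x => mollify (k n) (Ω.indicator β) (foot e Γ x) := fun n =>
    (PDELearning.contDiff_mollify (hm n) ((memLp_indicator hΩ hβ2).locallyIntegrable
      (by norm_num))).continuous.comp hheight.continuous_foot
  set b : Fin d → ℕ → Eu d → ℝ := fun i n x => mollify (k n) (Ω.indicator β) (foot e Γ x)
    * lineDeriv ℝ Γ x (EuclideanSpace.single i 1) with hbdef
  have hbm : ∀ i n, AEStronglyMeasurable (b i n) μ := fun i n =>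
    (hβn n).aestronglyMeasurable.mul (hν i).aestronglyMeasurable
  have hbb : ∀ i n x, |b i n x| ≤ cb * K := fun i n x => by
    have h := abs_mollify_le (hm n) hcb (foot e Γ x)
    rw [hbdef, abs_mul]
    exact mul_le_mul h (hνb i x) (abs_nonneg _) ((abs_nonneg _).trans h)
  -- the deviation of the products `v U i` on the boundary from their limits
  set D : Fin d → ℕ → Eu d → ℝ := fun i n x =>
    ψ (foot e Γ x) * mollify (k n) (Ω.indicator v) (foot e Γ x)
      * (φ (foot e Γ x) * mollify (k n) (Ω.indicator (U i)) (foot e Γ x))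
      - (q x).1 * (q x).2 i with hDdef
  have hql : ∀ i, Integrable (fun x => (q x).1 * (q x).2 i) μ := fun i =>
    hVl.integrable_mul (hUi i).2.2
  have hD : ∀ i n, Integrable (D i n) μ := fun i n =>
    ((hV n).integrable_mul ((hUi i).1 n)).sub (hql i)
  have hlim : Tendsto (fun n => ∑ i, ∫ x, b i n x * D i n x ∂μ) atTop (𝓝 (∑ _i : Fin d, 0)) :=
    tendsto_finsetSum _ fun i _ => tendsto_integral_bdd_mul_zero (hbm i) (hbb i) (hD i)
      (tendsto_lintegral_mul_sub hVl (hUi i).2.2 (fun n => (hV n).1) (fun n => ((hUi i).1 n).1)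
        hVt (hUi i).2.1)
  rw [Finset.sum_const_zero] at hlim
  refine hlim.congr fun n => ?_
  -- with the limits in place of the mollified `v` and `U`, the flux already vanishes pointwise
  have hzero : ∑ i, ∫ x, b i n x * ((q x).1 * (q x).2 i) ∂μ = 0 := by
    rw [← integral_finsetSum _ fun i _ =>
      (hql i).bdd_mul (hbm i n) (ae_of_all _ (hbb i n))]
    refine integral_eq_zero_of_ae ?_
    filter_upwards [hae] with x hx
    have h2 := hx.2.2
    have e1 : ∑ i, b i n x * ((q x).1 * (q x).2 i)
        = mollify (k n) (Ω.indicator β) (foot e Γ x)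
          * ∑ i, (q x).1 * (q x).2 i * lineDeriv ℝ Γ x (EuclideanSpace.single i 1) := by
      rw [Finset.mul_sum]
      refine Finset.sum_congr rfl fun i _ => ?_
      simp only [hbdef]; ring
    rw [e1, h2, mul_zero]
    rfl
  rw [← add_zero (∑ i, ∫ x, b i n x * D i n x ∂μ), ← hzero, ← Finset.sum_add_distrib]
  refine Finset.sum_congr rfl fun i _ => ?_
  rw [← integral_add ((hD i n).bdd_mul (hbm i n) (ae_of_all _ (hbb i n)))
    ((hql i).bdd_mul (hbm i n) (ae_of_all _ (hbb i n)))]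
  refine integral_congr_ae (ae_of_all _ fun x => ?_)
  simp only [hbdef, hDdef]
  linear_combination (-(mollify (k n) (Ω.indicator β) (foot e Γ x)
    * lineDeriv ℝ Γ x (EuclideanSpace.single i 1) * mollify (k n) (Ω.indicator v) (foot e Γ x)
    * mollify (k n) (Ω.indicator (U i)) (foot e Γ x))) * hψφ (foot e Γ x)

end

/-! ### Green's formula on a Lipschitz domain -/

section
variable {d : ℕ} {Ω : Set (Eu d)}

/-- Green's formula with a cut-off supported in a chart. -/
theorem IsChart.sum_integral_greenIntegrand_eq_zero (hd : 1 ≤ d) {z e : Eu d} {Γ : Eu d → ℝ}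
    {K : ℝ≥0} {ε : ℝ} (hc : IsChart Ω z e Γ K ε) (hΩ : MeasurableSet Ω) (hfin : volume Ω ≠ ⊤)
    {φ β v : Eu d → ℝ} {Dβ Dv : Eu d → Eu d} {U : Fin d → Eu d → ℝ} {DU : Fin d → Eu d → Eu d}
    (hφ : ContDiff ℝ ∞ φ) (hφs : tsupport φ ⊆ Metric.ball z (ε / 4)) (hβ : MemW1inf Ω β Dβ)
    (hv : IsSobolevPair Ω v Dv) (hU : ∀ i, IsSobolevPair Ω (U i) (DU i))
    (hb : BoundaryFluxVanishes Ω U v) :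
    ∑ i, ∫ x in Ω, greenIntegrand φ β Dβ v Dv (U i) (DU i) (EuclideanSpace.single i 1) x = 0 := by
  have hε := hc.pos
  have : IsFiniteMeasure (volume.restrict Ω) := ⟨by simpa using hfin.lt_top⟩
  have hβ2 : IsSobolevPair Ω β Dβ :=
    ⟨hβ.memLp.mono_exponent le_top, hβ.memLp_grad.mono_exponent le_top, hβ.weak⟩
  have hφs2 : tsupport φ ⊆ Metric.ball z (ε / 2) :=
    hφs.trans (Metric.ball_subset_ball (by linarith))
  have hφc : HasCompactSupport φ := (isCompact_closedBall z (ε / 2)).of_isClosed_subset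
    (isClosed_tsupport φ) (hφs2.trans Metric.ball_subset_closedBall)
  -- a second cut-off, equal to `1` on the support of `φ`: one for `v` and one for `U`
  let ψ : ContDiffBump z := ⟨ε / 4, 3 * ε / 8, by linarith, by linarith⟩
  have hψs : tsupport ψ ⊆ Metric.ball z (ε / 2) := by
    rw [ψ.tsupport_eq]
    exact Metric.closedBall_subset_ball (by change 3 * ε / 8 < ε / 2; linarith)
  have hψφ : ∀ x, φ x = φ x * ψ x := fun x => by
    by_cases hx : x ∈ tsupport φ
    · rw [ψ.one_of_mem_closedBall (Metric.ball_subset_closedBall (hφs hx)), mul_one]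
    · rw [image_eq_zero_of_notMem_tsupport hx, zero_mul]
  obtain ⟨k, s, A, hk⟩ := hc.isHeight.exists_isInwardKernelSeq
  have h1 := tendsto_finsetSum (Finset.univ : Finset (Fin d)) fun i _ =>
    hc.tendsto_integral_fderiv hΩ hfin hk hφ hφs2 hβ hv (hU i) (EuclideanSpace.single i 1)
  have h2 := (hc.tendsto_boundary_integral hd hΩ hk ψ.contDiff hψs hφ hφs2 hψφ hβ2.memLp hβ.memLp
    hv hU hb).neg
  rw [neg_zero] at h2
  refine tendsto_nhds_unique h1 (h2.congr fun n => ?_)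
  rw [← Finset.sum_neg_distrib]
  refine Finset.sum_congr rfl fun i _ => ?_
  have hm := hk.isMollifier n
  rw [hc.isHeight.integral_fderiv_epigraph (G := fun x => φ x * mollify (k n) (Ω.indicator β) x
    * mollify (k n) (Ω.indicator v) x * mollify (k n) (Ω.indicator (U i)) x) ?_ ?_ _ one_pos,
    inv_one, one_mul]
  · exact (((hφ.mul (hβ2.contDiff_mollify hΩ hm)).mul (hv.contDiff_mollify hΩ hm)).mul
      ((hU i).contDiff_mollify hΩ hm)).of_le (by simp)
  · exact (hφc.mul_right.mul_right).mul_right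

open scoped Manifold in
/-- A partition of unity on the closure of `Ω` by smooth functions supported in charts. -/
theorem IsLipschitzDomain.exists_partition (hd : 1 ≤ d) (hΩ : IsLipschitzDomain Ω) :
    ∃ (ι : Type) (_ : Fintype ι) (φ : ι → Eu d → ℝ), (∀ j, ContDiff ℝ ∞ (φ j)) ∧
      (∀ x ∈ Ω, ∑ j, φ j x = 1) ∧
      ∀ j, ∃ z e Γ K ε, IsChart Ω z e Γ K ε ∧ tsupport (φ j) ⊆ Metric.ball z (ε / 4) := by
  choose! e Γ K ε hc using fun (z : Eu d) (hz : z ∈ closure Ω) => exists_isChart hd hΩ hz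
  obtain ⟨t, ht, hcov⟩ := (isCompact_closure hΩ).elim_nhds_subcover
    (fun z => Metric.ball z (ε z / 4))
    (fun z hz => Metric.ball_mem_nhds z (by linarith [(hc z hz).pos]))
  obtain ⟨f, hf⟩ := SmoothPartitionOfUnity.exists_isSubordinate (𝓘(ℝ, Eu d))
    (isClosed_closure (s := Ω)) (fun z : Fin t.card => Metric.ball ((t.equivFin.symm z : t) : Eu d)
      (ε (t.equivFin.symm z : t) / 4)) (fun _ => Metric.isOpen_ball) (by
        intro x hx
        obtain ⟨z, hz, hxz⟩ := mem_iUnion₂.1 (hcov hx)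
        refine mem_iUnion.2 ⟨t.equivFin ⟨z, hz⟩, ?_⟩
        simpa using hxz)
  refine ⟨Fin t.card, inferInstance, fun j => f j, fun j => (f j).contMDiff.contDiff, ?_, ?_⟩
  · intro x hx
    rw [← finsum_eq_sum_of_fintype]
    exact f.sum_eq_one (subset_closure hx)
  · intro j
    exact ⟨_, _, _, _, _, hc _ (ht _ (t.equivFin.symm j).2), hf j⟩

/-- Green's formula on a Lipschitz domain: `∫_Ω ∇·(βvU) = 0` if the flux of `vU` through the
boundary vanishes. -/
theorem IsLipschitzDomain.sum_integral_eq_zero (hd : 1 ≤ d) (hΩ : IsLipschitzDomain Ω)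
    {β v : Eu d → ℝ} {Dβ Dv : Eu d → Eu d} {U : Fin d → Eu d → ℝ} {DU : Fin d → Eu d → Eu d}
    (hβ : MemW1inf Ω β Dβ) (hv : IsSobolevPair Ω v Dv) (hU : ∀ i, IsSobolevPair Ω (U i) (DU i))
    (hb : BoundaryFluxVanishes Ω U v) :
    ∑ i, ∫ x in Ω, (Dβ x i * v x * U i x + β x * Dv x i * U i x + β x * v x * DU i x i) = 0 := by
  obtain ⟨ι, _, φ, hφ, hsum, hch⟩ := hΩ.exists_partition hd
  have hfin : volume Ω ≠ ⊤ := hΩ.isBounded.measure_lt_top.ne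
  have hm := hΩ.isOpen.measurableSet
  have hloc : ∀ j, ∑ i, ∫ x in Ω, greenIntegrand (φ j) β Dβ v Dv (U i) (DU i)
      (EuclideanSpace.single i 1) x = 0 := fun j => by
    obtain ⟨z, e, Γ, K, ε, hc, hs⟩ := hch j
    exact hc.sum_integral_greenIntegrand_eq_zero hd hm hfin (hφ j) hs hβ hv hU hb
  have hcomp : ∀ j, HasCompactSupport (φ j) := fun j => by
    obtain ⟨z, e, Γ, K, ε, hc, hs⟩ := hch j
    exact (isCompact_closedBall z (ε / 4)).of_isClosed_subset
      (isClosed_tsupport _) (hs.trans Metric.ball_subset_closedBall)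
  have hall := Finset.sum_eq_zero fun j (_ : j ∈ (Finset.univ : Finset ι)) => hloc j
  rw [Finset.sum_comm] at hall
  rw [← hall]
  refine Finset.sum_congr rfl fun i _ => ?_
  rw [← integral_finsetSum _ fun j _ => integrable_greenIntegrand (hφ j) (hcomp j) hβ hv (hU i) _]
  refine setIntegral_congr_fun hm fun x hx => ?_
  have h1 := hsum x hx
  have h2 : ∑ j, fderiv ℝ (φ j) x (EuclideanSpace.single i 1) = 0 := by
    have h3 : (fun y => ∑ j, φ j y) =ᶠ[𝓝 x] fun _ => 1 := by
      filter_upwards [hΩ.isOpen.mem_nhds hx] with y hy using hsum y hy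
    have h4 := h3.fderiv_eq (𝕜 := ℝ)
    rw [fderiv_fun_sum fun j _ => (hφ j).differentiable (by simp) x] at h4
    have h5 := congrArg (fun L : Eu d →L[ℝ] ℝ => L (EuclideanSpace.single i 1)) h4
    simpa using h5
  have h6 : ∑ j, greenIntegrand (φ j) β Dβ v Dv (U i) (DU i) (EuclideanSpace.single i 1) x
      = (∑ j, fderiv ℝ (φ j) x (EuclideanSpace.single i 1)) * (β x * v x * U i x)
        + (∑ j, φ j x) * (Dβ x i * v x * U i x + β x * Dv x i * U i x + β x * v x * DU i x i) := by
    rw [Finset.sum_mul, Finset.sum_mul, ← Finset.sum_add_distrib]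
    refine Finset.sum_congr rfl fun j _ => ?_
    simp only [greenIntegrand, EuclideanSpace.inner_single_right, conj_trivial, one_mul]
    ring
  change _ = ∑ j, greenIntegrand (φ j) β Dβ v Dv (U i) (DU i) (EuclideanSpace.single i 1) x
  rw [h6, h1, h2]
  ring

end

/-! ### The error estimate -/

theorem abs_integral_mul_mul_le {X : Type*} [MeasurableSpace X] {μ : Measure X} {b f h : X → ℝ}
    {c : ℝ} (hc0 : 0 ≤ c) (hc : ∀ᵐ x ∂μ, |b x| ≤ c) (hf : MemLp f 2 μ) (hh : MemLp h 2 μ) :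
    |∫ x, b x * f x * h x ∂μ| ≤ c * (eLpNorm f 2 μ).toReal * (eLpNorm h 2 μ).toReal := by
  have hfh : Integrable (fun x => f x * h x) μ := hf.integrable_mul hh
  have e1 : ∀ g : X → ℝ, (∫⁻ x, ‖g x‖ₑ ^ 2 ∂μ) ^ (1 / 2 : ℝ) = eLpNorm g 2 μ := fun g => by
    rw [lintegral_enorm_sq_eq, ← ENNReal.rpow_natCast, ← ENNReal.rpow_mul]
    norm_num
  have h1 := lintegral_enorm_mul_le hf.1 hh.1
  rw [e1, e1] at h1
  calc |∫ x, b x * f x * h x ∂μ| ≤ ∫ x, c * ‖f x * h x‖ ∂μ := by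
        refine norm_integral_le_of_norm_le (f := fun x => b x * f x * h x) (hfh.norm.const_mul c) ?_
        filter_upwards [hc] with x hx
        rw [mul_assoc, norm_mul]
        exact mul_le_mul_of_nonneg_right hx (norm_nonneg _)
    _ = c * (∫⁻ x, ‖f x * h x‖ₑ ∂μ).toReal := by
        rw [integral_const_mul, integral_norm_eq_lintegral_enorm hfh.1]
    _ ≤ c * ((eLpNorm f 2 μ).toReal * (eLpNorm h 2 μ).toReal) := by
        rw [← ENNReal.toReal_mul]
        exact mul_le_mul_of_nonneg_left
          (ENNReal.toReal_mono (ENNReal.mul_ne_top hf.2.ne hh.2.ne) h1) hc0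
    _ = _ := by ring

section
variable {d : ℕ} {Ω : Set (Eu d)}

theorem ae_norm_le_linfNorm {F : Type*} [NormedAddCommGroup F] {f : Eu d → F}
    (hf : MemLp f ⊤ (volume.restrict Ω)) : ∀ᵐ x ∂(volume.restrict Ω), ‖f x‖ ≤ linfNorm Ω f := by
  filter_upwards [ae_le_eLpNormEssSup (f := f) (μ := volume.restrict Ω)] with x hx
  rw [linfNorm, ← toReal_enorm, eLpNorm_exponent_top]
  refine ENNReal.toReal_mono ?_ hx
  rw [← eLpNorm_exponent_top]
  exact hf.2.ne

theorem isSobolevPair (v : H1 Ω) : IsSobolevPair Ω (sobVal v) (sobGrad v) :=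
  ⟨Lp.memLp _, Lp.memLp _, v.2⟩

theorem memLp_apply {E : Type*} [MeasurableSpace E] {μ : Measure E} {p : ℝ≥0∞} {g : E → Eu d}
    (hg : MemLp g p μ) (i : Fin d) : MemLp (fun x => g x i) p μ := by
  simpa [EuclideanSpace.inner_single_right] using
    hg.inner_const (𝕜 := ℝ) (EuclideanSpace.single i (1 : ℝ))

theorem abs_apply_le_norm (x : Eu d) (i : Fin d) : |x i| ≤ ‖x‖ := by
  simpa using PiLp.norm_apply_le x i

/-- For `u ∈ H²(Ω)` the functional `v ↦ ∫ β ∇u · ∇v` is bounded in the `L²`-norm, by partial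
integration; the boundary integral vanishes. -/
theorem MemH2.exists_abs_integral_le (hd : 1 ≤ d) (hΩ : IsLipschitzDomain Ω) {u : H1 Ω}
    (hu : MemH2 u) : ∃ C : ℝ, 0 ≤ C ∧ ∀ (β : Eu d → ℝ) (Dβ : Eu d → Eu d), MemW1inf Ω β Dβ →
      ∀ v : H1 Ω, BoundaryProductVanishes u v →
      |∫ x in Ω, β x * inner ℝ (sobGrad u x) (sobGrad v x)|
        ≤ C * w1infNorm Ω β Dβ * ‖sobVal v‖ := by
  choose w hw using hu
  set μ := (volume : Measure (Eu d)).restrict Ω with hμ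
  refine ⟨∑ i, ((eLpNorm (fun x => sobGrad u x i) 2 μ).toReal
    + (eLpNorm (fun x => sobGrad (w i) x i) 2 μ).toReal),
    Finset.sum_nonneg fun i _ => by positivity, fun β Dβ hβ v hv => ?_⟩
  have hU : ∀ i, IsSobolevPair Ω (fun x => sobGrad u x i) (sobGrad (w i)) := fun i =>
    ⟨memLp_apply (Lp.memLp (sobGrad u)) i, Lp.memLp _, fun φ hφ a => by
      refine Eq.trans ?_ ((w i).2 φ hφ a)
      refine integral_congr_ae ?_
      filter_upwards [hw i] with x hx
      rw [← hx]
      rfl⟩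
  have hV := isSobolevPair v
  have hgreen := hΩ.sum_integral_eq_zero hd hβ hV hU hv
  set W := w1infNorm Ω β Dβ with hW
  have hW0 : 0 ≤ W := le_max_of_le_left ENNReal.toReal_nonneg
  have hβW : ∀ᵐ x ∂μ, |β x| ≤ W := (ae_norm_le_linfNorm hβ.memLp).mono fun x hx =>
    hx.trans (le_max_left _ _)
  have hDW : ∀ i, ∀ᵐ x ∂μ, |Dβ x i| ≤ W := fun i =>
    (ae_norm_le_linfNorm hβ.memLp_grad).mono fun x hx =>
      (abs_apply_le_norm _ i).trans (hx.trans (le_max_right _ _))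
  have hnorm : (eLpNorm (sobVal v) 2 μ).toReal = ‖sobVal v‖ := (Lp.norm_def _).symm
  have int : ∀ {b f h : Eu d → ℝ}, MemLp b ⊤ μ → MemLp f 2 μ → MemLp h 2 μ →
      Integrable (fun x => b x * f x * h x) μ := fun {b f h} hb hf hh => by
    have h1 := (hf.integrable_mul hh).bdd_mul hb.1 (ae_norm_le_linfNorm hb)
    refine h1.congr (ae_of_all _ fun x => ?_)
    simp only [Pi.mul_apply]; ring
  have i1 := fun i => int (memLp_apply hβ.memLp_grad i) hV.memLp (hU i).memLp
  have i2 := fun i => int hβ.memLp (memLp_apply hV.memLp_grad i) (hU i).memLp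
  have i3 := fun i => int hβ.memLp hV.memLp (memLp_apply (hU i).memLp_grad i)
  have hsplit : ∫ x, β x * inner ℝ (sobGrad u x) (sobGrad v x) ∂μ
      = - ∑ i, ((∫ x, Dβ x i * sobVal v x * sobGrad u x i ∂μ)
        + ∫ x, β x * sobVal v x * sobGrad (w i) x i ∂μ) := by
    have e1 : ∫ x, β x * inner ℝ (sobGrad u x) (sobGrad v x) ∂μ
        = ∑ i, ∫ x, β x * sobGrad v x i * sobGrad u x i ∂μ := by
      rw [← integral_finsetSum _ fun i _ => i2 i]
      refine integral_congr_ae (ae_of_all _ fun x => ?_)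
      simp only [PiLp.inner_apply, Finset.mul_sum]
      refine Finset.sum_congr rfl fun i _ => ?_
      simp
      ring
    rw [e1, ← sub_eq_zero, sub_neg_eq_add, ← Finset.sum_add_distrib, ← hgreen]
    refine Finset.sum_congr rfl fun i _ => ?_
    have e2 := (integral_add ((i1 i).add (i2 i)) (i3 i)).trans
      (congrArg (· + _) (integral_add (i1 i) (i2 i)))
    refine Eq.trans ?_ e2.symm
    simp only
    ring
  rw [hsplit, abs_neg, Finset.sum_mul, Finset.sum_mul]
  refine (Finset.abs_sum_le_sum_abs _ _).trans (Finset.sum_le_sum fun i _ => ?_)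
  have h1 := abs_integral_mul_mul_le hW0 (hDW i) hV.memLp (hU i).memLp
  have h3 := abs_integral_mul_mul_le hW0 hβW hV.memLp (memLp_apply (hU i).memLp_grad i)
  rw [hnorm] at h1 h3
  refine (abs_add_le _ _).trans ((add_le_add h1 h3).trans (le_of_eq ?_))
  ring

/-- The data misfit of a Hölder continuous function is controlled by the size of the data sets. -/
theorem IsDataCovering.sum_sq_sub_average_le (hΩ : IsLipschitzDomain Ω) {m : ℕ}
    {B K : Fin m → Set (Eu d)} (h : IsDataCovering Ω B K) {M₁ : ℝ}
    (hM : (overlap Ω K : ℝ) ≤ M₁) {u : H1 Ω} {uc : Eu d → ℝ}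
    (huc : uc =ᵐ[volume.restrict Ω] sobVal u) {H lam : ℝ≥0}
    (hHol : HolderOnWith H lam uc (closure Ω)) {p : Fin m → Eu d} (hp : ∀ i, p i ∈ B i) :
    ∑ i, volume.real (B i) * (uc (p i) - ⨍ x in B i, sobVal u x) ^ 2
      ≤ M₁ * volume.real Ω * (H * maxDiam B ^ (lam : ℝ)) ^ 2 := by
  have hfin : volume Ω ≠ ⊤ := hΩ.isBounded.measure_lt_top.ne
  have hone : ∀ i, |uc (p i) - ⨍ x in B i, sobVal u x| ≤ H * maxDiam B ^ (lam : ℝ) := by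
    intro i
    have hBm := h.measure_B_ne_top i
    have hB0 : 0 < volume.real (B i) := ENNReal.toReal_pos (h.measure_B_pos i).ne' hBm
    have hint : IntegrableOn (sobVal u) (B i) := integrableOn_sobVal u (h.subset i) hBm
    have hfinB : IsFiniteMeasure (volume.restrict (B i)) := ⟨by simpa using hBm.lt_top⟩
    have hae : ∀ᵐ x ∂(volume.restrict (B i)), ‖uc (p i) - sobVal u x‖
        ≤ H * maxDiam B ^ (lam : ℝ) := by
      filter_upwards [ae_restrict_of_ae_restrict_of_subset (h.subset i) huc,
        ae_restrict_mem (h.isOpen i).measurableSet] with x hx hxB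
      rw [← hx, ← dist_eq_norm]
      have hdist : dist (p i) x ≤ maxDiam B :=
        (Metric.dist_le_diam_of_mem ((h.bounded i).subset (h.subset_K i)) (hp i) hxB).trans
          (diam_le_maxDiam B i)
      exact hHol.dist_le_of_le (subset_closure (h.subset i (hp i)))
        (subset_closure (h.subset i hxB)) hdist
    have e1 : volume.real (B i) * (uc (p i) - ⨍ x in B i, sobVal u x)
        = ∫ x in B i, (uc (p i) - sobVal u x) := by
      rw [integral_sub (integrable_const _) hint, setIntegral_const, smul_eq_mul, mul_sub,
        ← measure_smul_setAverage _ hBm, smul_eq_mul]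
    have h2 := norm_setIntegral_le_of_norm_le_const_ae' hBm.lt_top (C := H * maxDiam B ^ (lam : ℝ))
      ((ae_restrict_iff' (h.isOpen i).measurableSet).1 hae)
    rw [← e1, norm_mul, Real.norm_of_nonneg hB0.le, mul_comm] at h2
    exact le_of_mul_le_mul_right h2 hB0
  have hvol : ∑ i, volume.real (B i) ≤ M₁ * volume.real Ω := by
    have h1 := h.sum_lintegral_le hΩ.isOpen.measurableSet subset_rfl
      (I := Finset.univ) (fun i _ => h.subset i) (G := fun _ => 1) measurable_const
    simp only [lintegral_const, one_mul, Measure.restrict_apply_univ] at h1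
    have h2 := ENNReal.toReal_mono (ENNReal.mul_ne_top (by simp) hfin) h1
    rw [ENNReal.toReal_sum fun i _ => h.measure_B_ne_top i, ENNReal.toReal_mul,
      ENNReal.toReal_natCast] at h2
    exact h2.trans (mul_le_mul_of_nonneg_right hM measureReal_nonneg)
  calc ∑ i, volume.real (B i) * (uc (p i) - ⨍ x in B i, sobVal u x) ^ 2
      ≤ ∑ i, volume.real (B i) * (H * maxDiam B ^ (lam : ℝ)) ^ 2 := by
        refine Finset.sum_le_sum fun i _ => mul_le_mul_of_nonneg_left ?_ measureReal_nonneg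
        rw [← sq_abs]
        exact pow_le_pow_left₀ (abs_nonneg _) (hone i) 2
    _ ≤ _ := by
        rw [← Finset.sum_mul]
        exact mul_le_mul_of_nonneg_right hvol (sq_nonneg _)

/-- Young's inequality for the data misfit of `u`, tested with `e`. -/
theorem dataTerm_sub_dataForm_le {m : ℕ} (B : Fin m → Set (Eu d)) (b : Fin m → ℝ) (u e : H1 Ω) :
    dataTerm B b e - dataForm B u e
      ≤ ((∑ i, volume.real (B i) * (b i - ⨍ x in B i, sobVal u x) ^ 2) + dataForm B e e) / 2 := by
  rw [dataTerm, dataForm, dataForm, ← Finset.sum_sub_distrib, ← Finset.sum_add_distrib,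
    Finset.sum_div]
  refine Finset.sum_le_sum fun i _ => ?_
  have h0 : 0 ≤ volume.real (B i) := measureReal_nonneg
  nlinarith [mul_nonneg h0
    (sq_nonneg (b i - (⨍ x in B i, sobVal u x) - ⨍ x in B i, sobVal e x))]

/-- The elementary part of the estimate: absorption of the error norm. -/
theorem le_of_energy_estimate {E D b S P R X δ θ Θ a α₀ C₁ M N : ℝ} (hE : 0 ≤ E)
    (hP : 0 ≤ P) (hS : 0 ≤ S) (hα₀ : 0 < α₀) (ha : α₀ ≤ a) (hδ : 0 < δ) (hθ : 0 < θ)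
    (hΘ : θ⁻¹ ≤ Θ) (hC₁ : 0 < C₁) (hN1 : 1 ≤ N) (hNM : N ≤ M)
    (hX : X = R ^ 2 * N / (Real.pi ^ 2 * a)) (h1 : θ * X ≤ δ) (h2 : δ ≤ θ⁻¹ * X)
    (henergy : a * D ^ 2 + δ⁻¹ * b ≤ P * E + δ⁻¹ * ((S ^ 2 + b) / 2))
    (hpoin : E ^ 2 ≤ C₁ * (R ^ 2 * D ^ 2 + b)) (hb : 0 ≤ b) :
    E ≤ C₁ * (1 / α₀ + 2 * Θ * M / (Real.pi ^ 2 * α₀)) * R ^ 2 * P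
      + √(C₁ * (Real.pi ^ 2 * Θ / 2 + 1)) * S := by
  have hπ := Real.pi_pos
  have ha0 : 0 < a := hα₀.trans_le ha
  have hΘ0 : 0 < Θ := (inv_pos.2 hθ).trans_le hΘ
  have hM0 : 0 < M := by linarith
  have hX0 : 0 ≤ X := by rw [hX]; positivity
  have hPE : 0 ≤ P * E := mul_nonneg hP hE
  -- the two parts of the energy
  have hb2 : b ≤ 2 * δ * (P * E) + S ^ 2 := by
    have h3 : δ⁻¹ * b ≤ P * E + δ⁻¹ * ((S ^ 2 + b) / 2) := by nlinarith [sq_nonneg D]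
    have h4 := mul_le_mul_of_nonneg_left h3 hδ.le
    rw [mul_add, mul_inv_cancel_left₀ hδ.ne', mul_inv_cancel_left₀ hδ.ne'] at h4
    linarith
  have hD2 : D ^ 2 ≤ a⁻¹ * (P * E + δ⁻¹ * (S ^ 2 / 2)) := by
    rw [← div_eq_inv_mul, le_div_iff₀ ha0]
    have : 0 ≤ δ⁻¹ * b := mul_nonneg (inv_nonneg.2 hδ.le) hb
    nlinarith
  -- the balance of `δ`
  have hδ1 : δ ≤ Θ * (R ^ 2 * M / (Real.pi ^ 2 * α₀)) := by
    have hXle : X ≤ R ^ 2 * M / (Real.pi ^ 2 * α₀) := by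
      rw [hX]
      gcongr
    exact h2.trans (mul_le_mul hΘ hXle hX0 hΘ0.le)
  have hδ2 : R ^ 2 * a⁻¹ * δ⁻¹ ≤ Real.pi ^ 2 * Θ := by
    have h3 : R ^ 2 * a⁻¹ ≤ Real.pi ^ 2 * X := by
      have : Real.pi ^ 2 * X = R ^ 2 * a⁻¹ * N := by
        rw [hX]; field_simp
      rw [this]
      exact le_mul_of_one_le_right (by positivity) hN1
    have h4 : X ≤ Θ * δ := by
      have h5 : X ≤ θ⁻¹ * δ := by
        rw [← div_eq_inv_mul, le_div_iff₀ hθ]; linarith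
      exact h5.trans (mul_le_mul_of_nonneg_right hΘ hδ.le)
    rw [← div_eq_mul_inv, div_le_iff₀ hδ]
    nlinarith [sq_nonneg Real.pi, mul_le_mul_of_nonneg_left h4 (sq_nonneg Real.pi)]
  set p := C₁ * (1 / α₀ + 2 * Θ * M / (Real.pi ^ 2 * α₀)) * R ^ 2 * P with hp
  set q := √(C₁ * (Real.pi ^ 2 * Θ / 2 + 1)) with hq
  have hq2 : q ^ 2 = C₁ * (Real.pi ^ 2 * Θ / 2 + 1) := Real.sq_sqrt (by positivity)
  have hp0 : 0 ≤ p := by positivity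
  have hq0 : 0 ≤ q := Real.sqrt_nonneg _
  have hquad : E ^ 2 ≤ p * E + (q * S) ^ 2 := by
    have h3 : R ^ 2 * D ^ 2 ≤ R ^ 2 / α₀ * (P * E) + Real.pi ^ 2 * Θ * (S ^ 2 / 2) := by
      calc R ^ 2 * D ^ 2 ≤ R ^ 2 * (a⁻¹ * (P * E + δ⁻¹ * (S ^ 2 / 2))) :=
            mul_le_mul_of_nonneg_left hD2 (sq_nonneg R)
        _ = R ^ 2 * a⁻¹ * (P * E) + R ^ 2 * a⁻¹ * δ⁻¹ * (S ^ 2 / 2) := by ring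
        _ ≤ R ^ 2 / α₀ * (P * E) + Real.pi ^ 2 * Θ * (S ^ 2 / 2) := by
            have h5 : R ^ 2 * a⁻¹ ≤ R ^ 2 / α₀ := by
              rw [div_eq_mul_inv]
              gcongr
            gcongr
    have h4 : 2 * δ * (P * E) ≤ 2 * (Θ * (R ^ 2 * M / (Real.pi ^ 2 * α₀))) * (P * E) := by
      gcongr
    calc E ^ 2 ≤ C₁ * (R ^ 2 * D ^ 2 + b) := hpoin
      _ ≤ C₁ * ((R ^ 2 / α₀ * (P * E) + Real.pi ^ 2 * Θ * (S ^ 2 / 2))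
          + (2 * (Θ * (R ^ 2 * M / (Real.pi ^ 2 * α₀))) * (P * E) + S ^ 2)) := by
          refine mul_le_mul_of_nonneg_left ?_ hC₁.le
          linarith
      _ = p * E + (q * S) ^ 2 := by
          rw [mul_pow, hq2, hp]; ring
  by_contra! hlt
  have hqS : 0 ≤ q * S := mul_nonneg hq0 hS
  nlinarith

end

/-! ### The equation for the error -/

section
variable {d : ℕ} {Ω : Set (Eu d)}

theorem integrable_mul_inner_sobGrad {α : Eu d → ℝ} (hα : MemLp α ⊤ (volume.restrict Ω))
    (w v : H1 Ω) :
    Integrable (fun x => α x * inner ℝ (sobGrad w x) (sobGrad v x)) (volume.restrict Ω) :=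
  (L2.integrable_inner (𝕜 := ℝ) (sobGrad w) (sobGrad v)).bdd_mul hα.1 (ae_norm_le_linfNorm hα)

theorem integrable_mul_sobVal_mul_sobVal {σ : Eu d → ℝ} (hσ : MemLp σ ⊤ (volume.restrict Ω))
    (w v : H1 Ω) :
    Integrable (fun x => σ x * sobVal w x * sobVal v x) (volume.restrict Ω) := by
  have h := ((Lp.memLp (sobVal w)).integrable_mul (Lp.memLp (sobVal v))).bdd_mul hσ.1
    (ae_norm_le_linfNorm hσ)
  refine h.congr (ae_of_all _ fun x => ?_)
  simp only [Pi.mul_apply]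
  ring

theorem ellForm_eq {α σ : Eu d → ℝ} (hα : MemLp α ⊤ (volume.restrict Ω))
    (hσ : MemLp σ ⊤ (volume.restrict Ω)) (w v : H1 Ω) :
    ellForm α σ w v = (∫ x in Ω, α x * inner ℝ (sobGrad w x) (sobGrad v x))
      + ∫ x in Ω, σ x * sobVal w x * sobVal v x :=
  integral_add (integrable_mul_inner_sobGrad hα w v) (integrable_mul_sobVal_mul_sobVal hσ w v)

theorem ellForm_sub_left {α σ : Eu d → ℝ} (hα : MemLp α ⊤ (volume.restrict Ω))
    (hσ : MemLp σ ⊤ (volume.restrict Ω)) (w₁ w₂ v : H1 Ω) :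
    ellForm α σ (w₁ - w₂) v = ellForm α σ w₁ v - ellForm α σ w₂ v := by
  have hi : ∀ w : H1 Ω, Integrable (fun x => α x * inner ℝ (sobGrad w x) (sobGrad v x)
      + σ x * sobVal w x * sobVal v x) (volume.restrict Ω) := fun w =>
    (integrable_mul_inner_sobGrad hα w v).add (integrable_mul_sobVal_mul_sobVal hσ w v)
  rw [ellForm, ellForm, ellForm, ← integral_sub (hi w₁) (hi w₂)]
  refine integral_congr_ae ?_
  filter_upwards [Lp.coeFn_sub (sobVal w₁) (sobVal w₂), Lp.coeFn_sub (sobGrad w₁) (sobGrad w₂)]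
    with x h1 h2
  change α x * inner ℝ ((sobGrad w₁ - sobGrad w₂ : L2Vec Ω) x) (sobGrad v x)
    + σ x * (sobVal w₁ - sobVal w₂ : L2 Ω) x * sobVal v x = _
  rw [h1, h2, Pi.sub_apply, Pi.sub_apply, inner_sub_left]
  ring

theorem ellForm_sub_ellForm {α σ α' σ' : Eu d → ℝ} (hα : MemLp α ⊤ (volume.restrict Ω))
    (hσ : MemLp σ ⊤ (volume.restrict Ω)) (hα' : MemLp α' ⊤ (volume.restrict Ω))
    (hσ' : MemLp σ' ⊤ (volume.restrict Ω)) (w v : H1 Ω) :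
    ellForm α' σ' w v - ellForm α σ w v
      = (∫ x in Ω, (α' x - α x) * inner ℝ (sobGrad w x) (sobGrad v x))
        + ∫ x in Ω, (σ' x - σ x) * sobVal w x * sobVal v x := by
  rw [ellForm_eq hα hσ, ellForm_eq hα' hσ']
  simp only [sub_mul]
  rw [integral_sub (integrable_mul_inner_sobGrad hα' w v) (integrable_mul_inner_sobGrad hα w v),
    integral_sub (integrable_mul_sobVal_mul_sobVal hσ' w v)
      (integrable_mul_sobVal_mul_sobVal hσ w v)]
  ring

theorem IsCoefficientPair.le_ellForm {αmin : ℝ} {α σ : Eu d → ℝ}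
    (h : IsCoefficientPair Ω αmin α σ) (v : H1 Ω) :
    αmin * ‖sobGrad v‖ ^ 2 ≤ ellForm α σ v v := by
  rw [ellForm_eq h.memLp_α h.memLp_σ, ← real_inner_self_eq_norm_sq, L2.inner_def,
    ← integral_const_mul]
  have h1 : 0 ≤ ∫ x in Ω, σ x * sobVal v x * sobVal v x := by
    refine integral_nonneg_of_ae ?_
    filter_upwards [h.nonneg_σ] with x hx
    rw [mul_assoc]
    exact mul_nonneg hx (mul_self_nonneg _)
  refine le_add_of_le_of_nonneg (integral_mono_ae
    ((L2.integrable_inner (𝕜 := ℝ) (sobGrad v) (sobGrad v)).const_mul _)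
    (integrable_mul_inner_sobGrad h.memLp_α v v) ?_) h1
  filter_upwards [h.le_α] with x hx
  exact mul_le_mul_of_nonneg_right hx real_inner_self_nonneg

theorem abs_load_sub_load_le (f f' : L2 Ω) (v : H1 Ω) :
    |load f' v - load f v| ≤ ‖f' - f‖ * ‖sobVal v‖ := by
  have h : load f' v - load f v = inner ℝ (sobVal v) (f' - f) := by
    have hi : ∀ f : L2 Ω, Integrable (fun x => f x * sobVal v x) (volume.restrict Ω) :=
      fun f => (Lp.memLp f).integrable_mul (Lp.memLp (sobVal v))
    rw [load, load, ← integral_sub (hi f') (hi f), L2.inner_def]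
    refine integral_congr_ae ?_
    filter_upwards [Lp.coeFn_sub f' f] with x hx
    rw [hx]
    simp
    ring
  rw [h, mul_comm]
  exact abs_real_inner_le_norm _ _

theorem IsDataCovering.dataForm_sub_left {m : ℕ} {B K : Fin m → Set (Eu d)}
    (h : IsDataCovering Ω B K) (w₁ w₂ v : H1 Ω) :
    dataForm B (w₁ - w₂) v = dataForm B w₁ v - dataForm B w₂ v := by
  rw [dataForm, dataForm, dataForm, ← Finset.sum_sub_distrib]
  refine Finset.sum_congr rfl fun i _ => ?_
  have e : (⨍ x in B i, sobVal (w₁ - w₂) x)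
      = (⨍ x in B i, sobVal w₁ x) - ⨍ x in B i, sobVal w₂ x := by
    rw [setAverage_eq, setAverage_eq, setAverage_eq, ← smul_sub,
      ← integral_sub (integrableOn_sobVal w₁ (h.subset i) (h.measure_B_ne_top i))
        (integrableOn_sobVal w₂ (h.subset i) (h.measure_B_ne_top i))]
    congr 1
    exact integral_congr_ae (ae_restrict_of_ae_restrict_of_subset (h.subset i)
      (Lp.coeFn_sub (sobVal w₁) (sobVal w₂)))
  rw [e]
  ring

theorem w1infNorm_nonneg (β : Eu d → ℝ) (g : Eu d → Eu d) : 0 ≤ w1infNorm Ω β g :=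
  le_max_of_le_left ENNReal.toReal_nonneg

/-- The difference of the loads and of the forms at the exact solution `u`, tested with `e`. -/
theorem load_sub_ellForm_sub_le {αmin αmin' : ℝ} {α σ α' σ' : Eu d → ℝ} {Dβ : Eu d → Eu d}
    (hcoef : IsCoefficientPair Ω αmin α σ) (hcoef' : IsCoefficientPair Ω αmin' α' σ')
    (f f' : L2 Ω) {u e : H1 Ω} {C : ℝ} (hC : 0 ≤ C)
    (hgreen : |∫ x in Ω, (α' x - α x) * inner ℝ (sobGrad u x) (sobGrad e x)|
      ≤ C * w1infNorm Ω (fun x => α' x - α x) Dβ * ‖sobVal e‖) :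
    (load f' e - load f e) - (ellForm α' σ' u e - ellForm α σ u e)
      ≤ (1 + ‖sobVal u‖ + C) * (‖f' - f‖ + linfNorm Ω (fun x => σ' x - σ x)
        + w1infNorm Ω (fun x => α' x - α x) Dβ) * ‖sobVal e‖ := by
  have hs0 : 0 ≤ linfNorm Ω (fun x => σ' x - σ x) := ENNReal.toReal_nonneg
  have hw0 := w1infNorm_nonneg (Ω := Ω) (fun x => α' x - α x) Dβ
  have hσ := abs_integral_mul_mul_le (b := fun x => σ' x - σ x) hs0
    (ae_norm_le_linfNorm (hcoef'.memLp_σ.sub hcoef.memLp_σ))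
    (Lp.memLp (sobVal u)) (Lp.memLp (sobVal e))
  rw [← Lp.norm_def, ← Lp.norm_def] at hσ
  rw [ellForm_sub_ellForm hcoef.memLp_α hcoef.memLp_σ hcoef'.memLp_α hcoef'.memLp_σ]
  have h1 := (abs_le.1 (abs_load_sub_load_le f f' e)).2
  have h2 := (abs_le.1 hgreen).1
  have h3 := (abs_le.1 hσ).1
  have hf0 := norm_nonneg (f' - f)
  have hu0 := norm_nonneg (sobVal u)
  generalize linfNorm Ω (fun x => σ' x - σ x) = s at *
  generalize w1infNorm Ω (fun x => α' x - α x) Dβ = w at *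
  generalize ‖f' - f‖ = g at *
  have h4 : g + ‖sobVal u‖ * s + C * w ≤ (1 + ‖sobVal u‖ + C) * (g + s + w) := by
    nlinarith [mul_nonneg hu0 hf0, mul_nonneg hu0 hw0, mul_nonneg hC hf0, mul_nonneg hC hs0]
  have h5 := mul_le_mul_of_nonneg_right h4 (norm_nonneg (sobVal e))
  linarith

/-- The energy estimate for the error: the equation for `u' - u`, tested with itself. -/
theorem IsRegularizedSolution.energy_le {V : Submodule ℝ (H1 Ω)} {αmin αmin' : ℝ}
    {α σ α' σ' : Eu d → ℝ} {Dβ : Eu d → Eu d} {f f' : L2 Ω} {m : ℕ} {B K : Fin m → Set (Eu d)}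
    {b : Fin m → ℝ} {δ : ℝ} {u u' : H1 Ω} (hcoef : IsCoefficientPair Ω αmin α σ)
    (hcoef' : IsCoefficientPair Ω αmin' α' σ') (hcov : IsDataCovering Ω B K) (hδ : 0 < δ)
    (hu : IsExactSolution V α σ f u) (hu' : IsRegularizedSolution V α' σ' f' B b δ u')
    {C : ℝ} (hC : 0 ≤ C)
    (hgreen : ∀ v ∈ V, |∫ x in Ω, (α' x - α x) * inner ℝ (sobGrad u x) (sobGrad v x)|
      ≤ C * w1infNorm Ω (fun x => α' x - α x) Dβ * ‖sobVal v‖) :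
    αmin' * ‖sobGrad (u' - u)‖ ^ 2 + δ⁻¹ * dataForm B (u' - u) (u' - u)
      ≤ (1 + ‖sobVal u‖ + C) * (‖f' - f‖ + linfNorm Ω (fun x => σ' x - σ x)
          + w1infNorm Ω (fun x => α' x - α x) Dβ) * ‖sobVal (u' - u)‖
        + δ⁻¹ * (((∑ i, volume.real (B i) * (b i - ⨍ x in B i, sobVal u x) ^ 2)
          + dataForm B (u' - u) (u' - u)) / 2) := by
  have heV : u' - u ∈ V := V.sub_mem hu'.1 hu.1
  have h1 := hu.2 _ heV
  have h2 := hu'.2 _ heV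
  have h3 := ellForm_sub_left hcoef'.memLp_α hcoef'.memLp_σ u' u (u' - u)
  have h4 := hcov.dataForm_sub_left u' u (u' - u)
  have h5 := hcoef'.le_ellForm (u' - u)
  have h6 := mul_le_mul_of_nonneg_left (dataTerm_sub_dataForm_le B b u (u' - u))
    (inv_nonneg.2 hδ.le)
  have h7 := load_sub_ellForm_sub_le hcoef hcoef' f f' hC (hgreen _ heV)
  -- the difference of the two equations, with the forms at `u` moved to the right-hand side
  have hid : ellForm α' σ' (u' - u) (u' - u) + δ⁻¹ * dataForm B (u' - u) (u' - u)
      = (load f' (u' - u) - load f (u' - u))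
        + δ⁻¹ * (dataTerm B b (u' - u) - dataForm B u (u' - u))
        - (ellForm α' σ' u (u' - u) - ellForm α σ u (u' - u)) := by
    rw [h3, h4]
    linear_combination h2 - h1
  linarith

/-- The elementary part of the estimate with a constant that depends on the bounds for the
parameters only. -/
theorem exists_const_of_energy_estimate (M₀ Θ₀ : ℝ) {α₀ C₁ c₀ L : ℝ} (hα₀ : 0 < α₀)
    (hC₁ : 0 < C₁) (hc₀ : 0 < c₀) (hL : 0 ≤ L) :
    ∃ C : ℝ, 0 < C ∧ ∀ E D b T R δ θ a N G r : ℝ, 0 ≤ E → 0 ≤ b → 0 ≤ G → 0 ≤ r → α₀ ≤ a →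
      0 < δ → 0 < θ → θ⁻¹ ≤ Θ₀ → 1 ≤ N → N ≤ M₀ →
      δ ∈ Icc (θ * (R ^ 2 * N / (Real.pi ^ 2 * a))) (θ⁻¹ * (R ^ 2 * N / (Real.pi ^ 2 * a))) →
      a * D ^ 2 + δ⁻¹ * b ≤ c₀ * G * E + δ⁻¹ * ((T + b) / 2) → T ≤ (L * r) ^ 2 →
      E ^ 2 ≤ C₁ * (R ^ 2 * D ^ 2 + b) → E ≤ C * R ^ 2 * G + C * r := by
  set M₁ := max M₀ 1
  set Θ₁ := max Θ₀ 1
  have hM₁ : 0 < M₁ := lt_max_of_lt_right one_pos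
  have hΘ₁ : 0 < Θ₁ := lt_max_of_lt_right one_pos
  have hπ := Real.pi_pos
  set A := C₁ * (1 / α₀ + 2 * Θ₁ * M₁ / (Real.pi ^ 2 * α₀)) with hA
  set Q := √(C₁ * (Real.pi ^ 2 * Θ₁ / 2 + 1)) with hQ
  have hA0 : 0 < A := by positivity
  have hQ0 : 0 ≤ Q := Real.sqrt_nonneg _
  refine ⟨A * c₀ + Q * L, by positivity, ?_⟩
  intro E D b T R δ θ a N G r hE hb hG hr ha hδ hθ hΘ hN1 hN hδI henergy hT hpoin
  have henergy' : a * D ^ 2 + δ⁻¹ * b ≤ c₀ * G * E + δ⁻¹ * (((L * r) ^ 2 + b) / 2) := by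
    refine henergy.trans ?_
    gcongr
  have hmain := le_of_energy_estimate hE (mul_nonneg hc₀.le hG) (mul_nonneg hL hr) hα₀ ha hδ hθ
    (hΘ.trans (le_max_left Θ₀ 1)) hC₁ hN1 (hN.trans (le_max_left M₀ 1)) rfl hδI.1 hδI.2 henergy'
    hpoin hb
  have h1 : 0 ≤ Q * L * R ^ 2 * G := by positivity
  have h2 : 0 ≤ A * c₀ * r := by positivity
  linarith

end

end PDELearning

theorem mainTheorem4 {d : ℕ} (hd : 1 ≤ d) (Ω : Set (Eu d)) (hΩ : IsLipschitzDomain Ω)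
    (u : H1 Ω) (hu2 : MemH2 u)
    (lam : ℝ≥0) (hlam_pos : 0 < lam) (hlam_le : lam ≤ 1)
    (uc : Eu d → ℝ) (huc : uc =ᵐ[volume.restrict Ω] sobVal u)
    (hHol : ∃ H : ℝ≥0, HolderOnWith H lam uc (closure Ω))
    (M₀ η₀ Θ₀ α₀ : ℝ) (hα₀ : 0 < α₀) :
    ∃ C : ℝ, 0 < C ∧
      ∀ (αmin : ℝ) (α σ : Eu d → ℝ) (f : L2 Ω) (V : Submodule ℝ (H1 Ω)),
      IsCoefficientPair Ω αmin α σ →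
      IsTrialSpace α σ V →
      IsExactSolution V α σ f u →
      (∀ v ∈ V, BoundaryProductVanishes u v) →
      ∀ (αmin' : ℝ) (α' σ' : Eu d → ℝ) (f' : L2 Ω) (Dβ : Eu d → Eu d),
      α₀ ≤ αmin' →
      IsCoefficientPair Ω αmin' α' σ' →
      MemW1inf Ω (fun x => α' x - α x) Dβ →
      ∀ (m : ℕ) (B K : Fin m → Set (Eu d)) (p : Fin m → Eu d) (δ : ℝ) (u' : H1 Ω),
      IsDataCovering Ω B K →
      (∀ i, p i ∈ B i) →
      (overlap Ω K : ℝ) ≤ M₀ →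
      mismatch B K ≤ η₀ →
      0 < δ →
      IsWellBalanced Ω K αmin' δ Θ₀ →
      IsRegularizedSolution V α' σ' f' B (fun i => uc (p i)) δ u' →
      ‖sobVal u' - sobVal u‖ ≤
        C * maxDiam K ^ 2 *
            (‖f' - f‖ + linfNorm Ω (fun x => σ' x - σ x)
              + w1infNorm Ω (fun x => α' x - α x) Dβ)
          + C * maxDiam B ^ (lam : ℝ) := by
  obtain ⟨H, hH⟩ := hHol
  obtain ⟨C₁, hC₁, hpoin⟩ := exists_norm_sq_le hd hΩ M₀ η₀
  obtain ⟨C₂, hC₂, hgreen⟩ := hu2.exists_abs_integral_le hd hΩ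
  have hc₀ : 0 < 1 + ‖sobVal u‖ + C₂ := by linarith [norm_nonneg (sobVal u)]
  have hL : 0 ≤ √(M₀ * volume.real Ω) * H := mul_nonneg (Real.sqrt_nonneg _) H.2
  obtain ⟨C, hC, hmain⟩ := exists_const_of_energy_estimate M₀ Θ₀ hα₀ hC₁ hc₀ hL
  refine ⟨C, hC, ?_⟩
  intro αmin α σ f V hcoef _ hu hbdry αmin' α' σ' f' Dβ hα₀' hcoef' hβ m B K p δ u' hcov hp hM hη
    hδ ⟨θ, hθ, _, hθΘ, hδI⟩ hu'
  have hN1 : (1 : ℝ) ≤ overlap Ω K := by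
    exact_mod_cast hcov.one_le_overlap hΩ.isConnected.nonempty
  have hS : _ ≤ (√(M₀ * volume.real Ω) * H * maxDiam B ^ (lam : ℝ)) ^ 2 :=
    (hcov.sum_sq_sub_average_le hΩ hM huc hH hp).trans_eq (by
      rw [mul_assoc (√_), mul_pow (√_), Real.sq_sqrt
        (mul_nonneg (zero_le_one.trans (hN1.trans hM)) measureReal_nonneg)])
  exact hmain _ _ _ _ _ _ _ _ _ _ _ (norm_nonneg (sobVal (u' - u)))
    (dataForm_self_nonneg B (u' - u))
    (add_nonneg (add_nonneg (norm_nonneg _) ENNReal.toReal_nonneg) (w1infNorm_nonneg _ _))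
    (Real.rpow_nonneg (Real.iSup_nonneg fun i => Metric.diam_nonneg) _) hα₀' hδ hθ hθΘ hN1 hM hδI
    (hu'.energy_le hcoef hcoef' hcov hδ hu hC₂ fun v hv => hgreen _ Dβ hβ v (hbdry v hv)) hS
    (hpoin m B K hcov hM hη (u' - u))
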